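/- **Setting.** An *alignment* is a pair $(R,t)$ of a rotation matrix $R\in\mathbb{R}^{2\times2}$ ($R^TR=I$, $\det R=1$) and a vector $t\in\mathbb{R}^2$; it moves a point $p$ to $Rp-t$. Let $n\ge 3$ and let $A=((p_1,\ell_1),\dots,(p_n,\ell_n))$, where each $p_i$ is a point and each $\ell_i$ a line in $\mathbb{R}^2$. For a permutation $\pi$ of $[n]$ put $A_\pi=((p_1,\ell_{\pi(1)}),\dots,(p_n,\ell_{\pi(n)}))$. Let $z\ge1$ and $D_z((p,\ell),(R,t))=\min_{q\in\ell}\|Rp-t-q\|_z$. Let $r>0$ and let $\mathrm{lip}:[0,\infty)\to[0,\infty)$ be $r$-log-Lipschitz: non-decreasing, with $\mathrm{lip}(cx)\le c^r\,\mathrm{lip}(x)$ for all $c\ge1$, $x\ge0$. Put $$\mathrm{cost}\big(((p_i,\ell_i))_i,(R,t)\big)=\sum_{i=1}^n \mathrm{lip}\big(D_z((p_i,\ell_i),(R,t))\big),$$ and let $w=1$ if $z=2$, $w=\sqrt2$ otherwise. Write $J=\begin{pmatrix}0&-1\\1&0\end{pmatrix}$ and $\|\cdot\|=\|\cdot\|_2$.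 **Z-Configs**$(v,p,q,y)$, for a unit vector $v=(v_1,v_2)$ with $v_2\ne0$ and points $p,q,y$. Let $r_1=\|p-q\|$, $r_2=\|p-y\|$, $r_3=\|q-y\|$, $P=r_1\begin{pmatrix}v_1/v_2&1\\0&0\end{pmatrix}$, $Q=P^T$. If $r_1=0$ let $Z=r_2I$. Otherwise let $d_1=\frac{r_1^2+r_2^2-r_3^2}{2r_1}$, $d_2=\sqrt{|r_2^2-d_1^2|}$, let $\beta=1$ if $(y-p)^TJ(q-p)>0$ and $\beta=-1$ otherwise, and $Z=P+\frac{d_1}{r_1}(Q-P)+\beta\frac{d_2}{r_1}J(Q-P)$. Return $(P,Q,Z)$. **Align** of a tuple of pairs $(p_1,\ell_1),\dots,(p_m,\ell_m)$. Choose unit vectors $v_i$ and $b_i\ge0$ with $\ell_i=\{q: v_i^Tq=b_i\}$. For all $j,k,l\in[m]$ with $j\ne k$ form a set $F$ of alignments: * If $|v_j^Tv_k|\neq1$: let $u_i=Jv_i$ and let $U$ be the rotation matrix with rows $u_j^T,(Ju_j)^T$; let $(P',Q',Z')=$ Z-Configs$(Uu_k,p_j,p_k,p_l)$ and $P=U^TP'$,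 $Q=U^TQ'$, $Z=U^TZ'$; let $s$ be the point of $\ell_j\cap\ell_k$ and $c_l=b_l-v_l^Ts$. Then $F$ consists of all alignments $(R,t)$ for which there is $x\in\operatorname{argmin}_{\|x\|=1}|v_l^TZx-c_l|$ with $Rp_j-t=Px+s$, $Rp_k-t=Qx+s$, $Rp_l-t=Zx+s$. * If $|v_j^Tv_k|=1$: $F$ consists of the alignments $(R,t)$ that minimize the Euclidean distance from $Rp_k-t$ to $\ell_k$ among all alignments with $Rp_j-t\in\ell_j$. From $F$ select a set of alignments: if only finitely many rotations $R$ occur in $F$, one arbitrary $(R,t)\in F$ for each of these rotations, and otherwise one arbitrary element of $F$. The output of Align is the union of the selected sets over all $j,k,l$. **Align+Match**$(A,\mathrm{cost})$. Let $X$ be the union over all $i_1,i_2,i_3,j_1,j_2,j_3\in[n]$ of the outputs of Align$\big((p_{i_1},\ell_{j_1}),(p_{i_2},\ell_{j_2}),(p_{i_3},\ell_{j_3})\big)$. For each $(R,t)\in X$ choose a permutation $\hat\pi_{(R,t)}$ that minimizes $\mathrm{cost}(A_\pi,(R,t))$ over all $\pi$. Return a triple $(\tilde R,\tilde t,\tilde\pi)$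 of minimal $\mathrm{cost}(A_{\tilde\pi},(\tilde R,\tilde t))$ among the triples $(R,t,\hat\pi_{(R,t)})$, $(R,t)\in X$. **Theorem.** The minimum of $\mathrm{cost}(A_\pi,(R,t))$ over all alignments $(R,t)$ and permutations $\pi$ of $[n]$ exists, and every possible output $(\tilde R,\tilde t,\tilde\pi)$ of Align+Match$(A,\mathrm{cost})$ satisfies $$\mathrm{cost}\big(A_{\tilde\pi},(\tilde R,\tilde t)\big)\le (16w)^r\cdot\min_{(R,t,\pi)}\mathrm{cost}\big(A_\pi,(R,t)\big).$$ Moreover, such an output can be computed in $n^{O(1)}$ time: there is one real RAM program (exact arithmetic $+,-,\cdot,/,\sqrt{\ }$ and comparisons of reals, evaluation of $\mathrm{lip}$, and of the $\ell_z$ distance from a point to a line, each at unit cost) which, for all $n\ge3$, $A$, $z$, $r$, $\mathrm{lip}$ as above, halts within $K n^{d}$ operations, with constants $K,d$ that depend on nothing, and returns an output of Align+Match$(A,\mathrm{cost})$. -/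

import Mathlib

open scoped NNReal

noncomputable section

namespace PointsToLines

/-! ### Points, lines, alignments -/

/-- The Euclidean plane. -/
abbrev Point := EuclideanSpace ℝ (Fin 2)

/-- The set `{q | aᵀ q = c}`. -/
def hyperplane (a : Point) (c : ℝ) : Set Point := {q | inner ℝ a q = c}

/-- A line on the plane, presented by an arbitrary nonzero normal vector and an offset. -/
structure Line where
  normal : Point
  offset : ℝ
  normal_ne : normal ≠ 0

/-- The points of a line. -/
def Line.carrier (L : Line) : Set Point := hyperplane L.normal L.offset

/-- An alignment `(R, t)`: a rotation matrix (`Rᵀ R = 1`, `det R = 1`) and a translation vector. -/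
abbrev RigidMotion := Matrix.specialOrthogonalGroup (Fin 2) ℝ × Point

/-- The point `R p - t`. -/
def RigidMotion.move (g : RigidMotion) (p : Point) : Point :=
  Matrix.toEuclideanLin (g.1 : Matrix (Fin 2) (Fin 2) ℝ) p - g.2

/-! ### The cost function -/

/-- The `ℓ_z` norm on the plane. -/
def lzNorm (z : ℝ) (x : Point) : ℝ≥0 := (‖x 0‖₊ ^ z + ‖x 1‖₊ ^ z) ^ (1 / z)

/-- The `ℓ_z` distance from a point to a set. -/
def lzDist (z : ℝ) (y : Point) (S : Set Point) : ℝ≥0 := ⨅ q : S, lzNorm z (y - q)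

/-- `D_z((p, ℓ), (R, t)) = min_{q ∈ ℓ} ‖R p - t - q‖_z`. -/
def Dz (z : ℝ) (a : Point × Line) (g : RigidMotion) : ℝ≥0 :=
  lzDist z (g.move a.1) a.2.carrier

/-- `h : [0, ∞) → [0, ∞)` is `r`-log-Lipschitz. -/
def IsLogLipschitz (r : ℝ) (h : ℝ≥0 → ℝ≥0) : Prop :=
  0 < r ∧ Monotone h ∧ ∀ c x : ℝ≥0, 1 ≤ c → h (c * x) ≤ c ^ r * h x

/-- `cost(A, q) = f(lip(D(a₁, q)), …, lip(D(aₙ, q)))`. -/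
def frameworkCost {X Q : Type*} {n : ℕ} (f : (Fin n → ℝ≥0) → ℝ≥0) (lip : ℝ≥0 → ℝ≥0)
    (D : X → Q → ℝ≥0) (A : Fin n → X) (q : Q) : ℝ≥0 :=
  f fun i => lip (D (A i) q)

/-- The `ℓ_1` norm of a vector with nonnegative entries. -/
def l1 {n : ℕ} (v : Fin n → ℝ≥0) : ℝ≥0 := ∑ i, v i

/-- The cost with `D = D_z` and `f = ‖·‖_1`. -/
def cost {n : ℕ} (z : ℝ) (lip : ℝ≥0 → ℝ≥0) (A : Fin n → Point × Line) (g : RigidMotion) : ℝ≥0 :=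
  frameworkCost l1 lip (Dz z) A g

/-- `A_π = ((p₁, ℓ_{π(1)}), …, (pₙ, ℓ_{π(n)}))`. -/
def rematch {n : ℕ} (A : Fin n → Point × Line) (π : Equiv.Perm (Fin n)) : Fin n → Point × Line :=
  fun i => ((A i).1, (A (π i)).2)

/-- `π` is an optimal matching for `(A, (R, t), cost)`. -/
def IsOptimalMatching {n : ℕ} (z : ℝ) (lip : ℝ≥0 → ℝ≥0) (A : Fin n → Point × Line)
    (g : RigidMotion) (π : Equiv.Perm (Fin n)) : Prop :=
  ∀ σ : Equiv.Perm (Fin n), cost z lip (rematch A π) g ≤ cost z lip (rematch A σ) g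

/-- `w = 1` if `z = 2` and `w = √2` otherwise. -/
def wFactor (z : ℝ) : ℝ≥0 := if z = 2 then 1 else NNReal.sqrt 2

/-! ### The subroutine Z-Configs -/

/-- The counter-clockwise rotation by a right angle. -/
def quarterTurn : Matrix (Fin 2) (Fin 2) ℝ := !![0, -1; 1, 0]

/-- The counter-clockwise perpendicular vector. -/
def perp (u : Point) : Point := Matrix.toEuclideanLin quarterTurn u

/-- For a unit vector `u`, the rotation matrix with rows `u`, `perp u`; it takes `u` to `(1, 0)`. -/
def toXAxis (u : Point) : Matrix (Fin 2) (Fin 2) ℝ := !![u 0, u 1; perp u 0, perp u 1]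

/-- `Z-Configs(v, p, q, z)`. As `x` runs over the unit vectors, `(P x, Q x, Z x)` runs over the
positions of the (rigidly moved) triple `(p, q, z)` with the first point on the `x`-axis and the
second one on the line spanned by `v`. If `p = q`, both are at the origin, and `z` runs over
a circle around it. -/
def zConfigs (v p q z : Point) :
    Matrix (Fin 2) (Fin 2) ℝ × Matrix (Fin 2) (Fin 2) ℝ × Matrix (Fin 2) (Fin 2) ℝ :=
  let r₁ := dist p q
  let r₂ := dist p z
  let r₃ := dist q z
  let d₁ := (r₁ ^ 2 + r₂ ^ 2 - r₃ ^ 2) / (2 * r₁)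
  let d₂ := √|r₂ ^ 2 - d₁ ^ 2|
  let P : Matrix (Fin 2) (Fin 2) ℝ := r₁ • !![v 0 / v 1, 1; 0, 0]
  let Q := P.transpose
  let b : ℝ := if 0 < inner ℝ (z - p) (perp (q - p)) then 1 else -1
  let Z : Matrix (Fin 2) (Fin 2) ℝ :=
    if r₁ = 0 then r₂ • 1 else P + (d₁ / r₁) • (Q - P) + (b * (d₂ / r₁)) • (quarterTurn * (Q - P))
  (P, Q, Z)

/-! ### The algorithm Align -/

/-- `x ∈ argmin_{‖y‖ = 1} |vᵀ Z y - c|`. -/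
def IsUnitArgmin (v : Point) (Z : Matrix (Fin 2) (Fin 2) ℝ) (c : ℝ) (x : Point) : Prop :=
  ‖x‖ = 1 ∧ ∀ y : Point, ‖y‖ = 1 →
    |inner ℝ v (Matrix.toEuclideanLin Z x) - c| ≤ |inner ℝ v (Matrix.toEuclideanLin Z y) - c|

/-- The alignments found in an iteration in which the lines `j` and `k` are not parallel; here
`ℓ_i = {q | v_iᵀ q = b_i}` with a unit vector `v_i`, so that `perp (v i)` spans the direction of
`ℓ_i`. The configurations are computed relative to the intersection point `s` of `ℓ_j` and `ℓ_k`. -/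
def crossingAlignments {m : ℕ} (A : Fin m → Point × Line) (v : Fin m → Point) (b : Fin m → ℝ)
    (j k l : Fin m) : Set RigidMotion :=
  let U := toXAxis (perp (v j))
  let M := zConfigs (Matrix.toEuclideanLin U (perp (v k))) (A j).1 (A k).1 (A l).1
  let P := U.transpose * M.1
  let Q := U.transpose * M.2.1
  let Z := U.transpose * M.2.2
  {g | ∃ s x : Point, s ∈ (A j).2.carrier ∩ (A k).2.carrier ∧
    IsUnitArgmin (v l) Z (b l - inner ℝ (v l) s) x ∧
    g.move (A j).1 = Matrix.toEuclideanLin P x + s ∧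
    g.move (A k).1 = Matrix.toEuclideanLin Q x + s ∧
    g.move (A l).1 = Matrix.toEuclideanLin Z x + s}

/-- The alignments that are eligible in an iteration in which the lines `j` and `k` are parallel:
`p_j` is put on `ℓ_j` and, subject to this, `p_k` as close as possible to `ℓ_k`. -/
def parallelAlignments {m : ℕ} (A : Fin m → Point × Line) (j k : Fin m) : Set RigidMotion :=
  {g | g.move (A j).1 ∈ (A j).2.carrier ∧
    ∀ g' : RigidMotion, g'.move (A j).1 ∈ (A j).2.carrier →
      Metric.infDist (g.move (A k).1) (A k).2.carrier ≤
        Metric.infDist (g'.move (A k).1) (A k).2.carrier}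

/-- `C` is a choice of constantly many alignments of `F`: if finitely many rotations occur in `F`,
one alignment of `F` for each of them, and otherwise one arbitrary alignment of `F`. -/
def IsSelection (F C : Set RigidMotion) : Prop :=
  C ⊆ F ∧
    (((Prod.fst '' F).Finite ∧ ∀ R ∈ Prod.fst '' F, ∃! g : RigidMotion, g ∈ C ∧ g.1 = R) ∨
      ((Prod.fst '' F).Infinite ∧ ∃ g : RigidMotion, C = {g}))

/-- `C` is an output of a call to `Align(A)`. -/
def IsAlignOutput {m : ℕ} (A : Fin m → Point × Line) (C : Set RigidMotion) : Prop :=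
  ∃ (v : Fin m → Point) (b : Fin m → ℝ),
    (∀ i, ‖v i‖ = 1 ∧ 0 ≤ b i ∧ (A i).2.carrier = hyperplane (v i) (b i)) ∧
    ∃ C' : Fin m → Fin m → Fin m → Set RigidMotion,
      (∀ j k l, j ≠ k →
        (|inner ℝ (v j) (v k)| ≠ 1 → IsSelection (crossingAlignments A v b j k l) (C' j k l)) ∧
        (|inner ℝ (v j) (v k)| = 1 → IsSelection (parallelAlignments A j k) (C' j k l))) ∧
      C = {g | ∃ j k l, j ≠ k ∧ g ∈ C' j k l}

/-! ### The algorithm Align+Match -/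

/-- `(g, π)` is an output of a call to `Align+Match(A, cost)`. -/
def IsAlignMatchOutput {n : ℕ} (z : ℝ) (lip : ℝ≥0 → ℝ≥0) (A : Fin n → Point × Line)
    (out : RigidMotion × Equiv.Perm (Fin n)) : Prop :=
  ∃ (X' : (Fin 3 → Fin n) → (Fin 3 → Fin n) → Set RigidMotion)
    (πhat : RigidMotion → Equiv.Perm (Fin n)),
    (∀ i j : Fin 3 → Fin n,
      IsAlignOutput (fun a : Fin 3 => ((A (i a)).1, (A (j a)).2)) (X' i j)) ∧
    (∀ g, (∃ i j, g ∈ X' i j) → IsOptimalMatching z lip A g (πhat g)) ∧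
    ∃ S : Set (RigidMotion × Equiv.Perm (Fin n)),
      S = {u | (∃ i j, u.1 ∈ X' i j) ∧ u.2 = πhat u.1} ∧
      out ∈ S ∧ ∀ u ∈ S, cost z lip (rematch A out.2) out.1 ≤ cost z lip (rematch A u.2) u.1

end PointsToLines

/-! ### A real RAM

Structured programs over a memory with cells for natural numbers and cells for real numbers. Cells
are grouped in arrays; the name of an array is fixed in the program text, the indices are computed.
Real arithmetic and comparisons are exact. There is no conversion between the two kinds of cells.
Every operation has unit cost. -/

namespace RealRAM

open PointsToLines

/-- The cost function that a program is given as part of its input is accessed by evaluating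
`lip` on a nonnegative number, and the `ℓ_z` distance from a point to a line. -/
structure Oracle where
  lip : ℝ≥0 → ℝ≥0
  z : ℝ

structure Mem where
  /-- array name, index -/
  nat : ℕ → ℕ → ℕ
  /-- array name, row, column -/
  real : ℕ → ℕ → ℕ → ℝ

/-- Expressions for natural numbers (subtraction is truncated). -/
inductive NExp where
  | const (k : ℕ)
  | get (a : ℕ) (i : NExp)
  | add (e₁ e₂ : NExp)
  | sub (e₁ e₂ : NExp)

def NExp.eval (σ : Mem) : NExp → ℕ
  | const k => k
  | get a i => σ.nat a (i.eval σ)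
  | add e₁ e₂ => e₁.eval σ + e₂.eval σ
  | sub e₁ e₂ => e₁.eval σ - e₂.eval σ

/-- The number of operations of an evaluation. -/
def NExp.time : NExp → ℕ
  | const _ => 1
  | get _ i => i.time + 1
  | add e₁ e₂ => e₁.time + e₂.time + 1
  | sub e₁ e₂ => e₁.time + e₂.time + 1

/-- Expressions for real numbers. The only constants are natural numbers. -/
inductive RExp where
  | const (k : ℕ)
  | get (a : ℕ) (i j : NExp)
  | add (e₁ e₂ : RExp)
  | sub (e₁ e₂ : RExp)
  | mul (e₁ e₂ : RExp)
  | div (e₁ e₂ : RExp)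
  | sqrt (e : RExp)
  /-- the value of `lip` -/
  | lip (e : RExp)
  /-- the `ℓ_z` distance from the point `(y₁, y₂)` to the line `a₁ q₁ + a₂ q₂ = c` -/
  | lineDist (y₁ y₂ a₁ a₂ c : RExp)

def RExp.eval (O : Oracle) (σ : Mem) : RExp → ℝ
  | const k => k
  | get a i j => σ.real a (i.eval σ) (j.eval σ)
  | add e₁ e₂ => e₁.eval O σ + e₂.eval O σ
  | sub e₁ e₂ => e₁.eval O σ - e₂.eval O σ
  | mul e₁ e₂ => e₁.eval O σ * e₂.eval O σ
  | div e₁ e₂ => e₁.eval O σ / e₂.eval O σ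
  | sqrt e => √(e.eval O σ)
  | lip e => O.lip (e.eval O σ).toNNReal
  | lineDist y₁ y₂ a₁ a₂ c =>
      lzDist O.z !₂[y₁.eval O σ, y₂.eval O σ]
        (hyperplane !₂[a₁.eval O σ, a₂.eval O σ] (c.eval O σ))

/-- The number of operations of an evaluation. -/
def RExp.time : RExp → ℕ
  | const _ => 1
  | get _ i j => i.time + j.time + 1
  | add e₁ e₂ => e₁.time + e₂.time + 1
  | sub e₁ e₂ => e₁.time + e₂.time + 1
  | mul e₁ e₂ => e₁.time + e₂.time + 1
  | div e₁ e₂ => e₁.time + e₂.time + 1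
  | sqrt e => e.time + 1
  | lip e => e.time + 1
  | lineDist y₁ y₂ a₁ a₂ c => y₁.time + y₂.time + a₁.time + a₂.time + c.time + 1

/-- Tests. -/
inductive Test where
  | natLe (e₁ e₂ : NExp)
  | realLe (e₁ e₂ : RExp)
  | not (t : Test)
  | and (t₁ t₂ : Test)

def Test.holds (O : Oracle) (σ : Mem) : Test → Prop
  | natLe e₁ e₂ => e₁.eval σ ≤ e₂.eval σ
  | realLe e₁ e₂ => e₁.eval O σ ≤ e₂.eval O σ
  | not t => ¬ t.holds O σ
  | and t₁ t₂ => t₁.holds O σ ∧ t₂.holds O σ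

/-- The number of operations of a test. -/
def Test.time : Test → ℕ
  | natLe e₁ e₂ => e₁.time + e₂.time + 1
  | realLe e₁ e₂ => e₁.time + e₂.time + 1
  | not t => t.time + 1
  | and t₁ t₂ => t₁.time + t₂.time + 1

/-- Programs. -/
inductive Prog where
  | skip
  | setNat (a : ℕ) (i : NExp) (e : NExp)
  | setReal (a : ℕ) (i j : NExp) (e : RExp)
  | seq (P₁ P₂ : Prog)
  | ite (t : Test) (P₁ P₂ : Prog)
  | loop (t : Test) (P : Prog)

def Mem.writeNat (m : Mem) (a i x : ℕ) : Mem :=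
  ⟨Function.update m.nat a (Function.update (m.nat a) i x), m.real⟩

def Mem.writeReal (m : Mem) (a i j : ℕ) (x : ℝ) : Mem :=
  ⟨m.nat, Function.update m.real a
    (Function.update (m.real a) i (Function.update (m.real a i) j x))⟩

/-- `Run O P σ τ T`: started in the memory `σ`, the program `P` halts in the memory `τ` after
exactly `T` operations. -/
inductive Run (O : Oracle) : Prog → Mem → Mem → ℕ → Prop where
  | skip (σ : Mem) : Run O .skip σ σ 1
  | setNat (a : ℕ) (i e : NExp) (σ : Mem) :
      Run O (.setNat a i e) σ (σ.writeNat a (i.eval σ) (e.eval σ)) (i.time + e.time + 1)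
  | setReal (a : ℕ) (i j : NExp) (e : RExp) (σ : Mem) :
      Run O (.setReal a i j e) σ (σ.writeReal a (i.eval σ) (j.eval σ) (e.eval O σ))
        (i.time + j.time + e.time + 1)
  | seq {P₁ P₂ : Prog} {σ₁ σ₂ σ₃ : Mem} {T₁ T₂ : ℕ} :
      Run O P₁ σ₁ σ₂ T₁ → Run O P₂ σ₂ σ₃ T₂ → Run O (.seq P₁ P₂) σ₁ σ₃ (T₁ + T₂)
  | iteTrue {t : Test} {P₁ P₂ : Prog} {σ τ : Mem} {T : ℕ} :
      t.holds O σ → Run O P₁ σ τ T → Run O (.ite t P₁ P₂) σ τ (t.time + T)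
  | iteFalse {t : Test} {P₁ P₂ : Prog} {σ τ : Mem} {T : ℕ} :
      ¬ t.holds O σ → Run O P₂ σ τ T → Run O (.ite t P₁ P₂) σ τ (t.time + T)
  | loopTrue {t : Test} {P : Prog} {σ₁ σ₂ σ₃ : Mem} {T₁ T₂ : ℕ} :
      t.holds O σ₁ → Run O P σ₁ σ₂ T₁ → Run O (.loop t P) σ₂ σ₃ T₂ →
      Run O (.loop t P) σ₁ σ₃ (t.time + T₁ + T₂)
  | loopFalse {t : Test} {P : Prog} {σ : Mem} :
      ¬ t.holds O σ → Run O (.loop t P) σ σ t.time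

/-- The input memory: `n` in the cell `nat 0 0`, the point `p_i` in the columns `0, 1` and the
normal and the offset of the line `ℓ_i` in the columns `2, 3, 4` of the row `i` of `real 0`; all
other cells hold zero. -/
def inputMem {n : ℕ} (A : Fin n → Point × Line) : Mem where
  nat a i := if a = 0 ∧ i = 0 then n else 0
  real a i j :=
    if h : i < n then
      if a = 0 then
        match j with
        | 0 => (A ⟨i, h⟩).1 0
        | 1 => (A ⟨i, h⟩).1 1
        | 2 => (A ⟨i, h⟩).2.normal 0
        | 3 => (A ⟨i, h⟩).2.normal 1
        | 4 => (A ⟨i, h⟩).2.offset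
        | _ => 0
      else 0
    else 0

/-- The memory holds the output `(R, t, π)`: the entries of `R` in the rows `0, 1` and those of `t`
in the row `2` of `real 1`, and `π` in `nat 1`. -/
def HoldsOutput {n : ℕ} (σ : Mem) (out : RigidMotion × Equiv.Perm (Fin n)) : Prop :=
  (∀ i j : Fin 2, σ.real 1 i j = (out.1.1 : Matrix (Fin 2) (Fin 2) ℝ) i j) ∧
  (∀ j : Fin 2, σ.real 1 2 j = out.1.2 j) ∧
  ∀ i : Fin n, σ.nat 1 i = (out.2 i : ℕ)

end RealRAM

end

/-! For a fixed line and a fixed `z`, the `ℓ_z` distance of a point to the line is a constant times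
the residual `|ev|` of the line's equation (`exists_lzDist_eq`). Ratios of distances therefore do
not depend on `z`. It is enough to find, for an optimal alignment and matching, a candidate
alignment in which every residual is at most 16 times the optimal one. Log-Lipschitzness turns this
into a factor `16 ^ r` in every summand of the cost, and `w ≥ 1` is only slack.

The factor is 2 · 2 · 4. Translating the pair with the smallest distance onto its line changes no
other distance by more than that distance itself (`exists_translate_le_two`). If some line is not
parallel to this one, sliding along it until the first further point meets its line again at most
doubles the residuals (`exists_slide_le_two`). What remains is a rotation with cosine `x` and sine
`y`. The translation is an affine function of `(x, y)`, so each residual has the form `|a x + b y -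
c|` on the unit circle (`ev_of_mem_feasible`). Go to the nearest among the minimizers of all the
nonconstant residuals. No minimizer of any residual was closer, so distances to minimizers at most
double, and every residual grows at most fourfold (`abs_le_four_mul_abs`, `exists_closest_le_four`).
If all lines are parallel, the slide is not needed.

The two branches of Align produce exactly such constrained minimizers, the sets `closest`, because
the matrices of Z-Configs parametrize the alignments that keep two points on two crossing lines
(`crossingAlignments_eq`, `parallelAlignments_eq`). Since Align+Match tries all triples of points
and of lines, it also meets the right triple under the optimal permutation.

A minimum exists although `lip` may jump at zero and the translations are unbounded: the cost is
lower semicontinuous, and every translation can be replaced by one of bounded length that worsens no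
residual (`exists_bounded_point`).

The program enumerates all six indices, computes two candidates by a closed formula, finds an
optimal matching by the Hungarian method and keeps the best result. A small calculus `Wp` proves
correctness together with a time bound in which every loop makes at most `n + 1` iterations. Since
the program text is fixed, the bound is polynomial. -/

noncomputable section

namespace PointsToLines

/-! ### Coordinates -/

theorem inner_eq (a b : Point) : inner ℝ a b = a 0 * b 0 + a 1 * b 1 := by
  simp [PiLp.inner_apply, Fin.sum_univ_two, mul_comm]

theorem norm_sq_eq (a : Point) : ‖a‖ ^ 2 = a 0 ^ 2 + a 1 ^ 2 := by
  simp [EuclideanSpace.norm_sq_eq, Fin.sum_univ_two]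

theorem norm_eq_one_iff (a : Point) : ‖a‖ = 1 ↔ a 0 ^ 2 + a 1 ^ 2 = 1 := by
  rw [← norm_sq_eq]
  constructor
  · intro h; rw [h]; norm_num
  · intro h; nlinarith [norm_nonneg a]

theorem Point.ext {a b : Point} (h0 : a 0 = b 0) (h1 : a 1 = b 1) : a = b := by
  ext i; fin_cases i
  · exact h0
  · exact h1

theorem Point.ne_zero_iff (a : Point) : a ≠ 0 ↔ 0 < a 0 ^ 2 + a 1 ^ 2 := by
  rw [← norm_sq_eq]
  constructor
  · intro h; have := norm_pos_iff.2 h; positivity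
  · rintro h rfl; simp at h

theorem toEuclideanLin_zero (M : Matrix (Fin 2) (Fin 2) ℝ) (x : Point) :
    Matrix.toEuclideanLin M x 0 = M 0 0 * x 0 + M 0 1 * x 1 := by
  simp [Matrix.toLpLin_apply]

theorem toEuclideanLin_one (M : Matrix (Fin 2) (Fin 2) ℝ) (x : Point) :
    Matrix.toEuclideanLin M x 1 = M 1 0 * x 0 + M 1 1 * x 1 := by
  simp [Matrix.toLpLin_apply]

@[simp] theorem perp_zero (u : Point) : perp u 0 = -u 1 := by
  rw [perp, toEuclideanLin_zero]; simp [quarterTurn]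

@[simp] theorem perp_one (u : Point) : perp u 1 = u 0 := by
  rw [perp, toEuclideanLin_one]; simp [quarterTurn]

/-! ### Rotations -/

/-- The cosine of the angle of the rotation. -/
def RigidMotion.cs (g : RigidMotion) : ℝ := (g.1 : Matrix (Fin 2) (Fin 2) ℝ) 0 0

/-- The sine of the angle of the rotation. -/
def RigidMotion.sn (g : RigidMotion) : ℝ := (g.1 : Matrix (Fin 2) (Fin 2) ℝ) 1 0

/-- The rotation with the given cosine and sine. -/
def rotation (x y : ℝ) (h : x ^ 2 + y ^ 2 = 1) : Matrix.specialOrthogonalGroup (Fin 2) ℝ :=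
  ⟨!![x, -y; y, x], by
    rw [Matrix.mem_specialOrthogonalGroup_iff, Matrix.mem_orthogonalGroup_iff]
    refine ⟨?_, by simp [Matrix.det_fin_two]; nlinarith⟩
    ext i j
    fin_cases i <;> fin_cases j <;> simp [Matrix.mul_apply, Fin.sum_univ_two] <;> nlinarith⟩

theorem rotation_entries (R : Matrix.specialOrthogonalGroup (Fin 2) ℝ) :
    (R : Matrix (Fin 2) (Fin 2) ℝ) 0 1 = -(R : Matrix (Fin 2) (Fin 2) ℝ) 1 0 ∧
    (R : Matrix (Fin 2) (Fin 2) ℝ) 1 1 = (R : Matrix (Fin 2) (Fin 2) ℝ) 0 0 ∧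
    (R : Matrix (Fin 2) (Fin 2) ℝ) 0 0 ^ 2 + (R : Matrix (Fin 2) (Fin 2) ℝ) 1 0 ^ 2 = 1 := by
  obtain ⟨M, hM⟩ := R
  rw [Matrix.mem_specialOrthogonalGroup_iff, Matrix.mem_orthogonalGroup_iff'] at hM
  obtain ⟨h, hd⟩ := hM
  have h00 := congrFun (congrFun h 0) 0
  have h01 := congrFun (congrFun h 0) 1
  have h11 := congrFun (congrFun h 1) 1
  simp [Matrix.mul_apply, Fin.sum_univ_two] at h00 h01 h11
  rw [Matrix.det_fin_two] at hd
  simp only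
  generalize M 0 0 = a at *
  generalize M 0 1 = b at *
  generalize M 1 0 = c at *
  generalize M 1 1 = d at *
  refine ⟨?_, ?_, by nlinarith⟩
  · linear_combination (-b) * h00 + a * h01 - c * hd
  · linear_combination (-d) * h00 + c * h01 + a * hd

theorem RigidMotion.cs_sq_add_sn_sq (g : RigidMotion) : g.cs ^ 2 + g.sn ^ 2 = 1 :=
  (rotation_entries g.1).2.2

theorem RigidMotion.move_zero (g : RigidMotion) (p : Point) :
    g.move p 0 = g.cs * p 0 - g.sn * p 1 - g.2 0 := by
  have := rotation_entries g.1
  rw [move, PiLp.sub_apply, toEuclideanLin_zero, this.1, cs, sn]; ring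

theorem RigidMotion.move_one (g : RigidMotion) (p : Point) :
    g.move p 1 = g.sn * p 0 + g.cs * p 1 - g.2 1 := by
  have := rotation_entries g.1
  rw [move, PiLp.sub_apply, toEuclideanLin_one, this.2.1, cs, sn]

/-- The alignment with the given cosine, sine and translation. -/
def mkMotion (x y : ℝ) (h : x ^ 2 + y ^ 2 = 1) (t : Point) : RigidMotion := (rotation x y h, t)

@[simp] theorem mkMotion_cs (x y : ℝ) (h : x ^ 2 + y ^ 2 = 1) (t : Point) :
    (mkMotion x y h t).cs = x := by simp [mkMotion, RigidMotion.cs, rotation]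

@[simp] theorem mkMotion_sn (x y : ℝ) (h : x ^ 2 + y ^ 2 = 1) (t : Point) :
    (mkMotion x y h t).sn = y := by simp [mkMotion, RigidMotion.sn, rotation]

@[simp] theorem mkMotion_snd (x y : ℝ) (h : x ^ 2 + y ^ 2 = 1) (t : Point) :
    (mkMotion x y h t).2 = t := rfl

theorem fst_eq_iff (g g' : RigidMotion) : g.1 = g'.1 ↔ g.cs = g'.cs ∧ g.sn = g'.sn := by
  constructor
  · intro h; simp [RigidMotion.cs, RigidMotion.sn, h]
  · rintro ⟨h0, h1⟩
    have h2 := rotation_entries g.1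
    have h3 := rotation_entries g'.1
    simp only [RigidMotion.cs, RigidMotion.sn] at h0 h1
    apply Subtype.ext
    ext i j
    fin_cases i <;> fin_cases j
    · exact h0
    · exact (h2.1.trans (by rw [h1])).trans h3.1.symm
    · exact h1
    · exact (h2.2.1.trans h0).trans h3.2.1.symm

theorem RigidMotion.ext {g g' : RigidMotion} (h0 : g.cs = g'.cs) (h1 : g.sn = g'.sn)
    (h2 : g.2 = g'.2) : g = g' :=
  Prod.ext ((fst_eq_iff g g').2 ⟨h0, h1⟩) h2

/-! ### Distances to lines -/

/-- The signed value of the equation of a line at a point. -/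
def Line.ev (L : Line) (q : Point) : ℝ := L.normal 0 * q 0 + L.normal 1 * q 1 - L.offset

theorem Line.mem_carrier (L : Line) (q : Point) : q ∈ L.carrier ↔ L.ev q = 0 := by
  rw [carrier, hyperplane, Set.mem_ofPred_eq, inner_eq, ev, sub_eq_zero]

theorem Line.normSq_pos (L : Line) : 0 < L.normal 0 ^ 2 + L.normal 1 ^ 2 :=
  (Point.ne_zero_iff _).1 L.normal_ne

theorem infDist_hyperplane (a : Point) (ha : a ≠ 0) (c : ℝ) (q : Point) :
    Metric.infDist q (hyperplane a c) = |inner ℝ a q - c| / ‖a‖ := by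
  have hn : 0 < ‖a‖ := norm_pos_iff.2 ha
  set s : ℝ := (inner ℝ a q - c) / ‖a‖ ^ 2 with hs
  have hmem : q - s • a ∈ hyperplane a c := by
    simp only [hyperplane, Set.mem_ofPred_eq, inner_sub_right, inner_smul_right,
      real_inner_self_eq_norm_sq]
    rw [hs]; field_simp; ring
  apply le_antisymm
  · refine (Metric.infDist_le_dist_of_mem hmem).trans (le_of_eq ?_)
    rw [dist_eq_norm, sub_sub_cancel, norm_smul, hs, Real.norm_eq_abs, abs_div,
      abs_of_pos (pow_pos hn 2)]
    field_simp
  · refine (Metric.le_infDist ⟨_, hmem⟩).2 fun y hy => ?_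
    rw [div_le_iff₀ hn, dist_eq_norm, mul_comm]
    have : inner ℝ a q - c = inner ℝ a (q - y) := by
      rw [inner_sub_right, show inner ℝ a y = c from hy]
    rw [this]
    exact abs_real_inner_le_norm _ _

theorem Line.infDist_carrier (L : Line) (q : Point) :
    Metric.infDist q L.carrier = |L.ev q| / ‖L.normal‖ := by
  rw [carrier, infDist_hyperplane _ L.normal_ne, inner_eq, ev]

theorem Line.infDist_le_iff (L : Line) (q q' : Point) :
    Metric.infDist q L.carrier ≤ Metric.infDist q' L.carrier ↔ |L.ev q| ≤ |L.ev q'| := by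
  rw [infDist_carrier, infDist_carrier, div_le_div_iff_of_pos_right (norm_pos_iff.2 L.normal_ne)]

theorem lzNorm_smul {z : ℝ} (hz : 1 ≤ z) (c : ℝ) (x : Point) :
    lzNorm z (c • x) = ‖c‖₊ * lzNorm z x := by
  have hz' : z ≠ 0 := by positivity
  simp only [lzNorm, PiLp.smul_apply, smul_eq_mul, nnnorm_mul, NNReal.mul_rpow]
  rw [← mul_add, NNReal.mul_rpow, ← NNReal.rpow_mul, mul_one_div_cancel hz', NNReal.rpow_one]

theorem lzDist_hyperplane (z : ℝ) (y a : Point) (c : ℝ) :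
    lzDist z y (hyperplane a c) = ⨅ w : {w : Point | inner ℝ a w = inner ℝ a y - c},
      lzNorm z w := by
  let e : hyperplane a c ≃ {w : Point | inner ℝ a w = inner ℝ a y - c} :=
    { toFun := fun q => ⟨y - q, by
        have := q.2; simp only [hyperplane, Set.mem_ofPred_eq] at this ⊢
        rw [inner_sub_right, this]⟩
      invFun := fun w => ⟨y - w, by
        have := w.2; simp only [hyperplane, Set.mem_ofPred_eq] at this ⊢
        rw [inner_sub_right, this]; ring⟩
      left_inv := fun q => by simp
      right_inv := fun q => by simp }
  exact e.iInf_congr fun q => rfl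

/-- The `ℓ_z` distance to a hyperplane is proportional to the value of its equation. -/
theorem exists_lzDist_eq {z : ℝ} (hz : 1 ≤ z) (a : Point) :
    ∃ κ : ℝ≥0, ∀ (y : Point) (c : ℝ),
      lzDist z y (hyperplane a c) = κ * ‖inner ℝ a y - c‖₊ := by
  have hz' : z ≠ 0 := by positivity
  -- The constant is the distance at residual 1; scaling by the residual `s` gives the other values.
  -- For `a = 0` and `s ≠ 0` both index sets are empty and both infima are 0, so `a ≠ 0` need not be
  -- assumed.
  refine ⟨⨅ w : {w : Point | inner ℝ a w = 1}, lzNorm z w, fun y c => ?_⟩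
  rw [lzDist_hyperplane]
  generalize inner ℝ a y - c = s
  rcases eq_or_ne s 0 with rfl | hs
  · rw [nnnorm_zero, mul_zero]
    refine le_antisymm ?_ zero_le
    refine (ciInf_le (OrderBot.bddBelow _) ⟨0, by simp⟩).trans ?_
    simp [lzNorm, hz', NNReal.zero_rpow]
  · let e : {w : Point | inner ℝ a w = 1} ≃ {w : Point | inner ℝ a w = s} :=
      { toFun := fun w => ⟨s • w, by
          have := w.2; simp only [Set.mem_ofPred_eq] at this ⊢
          rw [inner_smul_right, this, mul_one]⟩
        invFun := fun w => ⟨s⁻¹ • w, by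
          have := w.2; simp only [Set.mem_ofPred_eq] at this ⊢
          rw [inner_smul_right, this, inv_mul_cancel₀ hs]⟩
        left_inv := fun q => by simp [smul_smul, hs]
        right_inv := fun q => by simp [smul_smul, hs] }
    rw [NNReal.iInf_mul]
    refine (e.iInf_congr fun w => ?_).symm
    show lzNorm z (s • (w : Point)) = _
    rw [lzNorm_smul hz, mul_comm]

theorem exists_Dz_eq {z : ℝ} (hz : 1 ≤ z) (L : Line) :
    ∃ κ : ℝ≥0, ∀ (p : Point) (g : RigidMotion), Dz z (p, L) g = κ * ‖L.ev (g.move p)‖₊ := by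
  obtain ⟨κ, h⟩ := exists_lzDist_eq hz L.normal
  refine ⟨κ, fun p g => ?_⟩
  rw [Dz, Line.carrier, h, inner_eq, Line.ev]

end PointsToLines
end

noncomputable section

namespace PointsToLines

/-! ### Affine functions on the unit circle -/

/-- `(x, y)` minimizes `|A x + B y - C|` on the unit circle. -/
def CircleMin (A B C x y : ℝ) : Prop :=
  x ^ 2 + y ^ 2 = 1 ∧ ∀ x' y' : ℝ, x' ^ 2 + y' ^ 2 = 1 → |A * x + B * y - C| ≤ |A * x' + B * y' - C|

/-- The minimizers of `|A x + B y - C|` on the unit circle, for `s = 1` and `s = -1`; the point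
`(1, 0)` if all points are minimizers. -/
def circlePt (s A B C : ℝ) : ℝ × ℝ :=
  if A ^ 2 + B ^ 2 = 0 then (1, 0)
  else if C ^ 2 ≤ A ^ 2 + B ^ 2 then
    ((C * A - s * √(A ^ 2 + B ^ 2 - C ^ 2) * B) / (A ^ 2 + B ^ 2),
      (C * B + s * √(A ^ 2 + B ^ 2 - C ^ 2) * A) / (A ^ 2 + B ^ 2))
  else if 0 ≤ C then (A / √(A ^ 2 + B ^ 2), B / √(A ^ 2 + B ^ 2))
  else ((0 - A) / √(A ^ 2 + B ^ 2), (0 - B) / √(A ^ 2 + B ^ 2))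

/-- Serves to reduce the case `C < 0` to `0 ≤ C`. -/
theorem circleMin_neg {A B C x y : ℝ} : CircleMin (-A) (-B) (-C) x y ↔ CircleMin A B C x y := by
  have h : ∀ x y : ℝ, |-A * x + -B * y - -C| = |A * x + B * y - C| := fun x y => by
    rw [← abs_neg]; congr 1; ring
  simp only [CircleMin, h]

theorem circleMin_of_eq_zero {A B C x y : ℝ} (h : x ^ 2 + y ^ 2 = 1) (h0 : A * x + B * y = C) :
    CircleMin A B C x y := ⟨h, fun x' y' _ => by rw [h0, sub_self, abs_zero]; exact abs_nonneg _⟩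

/-- With `N = A² + B²` and `w² = N - C²`, the point is `(C / N) (A, B) + s (w / N) (-B, A)`: the
foot of the perpendicular from the origin to the line `A x + B y = C`, plus or minus half a chord.
-/
theorem circlePt_zero_value {s A B C : ℝ} (hs : s ^ 2 = 1) (hN : A ^ 2 + B ^ 2 ≠ 0)
    (hC : C ^ 2 ≤ A ^ 2 + B ^ 2) :
    (circlePt s A B C).1 ^ 2 + (circlePt s A B C).2 ^ 2 = 1 ∧
      A * (circlePt s A B C).1 + B * (circlePt s A B C).2 = C := by
  have hw := Real.sq_sqrt (sub_nonneg.2 hC)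
  simp only [circlePt, hN, if_false, hC, if_true]
  generalize √(A ^ 2 + B ^ 2 - C ^ 2) = w at *
  constructor
  · field_simp
    linear_combination (A ^ 2 + B ^ 2) * w ^ 2 * hs + (A ^ 2 + B ^ 2) * hw
  · field_simp
    ring

theorem linear_le_of_circle {A B x y : ℝ} (h : x ^ 2 + y ^ 2 = 1) :
    A * x + B * y ≤ √(A ^ 2 + B ^ 2) := by
  apply Real.le_sqrt_of_sq_le
  nlinarith [sq_nonneg (B * x - A * y)]

/-- The line `A x + B y = C` misses the circle, so the absolute value is `C - (A x + B y)`. It is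
least exactly where the Cauchy–Schwarz inequality is an equality. -/
theorem circleMin_far {A B C x y : ℝ} (hN : A ^ 2 + B ^ 2 ≠ 0) (hC : A ^ 2 + B ^ 2 < C ^ 2)
    (h0 : 0 ≤ C) :
    CircleMin A B C x y ↔ x = A / √(A ^ 2 + B ^ 2) ∧ y = B / √(A ^ 2 + B ^ 2) := by
  have hN' : 0 < A ^ 2 + B ^ 2 := lt_of_le_of_ne (by positivity) hN.symm
  have hs0 : 0 < √(A ^ 2 + B ^ 2) := Real.sqrt_pos.2 hN'
  have hs2 := Real.sq_sqrt hN'.le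
  have hsC : √(A ^ 2 + B ^ 2) < C := (Real.sqrt_lt' (by nlinarith)).2 hC
  have habs : ∀ x y : ℝ, x ^ 2 + y ^ 2 = 1 → |A * x + B * y - C| = C - (A * x + B * y) := by
    intro x y h
    have := linear_le_of_circle (A := A) (B := B) h
    rw [abs_of_neg (by linarith)]; ring
  have hle := fun (x y : ℝ) (h : x ^ 2 + y ^ 2 = 1) => linear_le_of_circle (A := A) (B := B) h
  generalize √(A ^ 2 + B ^ 2) = s at *
  have hu : (A / s) ^ 2 + (B / s) ^ 2 = 1 := by field_simp; linarith
  have hv : A * (A / s) + B * (B / s) = s := by field_simp; linarith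
  constructor
  · rintro ⟨h, hm⟩
    have h1 := hm _ _ hu
    rw [habs _ _ h, habs _ _ hu, hv] at h1
    have h2 := hle _ _ h
    have h3 : A * x + B * y = s := by linarith
    -- Equality in Cauchy–Schwarz, through `(A x + B y)² + (A y - B x)² = (A² + B²)(x² + y²)`. The
    -- values of both linear forms then determine `x` and `y`.
    have h4 : A * y - B * x = 0 := by
      have : (A * y - B * x) ^ 2 = 0 := by
        linear_combination (A ^ 2 + B ^ 2) * h - (A * x + B * y + s) * h3 - hs2
      exact pow_eq_zero_iff (two_ne_zero) |>.1 this
    have h5 : s * (s * x - A) = 0 := by linear_combination A * h3 - B * h4 + x * hs2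
    have h6 : s * (s * y - B) = 0 := by linear_combination B * h3 + A * h4 + y * hs2
    have h7 := (mul_eq_zero.1 h5).resolve_left hs0.ne'
    have h8 := (mul_eq_zero.1 h6).resolve_left hs0.ne'
    constructor
    · rw [eq_div_iff hs0.ne']; linarith
    · rw [eq_div_iff hs0.ne']; linarith
  · rintro ⟨rfl, rfl⟩
    refine ⟨hu, fun x' y' h' => ?_⟩
    rw [habs _ _ hu, habs _ _ h', hv]
    linarith [hle _ _ h']

/-- If the line `A x + B y = C` meets the circle, the minimum is 0 and the minimizers are the
intersection points. Otherwise the minimizer is unique and the two values of `circlePt` agree. -/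
theorem circleMin_iff {A B C x y : ℝ} (hN : A ^ 2 + B ^ 2 ≠ 0) :
    CircleMin A B C x y ↔ (x, y) = circlePt 1 A B C ∨ (x, y) = circlePt (-1) A B C := by
  by_cases hC : C ^ 2 ≤ A ^ 2 + B ^ 2
  · constructor
    · rintro ⟨h, hm⟩
      obtain ⟨h1, h2⟩ := circlePt_zero_value (s := 1) (by norm_num) hN hC
      have h3 := hm _ _ h1
      rw [h2, sub_self, abs_zero] at h3
      have h4 : A * x + B * y - C = 0 := abs_eq_zero.1 (le_antisymm h3 (abs_nonneg _))
      have hw := Real.sq_sqrt (sub_nonneg.2 hC)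
      simp only [circlePt, hN, if_false, hC, if_true, Prod.mk.injEq]
      generalize √(A ^ 2 + B ^ 2 - C ^ 2) = w at *
      have h5 : (A * y - B * x - w) * (A * y - B * x + w) = 0 := by
        linear_combination (A ^ 2 + B ^ 2) * h - (A * x + B * y + C) * h4 - hw
      rcases mul_eq_zero.1 h5 with h6 | h6
      · left
        constructor
        · rw [eq_div_iff hN]; linear_combination A * h4 - B * h6
        · rw [eq_div_iff hN]; linear_combination B * h4 + A * h6
      · right
        constructor
        · rw [eq_div_iff hN]; linear_combination A * h4 - B * h6
        · rw [eq_div_iff hN]; linear_combination B * h4 + A * h6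
    · rintro (h | h)
      · obtain ⟨h1, h2⟩ := circlePt_zero_value (s := 1) (by norm_num) hN hC
        rw [← h] at h1 h2
        exact circleMin_of_eq_zero h1 h2
      · obtain ⟨h1, h2⟩ := circlePt_zero_value (s := -1) (by norm_num) hN hC
        rw [← h] at h1 h2
        exact circleMin_of_eq_zero h1 h2
  · have hC' := not_le.1 hC
    by_cases h0 : 0 ≤ C
    · rw [circleMin_far hN hC' h0]
      simp [circlePt, hN, hC, h0]
    · rw [← circleMin_neg, circleMin_far (by simpa using hN) (by simpa using hC') (by linarith)]
      simp [circlePt, hN, hC, h0]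

theorem circlePt_min (A B C : ℝ) {s : ℝ} (hs : s = 1 ∨ s = -1) :
    CircleMin A B C (circlePt s A B C).1 (circlePt s A B C).2 := by
  by_cases hN : A ^ 2 + B ^ 2 = 0
  · have hA : A = 0 := by nlinarith [sq_nonneg A, sq_nonneg B]
    have hB : B = 0 := by nlinarith [sq_nonneg A, sq_nonneg B]
    subst hA hB
    refine ⟨?_, fun x' y' _ => by simp⟩
    simp [circlePt]
  · rw [circleMin_iff hN]
    rcases hs with rfl | rfl
    · exact Or.inl rfl
    · exact Or.inr rfl

theorem circlePt_sq (A B C : ℝ) {s : ℝ} (hs : s = 1 ∨ s = -1) :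
    (circlePt s A B C).1 ^ 2 + (circlePt s A B C).2 ^ 2 = 1 := (circlePt_min A B C hs).1

/-- The square of the distance. -/
def sqDist (x y x' y' : ℝ) : ℝ := (x - x') ^ 2 + (y - y') ^ 2

/-- The triangle inequality: the distance to `(a, b)` at most doubles, so its square at most
quadruples. -/
theorem sqDist_le_four {x y x' y' a b : ℝ} (h : sqDist x y x' y' ≤ sqDist x y a b) :
    sqDist x' y' a b ≤ 4 * sqDist x y a b := by
  simp only [sqDist] at *
  nlinarith [sq_nonneg (x' - x + a - x), sq_nonneg (y' - y + b - y)]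

/-- Let `s = √(A² + B²)` and let `u = (A, B) / s` be the only minimizer. On the circle, `C - (A x +
B y)` is the positive constant `C - s` plus `s / 2` times the squared distance to `u`, and only the
second term grows. -/
theorem abs_le_four_of_far {A B C x y x' y' : ℝ} (hN : A ^ 2 + B ^ 2 ≠ 0)
    (hC : A ^ 2 + B ^ 2 < C ^ 2) (h0 : 0 ≤ C) (h : x ^ 2 + y ^ 2 = 1) (h' : x' ^ 2 + y' ^ 2 = 1)
    (hmin : ∀ a b, CircleMin A B C a b → sqDist x y x' y' ≤ sqDist x y a b) :
    |A * x' + B * y' - C| ≤ 4 * |A * x + B * y - C| := by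
  have hN' : 0 < A ^ 2 + B ^ 2 := lt_of_le_of_ne (by positivity) hN.symm
  have hs0 : 0 < √(A ^ 2 + B ^ 2) := Real.sqrt_pos.2 hN'
  have hs2 := Real.sq_sqrt hN'.le
  have hsC : √(A ^ 2 + B ^ 2) < C := (Real.sqrt_lt' (by nlinarith)).2 hC
  have h1 := linear_le_of_circle (A := A) (B := B) h
  have h1' := linear_le_of_circle (A := A) (B := B) h'
  have h2 := sqDist_le_four (hmin _ _ ((circleMin_far hN hC h0).2 ⟨rfl, rfl⟩))
  generalize √(A ^ 2 + B ^ 2) = s at *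
  have hd : ∀ x y : ℝ, x ^ 2 + y ^ 2 = 1 →
      s * sqDist x y (A / s) (B / s) = 2 * s - 2 * (A * x + B * y) := by
    intro x y h
    simp only [sqDist]; field_simp
    linear_combination s ^ 2 * h - hs2
  have h3 := mul_le_mul_of_nonneg_left h2 hs0.le
  rw [mul_left_comm, hd _ _ h, hd _ _ h'] at h3
  rw [abs_of_neg (by linarith), abs_of_neg (by linarith)]
  linarith

/-- Moving on the unit circle from a point by at most its distance to the minimizers of
`|A x + B y - C|` increases this value at most fourfold. -/
theorem abs_le_four_mul_abs {A B C x y x' y' : ℝ} (hN : A ^ 2 + B ^ 2 ≠ 0)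
    (h : x ^ 2 + y ^ 2 = 1) (h' : x' ^ 2 + y' ^ 2 = 1)
    (hmin : ∀ a b, CircleMin A B C a b → sqDist x y x' y' ≤ sqDist x y a b) :
    |A * x' + B * y' - C| ≤ 4 * |A * x + B * y - C| := by
  have hN' : 0 < A ^ 2 + B ^ 2 := lt_of_le_of_ne (by positivity) hN.symm
  by_cases hC : C ^ 2 ≤ A ^ 2 + B ^ 2
  · have h1 := sqDist_le_four (hmin _ _ (circlePt_min A B C (.inl rfl)))
    have h2 := sqDist_le_four (hmin _ _ (circlePt_min A B C (.inr rfl)))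
    have hw := Real.sq_sqrt (sub_nonneg.2 hC)
    simp only [circlePt, hN, if_false, hC, if_true] at h1 h2
    generalize √(A ^ 2 + B ^ 2 - C ^ 2) = w at *
    generalize hN2 : A ^ 2 + B ^ 2 = N at *
    -- Up to the factor `√N / 2`, the value `|A x + B y - C|` is the product of the distances to its
    -- two zeros on the circle. Each distance at most doubles, which gives the factor 4.
    have key : ∀ x y : ℝ, x ^ 2 + y ^ 2 = 1 →
        N * (sqDist x y ((C * A - 1 * w * B) / N) ((C * B + 1 * w * A) / N) *
          sqDist x y ((C * A - -1 * w * B) / N) ((C * B + -1 * w * A) / N)) =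
        4 * (A * x + B * y - C) ^ 2 := by
      intro x y h
      have e : ∀ s : ℝ, s ^ 2 = 1 →
          N * sqDist x y ((C * A - s * w * B) / N) ((C * B + s * w * A) / N) =
          2 * N - 2 * C * (A * x + B * y) - 2 * s * w * (A * y - B * x) := by
        intro s hs
        simp only [sqDist]; field_simp
        linear_combination N ^ 2 * h + (C ^ 2 + s ^ 2 * w ^ 2) * hN2 + N * w ^ 2 * hs + N * hw
      have e1 := e 1 (by norm_num)
      have e2 := e (-1) (by norm_num)
      apply mul_left_cancel₀ hN
      have : N * (N * (sqDist x y ((C * A - 1 * w * B) / N) ((C * B + 1 * w * A) / N) *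
          sqDist x y ((C * A - -1 * w * B) / N) ((C * B + -1 * w * A) / N))) =
          (N * sqDist x y ((C * A - 1 * w * B) / N) ((C * B + 1 * w * A) / N)) *
          (N * sqDist x y ((C * A - -1 * w * B) / N) ((C * B + -1 * w * A) / N)) := by ring
      rw [this, e1, e2]
      have e3 : (A * x + B * y) ^ 2 + (A * y - B * x) ^ 2 = N := by
        rw [← hN2]; linear_combination (A ^ 2 + B ^ 2) * h
      linear_combination (-4 * w ^ 2) * e3 + 4 * ((A * x + B * y) ^ 2 - N) * hw
    have hp : ∀ x y a b : ℝ, 0 ≤ sqDist x y a b := fun x y a b => by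
      simp only [sqDist]; positivity
    have h3 := mul_le_mul h1 h2 (hp _ _ _ _) (mul_nonneg (by norm_num) (hp _ _ _ _))
    have h4 := mul_le_mul_of_nonneg_left h3 hN'.le
    rw [key _ _ h', mul_mul_mul_comm, mul_left_comm, key _ _ h] at h4
    rw [show (4 : ℝ) * |A * x + B * y - C| = |4 * (A * x + B * y - C)| by
      rw [abs_mul]; norm_num]
    apply sq_le_sq.1
    nlinarith
  · have hC' := not_le.1 hC
    by_cases h0 : 0 ≤ C
    · exact abs_le_four_of_far hN hC' h0 h h' hmin
    · have := abs_le_four_of_far (A := -A) (B := -B) (C := -C) (by simpa using hN)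
        (by simpa using hC') (by linarith) h h' (fun a b hab => hmin a b (circleMin_neg.1 hab))
      have e : ∀ x y : ℝ, |-A * x + -B * y - -C| = |A * x + B * y - C| := fun x y => by
        rw [← abs_neg]; congr 1; ring
      rwa [e, e] at this

/-! ### Alignments with points on given lines -/

/-- The determinant of the normals; it vanishes if and only if the lines are parallel. -/
def Line.det (L M : Line) : ℝ := L.normal 0 * M.normal 1 - L.normal 1 * M.normal 0

/-- The point whose inner products with the normals of `L`, `M` are `a`, `b`. -/
def Line.solve (L M : Line) (a b : ℝ) : Point :=
  !₂[(a * M.normal 1 - b * L.normal 1) / L.det M, (b * L.normal 0 - a * M.normal 0) / L.det M]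

/-- The coefficient of the cosine in a translation that puts `p` on `L` and, unless these lines
are parallel, `q` on `M`. -/
def shiftCos (L M : Line) (p q : Point) : Point :=
  if L.det M = 0 then p
  else L.solve M (L.normal 0 * p 0 + L.normal 1 * p 1) (M.normal 0 * q 0 + M.normal 1 * q 1)

/-- The coefficient of the sine. -/
def shiftSin (L M : Line) (p q : Point) : Point :=
  if L.det M = 0 then !₂[0 - p 1, p 0]
  else L.solve M (L.normal 1 * p 0 - L.normal 0 * p 1) (M.normal 1 * q 0 - M.normal 0 * q 1)

/-- The constant term. -/
def shiftConst (L M : Line) : Point :=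
  if L.det M = 0 then
    !₂[0 - L.offset * L.normal 0 / (L.normal 0 ^ 2 + L.normal 1 ^ 2),
      0 - L.offset * L.normal 1 / (L.normal 0 ^ 2 + L.normal 1 ^ 2)]
  else L.solve M (0 - L.offset) (0 - M.offset)

/-- The translation for the rotation with cosine `x` and sine `y`. -/
def shift (L M : Line) (p q : Point) (x y : ℝ) : Point :=
  !₂[x * shiftCos L M p q 0 + y * shiftSin L M p q 0 + shiftConst L M 0,
    x * shiftCos L M p q 1 + y * shiftSin L M p q 1 + shiftConst L M 1]

/-- The coefficients of the equation of `K` at the moved point `r`, as an affine function of the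
cosine and the sine. -/
def evCos (L M : Line) (p q : Point) (K : Line) (r : Point) : ℝ :=
  K.normal 0 * (r 0 - shiftCos L M p q 0) + K.normal 1 * (r 1 - shiftCos L M p q 1)

def evSin (L M : Line) (p q : Point) (K : Line) (r : Point) : ℝ :=
  K.normal 1 * (r 0 - shiftSin L M p q 1) - K.normal 0 * (r 1 + shiftSin L M p q 0)

def evConst (L M : Line) (K : Line) : ℝ :=
  K.offset + K.normal 0 * shiftConst L M 0 + K.normal 1 * shiftConst L M 1

theorem Line.ev_move (K : Line) (g : RigidMotion) (r : Point) :
    K.ev (g.move r) = K.normal 0 * (g.cs * r 0 - g.sn * r 1 - g.2 0) +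
      K.normal 1 * (g.sn * r 0 + g.cs * r 1 - g.2 1) - K.offset := by
  rw [ev, g.move_zero, g.move_one]

theorem ev_of_eq_shift {L M : Line} {p q : Point} {g : RigidMotion}
    (h : g.2 = shift L M p q g.cs g.sn) (K : Line) (r : Point) :
    K.ev (g.move r) =
      evCos L M p q K r * g.cs + evSin L M p q K r * g.sn - evConst L M K := by
  rw [K.ev_move, h]
  simp only [shift, evCos, evSin, evConst, PiLp.toLp_apply, Matrix.cons_val_zero,
    Matrix.cons_val_one]
  ring

/-- The alignments that put `p` on `L` and, unless these lines are parallel, `q` on `M`. -/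
def feasible (L M : Line) (p q : Point) : Set RigidMotion :=
  {g | L.ev (g.move p) = 0 ∧ (L.det M ≠ 0 → M.ev (g.move q) = 0)}

/-- For crossing lines the translation solves the two linear equations by Cramer's rule. For
parallel lines it is `R p` minus the foot of the perpendicular from the origin to `L`, so that `p`
lands on this foot. -/
theorem mkMotion_shift_mem_feasible (L M : Line) (p q : Point) (x y : ℝ) (h : x ^ 2 + y ^ 2 = 1) :
    mkMotion x y h (shift L M p q x y) ∈ feasible L M p q := by
  have hL := L.normSq_pos.ne'
  rw [feasible, Set.mem_ofPred_eq, L.ev_move, M.ev_move]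
  simp only [mkMotion_cs, mkMotion_sn, mkMotion_snd]
  by_cases hd : L.det M = 0
  · simp only [hd, ne_eq, not_true_eq_false, false_imp_iff, and_true]
    simp [shift, shiftCos, shiftSin, shiftConst, hd]
    field_simp
    ring
  · simp only [hd, ne_eq, not_false_eq_true, true_imp_iff]
    simp [shift, shiftCos, shiftSin, shiftConst, hd, Line.solve]
    constructor
    · field_simp
      simp only [Line.det]
      ring
    · field_simp
      simp only [Line.det]
      ring

/-- For a fixed rotation the two incidences are linear equations for the translation with
determinant `L.det M`, so the solution is unique. -/
theorem eq_shift_of_mem_feasible {L M : Line} {p q : Point} (hd : L.det M ≠ 0) {g : RigidMotion}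
    (hg : g ∈ feasible L M p q) : g.2 = shift L M p q g.cs g.sn := by
  have h' := mkMotion_shift_mem_feasible L M p q g.cs g.sn g.cs_sq_add_sn_sq
  rw [feasible, Set.mem_ofPred_eq, L.ev_move, M.ev_move] at hg h'
  obtain ⟨h1, h2⟩ := hg
  obtain ⟨h3, h4⟩ := h'
  replace h2 := h2 hd
  replace h4 := h4 hd
  simp only [mkMotion_cs, mkMotion_sn, mkMotion_snd] at h3 h4
  generalize shift L M p q g.cs g.sn = t at *
  apply Point.ext
  · apply mul_left_cancel₀ hd
    simp only [Line.det]
    linear_combination M.normal 1 * (h3 - h1) - L.normal 1 * (h4 - h2)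
  · apply mul_left_cancel₀ hd
    simp only [Line.det]
    linear_combination L.normal 0 * (h4 - h2) - M.normal 0 * (h3 - h1)

/-- On the feasible alignments, the equation of a line at a moved point is an affine function of
the cosine and the sine, if this line is parallel to `L` and `M` whenever these are parallel. -/
theorem ev_of_mem_feasible {L M : Line} {p q : Point} {g : RigidMotion}
    (hg : g ∈ feasible L M p q) {K : Line} (hK : L.det M = 0 → L.det K = 0) (r : Point) :
    K.ev (g.move r) =
      evCos L M p q K r * g.cs + evSin L M p q K r * g.sn - evConst L M K := by
  by_cases hd : L.det M = 0
  -- For parallel lines the translation is not unique, but two feasible translations for the same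
  -- rotation differ by a vector along `L`, which the equation of the parallel line `K` does not
  -- see.
  · have h' := mkMotion_shift_mem_feasible L M p q g.cs g.sn g.cs_sq_add_sn_sq
    rw [feasible, Set.mem_ofPred_eq, L.ev_move] at hg h'
    have h1 := hg.1
    have h2 := h'.1
    have e := ev_of_eq_shift (g := mkMotion g.cs g.sn g.cs_sq_add_sn_sq
      (shift L M p q g.cs g.sn)) (L := L) (M := M) (p := p) (q := q) (by simp) K r
    rw [Line.ev_move] at e ⊢
    simp only [mkMotion_cs, mkMotion_sn, mkMotion_snd] at h2 e
    rw [← e]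
    generalize shift L M p q g.cs g.sn = t at *
    have hLK : L.normal 0 * K.normal 1 - L.normal 1 * K.normal 0 = 0 := hK hd
    apply mul_left_cancel₀ L.normSq_pos.ne'
    linear_combination (K.normal 0 * L.normal 0 + K.normal 1 * L.normal 1) * (h1 - h2) +
      ((g.2 0 - t 0) * L.normal 1 - (g.2 1 - t 1) * L.normal 0) * hLK
  · exact ev_of_eq_shift (eq_shift_of_mem_feasible hd hg) K r

/-! ### Selections -/

/-- The feasible alignments that put `r` as close as possible to `K`. -/
def closest (L M : Line) (p q : Point) (K : Line) (r : Point) : Set RigidMotion :=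
  {g | g ∈ feasible L M p q ∧ ∀ g' ∈ feasible L M p q, |K.ev (g.move r)| ≤ |K.ev (g'.move r)|}

/-- Every rotation admits a feasible translation, and the residual depends on the rotation alone.
Minimizing over feasible alignments is thus minimizing over the whole unit circle. -/
theorem mem_closest_iff {L M : Line} {p q : Point} {K : Line} (hK : L.det M = 0 → L.det K = 0)
    {r : Point} {g : RigidMotion} (hg : g ∈ feasible L M p q) : g ∈ closest L M p q K r ↔
      CircleMin (evCos L M p q K r) (evSin L M p q K r) (evConst L M K) g.cs g.sn := by
  rw [closest, Set.mem_ofPred_eq, CircleMin, and_iff_right hg, and_iff_right g.cs_sq_add_sn_sq]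
  rw [ev_of_mem_feasible hg hK]
  constructor
  · intro h x y hxy
    have hm := mkMotion_shift_mem_feasible L M p q x y hxy
    have := h _ hm
    rwa [ev_of_mem_feasible hm hK, mkMotion_cs, mkMotion_sn] at this
  · intro h g' hg'
    rw [ev_of_mem_feasible hg' hK]
    exact h _ _ g'.cs_sq_add_sn_sq

/-- The alignment given by one of the two points `circlePt`. -/
def candidate (L M : Line) (p q : Point) (K : Line) (r : Point) (s : ℝ)
    (hs : s = 1 ∨ s = -1) : RigidMotion :=
  mkMotion _ _ (circlePt_sq (evCos L M p q K r) (evSin L M p q K r) (evConst L M K) hs)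
    (shift L M p q (circlePt s (evCos L M p q K r) (evSin L M p q K r) (evConst L M K)).1
      (circlePt s (evCos L M p q K r) (evSin L M p q K r) (evConst L M K)).2)

theorem candidate_mem_closest {L M : Line} (p q : Point) {K : Line}
    (hK : L.det M = 0 → L.det K = 0) (r : Point) {s : ℝ} (hs : s = 1 ∨ s = -1) :
    candidate L M p q K r s hs ∈ closest L M p q K r := by
  rw [candidate, mem_closest_iff hK (mkMotion_shift_mem_feasible L M p q _ _ _), mkMotion_cs,
    mkMotion_sn]
  exact circlePt_min _ _ _ hs

theorem finite_rotations {F : Set RigidMotion} {S : Set (ℝ × ℝ)} (hS : S.Finite)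
    (h : ∀ g ∈ F, (g.cs, g.sn) ∈ S) : (Prod.fst '' F).Finite := by
  refine Set.Finite.of_finite_image (f := fun R => (RigidMotion.cs (R, 0), RigidMotion.sn (R, 0)))
    (hS.subset ?_) ?_
  · rintro _ ⟨_, ⟨g, hg, rfl⟩, rfl⟩
    exact h g hg
  · rintro R - R' - hR
    exact (fst_eq_iff (R, 0) (R', 0)).2 (Prod.mk.inj hR)

theorem infinite_rotations {F : Set RigidMotion}
    (h : ∀ R, ∃ g ∈ F, g.1 = R) : (Prod.fst '' F).Infinite := by
  have hF : Prod.fst '' F = Set.univ := Set.eq_univ_of_forall fun R => by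
    obtain ⟨g, hg, hR⟩ := h R; exact ⟨g, hg, hR⟩
  rw [hF]
  have := (Set.Icc_infinite (zero_lt_one' ℝ)).to_subtype
  refine Set.infinite_of_injective_forall_mem
    (f := fun x : Set.Icc (0 : ℝ) 1 => rotation x √(1 - (x : ℝ) ^ 2) (by
      rw [Real.sq_sqrt (by nlinarith [x.2.1, x.2.2])]; ring)) ?_ (fun _ => Set.mem_univ _)
  intro x y hxy
  have := congrFun (congrFun (congrArg Subtype.val hxy) 0) 0
  simpa [rotation, Subtype.ext_iff] using this

theorem closest_finite {L M : Line} {p q : Point} {K : Line} (hK : L.det M = 0 → L.det K = 0)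
    {r : Point} (hN : evCos L M p q K r ^ 2 + evSin L M p q K r ^ 2 ≠ 0) :
    (Prod.fst '' closest L M p q K r).Finite := by
  refine finite_rotations (Set.toFinite {circlePt 1 (evCos L M p q K r) (evSin L M p q K r)
    (evConst L M K), circlePt (-1) (evCos L M p q K r) (evSin L M p q K r) (evConst L M K)})
    fun g hg => ?_
  exact (circleMin_iff hN).1 ((mem_closest_iff hK hg.1).1 hg)

/-- This makes the output of the closed formula a legitimate choice. If the residual is not
constant, the rotations that occur are precisely those of the two candidates. If it is constant,
every rotation occurs, and the default value `(1, 0)` of `circlePt` makes the two candidates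
coincide, so the selection is a singleton. -/
theorem isSelection_candidates {L M : Line} (p q : Point) {K : Line}
    (hK : L.det M = 0 → L.det K = 0) (r : Point) :
    IsSelection (closest L M p q K r)
      {candidate L M p q K r 1 (.inl rfl), candidate L M p q K r (-1) (.inr rfl)} := by
  refine ⟨?_, ?_⟩
  · rintro g (rfl | rfl)
    · exact candidate_mem_closest p q hK r _
    · exact candidate_mem_closest p q hK r _
  by_cases hN : evCos L M p q K r ^ 2 + evSin L M p q K r ^ 2 = 0
  · right
    refine ⟨infinite_rotations fun R => ?_, candidate L M p q K r 1 (.inl rfl), ?_⟩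
    · set g : RigidMotion := (R, 0)
      have hm := mkMotion_shift_mem_feasible L M p q g.cs g.sn g.cs_sq_add_sn_sq
      refine ⟨_, (mem_closest_iff hK hm).2 ?_, (fst_eq_iff _ g).2 ⟨mkMotion_cs _ _ _ _,
        mkMotion_sn _ _ _ _⟩⟩
      have hA : evCos L M p q K r = 0 := by
        nlinarith [sq_nonneg (evCos L M p q K r), sq_nonneg (evSin L M p q K r)]
      have hB : evSin L M p q K r = 0 := by
        nlinarith [sq_nonneg (evCos L M p q K r), sq_nonneg (evSin L M p q K r)]
      rw [hA, hB]
      exact ⟨RigidMotion.cs_sq_add_sn_sq _, fun x' y' _ => by simp⟩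
    · have : candidate L M p q K r (-1) (.inr rfl) = candidate L M p q K r 1 (.inl rfl) := by
        unfold candidate
        apply RigidMotion.ext <;> simp [circlePt, hN]
      rw [this, Set.pair_eq_singleton]
  · left
    refine ⟨closest_finite hK hN, ?_⟩
    rintro _ ⟨g, hg, rfl⟩
    have hc := (circleMin_iff hN).1 ((mem_closest_iff hK hg.1).1 hg)
    have huniq : ∀ g₁ g₂ : RigidMotion,
        g₁ ∈ ({candidate L M p q K r 1 (.inl rfl), candidate L M p q K r (-1) (.inr rfl)} :
          Set RigidMotion) →
        g₂ ∈ ({candidate L M p q K r 1 (.inl rfl), candidate L M p q K r (-1) (.inr rfl)} :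
          Set RigidMotion) → g₁.1 = g₂.1 → g₁ = g₂ := by
      -- Both candidates take their translation from `shift`, so equal rotations give equal
      -- alignments.
      have hsh : ∀ g₁ ∈ ({candidate L M p q K r 1 (.inl rfl),
          candidate L M p q K r (-1) (.inr rfl)} : Set RigidMotion),
          g₁.2 = shift L M p q g₁.cs g₁.sn := by
        rintro g₁ (rfl | rfl) <;> simp [candidate]
      intro g₁ g₂ h₁ h₂ h
      obtain ⟨h3, h4⟩ := (fst_eq_iff _ _).1 h
      exact RigidMotion.ext h3 h4 (by rw [hsh _ h₁, hsh _ h₂, h3, h4])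
    have hex : ∃ g', g' ∈ ({candidate L M p q K r 1 (.inl rfl),
        candidate L M p q K r (-1) (.inr rfl)} : Set RigidMotion) ∧ g'.1 = g.1 := by
      rcases hc with hc | hc
      · refine ⟨_, Or.inl rfl, (fst_eq_iff _ _).2 ?_⟩
        simp [candidate, ← hc]
      · refine ⟨_, Or.inr rfl, (fst_eq_iff _ _).2 ?_⟩
        simp [candidate, ← hc]
    obtain ⟨g', hg', h'⟩ := hex
    exact ⟨g', ⟨hg', h'⟩, fun g'' h'' => huniq _ _ h''.1 hg' (h''.2.trans h'.symm)⟩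

end PointsToLines
end

noncomputable section

namespace PointsToLines

/-! ### The alignments of Align as minimizers -/

theorem dist_sq_eq (p q : Point) : dist p q ^ 2 = (q 0 - p 0) ^ 2 + (q 1 - p 1) ^ 2 := by
  rw [dist_comm, dist_eq_norm, norm_sq_eq]; simp

/-- The matrices `P`, `Q`, `Z` of an iteration of Align. -/
def configs (v w p q y : Point) :
    Matrix (Fin 2) (Fin 2) ℝ × Matrix (Fin 2) (Fin 2) ℝ × Matrix (Fin 2) (Fin 2) ℝ :=
  let U := toXAxis (perp v)
  let M := zConfigs (Matrix.toEuclideanLin U (perp w)) p q y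
  (U.transpose * M.1, U.transpose * M.2.1, U.transpose * M.2.2)

/-- The image of the vector `q - p` in the configuration with parameter `x`. -/
def configEdge (v x : Point) : Point := !₂[v 1 * x 1 - v 0 * x 0, 0 - v 0 * x 1 - v 1 * x 0]

/-- The quotient is the cotangent of the angle from `v` to `w`; the first point moves along the
direction `perp v` of its line. -/
theorem configs_fst (v w p q y x : Point) :
    Matrix.toEuclideanLin (configs v w p q y).1 x =
      (dist p q * ((v 0 * w 0 + v 1 * w 1) / (v 0 * w 1 - v 1 * w 0) * x 0 + x 1)) • perp v := by
  apply Point.ext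
  · rw [toEuclideanLin_zero]
    simp [configs, zConfigs, toXAxis, toEuclideanLin_zero, toEuclideanLin_one, Matrix.mul_apply,
      Fin.sum_univ_two]
    ring
  · rw [toEuclideanLin_one]
    simp [configs, zConfigs, toXAxis, toEuclideanLin_zero, toEuclideanLin_one, Matrix.mul_apply,
      Fin.sum_univ_two]
    ring

/-- In Z-Configs, `Q - P` is `r₁` times the quarter turn. The edge from the first to the second
point therefore keeps its length and turns with `x`. -/
theorem configs_snd (v w p q y x : Point) :
    Matrix.toEuclideanLin (configs v w p q y).2.1 x =
      Matrix.toEuclideanLin (configs v w p q y).1 x + dist p q • configEdge v x := by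
  rw [configs_fst]
  apply Point.ext
  · rw [toEuclideanLin_zero]
    simp [configs, zConfigs, toXAxis, toEuclideanLin_zero, toEuclideanLin_one, Matrix.mul_apply,
      Fin.sum_univ_two, configEdge]
    ring
  · rw [toEuclideanLin_one]
    simp [configs, zConfigs, toXAxis, toEuclideanLin_zero, toEuclideanLin_one, Matrix.mul_apply,
      Fin.sum_univ_two, configEdge]
    ring

/-- The second point of a configuration is on the line spanned by `perp w`. -/
theorem inner_configs_snd {v w : Point} (p q y x : Point)
    (hd : v 0 * w 1 - v 1 * w 0 ≠ 0) :
    inner ℝ w (Matrix.toEuclideanLin (configs v w p q y).2.1 x) = 0 := by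
  rw [configs_snd, configs_fst, inner_eq]
  have hk := div_mul_cancel₀ (v 0 * w 0 + v 1 * w 1) hd
  generalize (v 0 * w 0 + v 1 * w 1) / (v 0 * w 1 - v 1 * w 0) = k at *
  simp [configEdge]
  linear_combination dist p q * x 0 * hk

theorem inner_configs_fst (v w p q y x : Point) :
    inner ℝ v (Matrix.toEuclideanLin (configs v w p q y).1 x) = 0 := by
  rw [configs_fst, inner_eq]
  simp
  ring

theorem configs_trd_of_eq {v w p q y : Point} (h : dist p q = 0) (x : Point) :
    Matrix.toEuclideanLin (configs v w p q y).2.2 x =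
      dist p y • !₂[0 - v 1 * x 0 - v 0 * x 1, v 0 * x 0 - v 1 * x 1] := by
  apply Point.ext
  · rw [toEuclideanLin_zero]
    simp only [configs, zConfigs, h, if_true]
    simp [toXAxis, Matrix.mul_apply, Fin.sum_univ_two]
    ring
  · rw [toEuclideanLin_one]
    simp only [configs, zConfigs, h, if_true]
    simp [toXAxis, Matrix.mul_apply, Fin.sum_univ_two]
    ring

/-- The numbers `d₁ / r₁` and `β d₂ / r₁` are the coordinates of `y - p` in the orthogonal basis
formed by `q - p` and its quarter turn. Multiplied by `r₁²` they are a dot and a cross product. By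
Lagrange's identity `r₂² - d₁²` is the square of the cross product over `r₁`, so the absolute value
under the root is harmless and `β` restores the sign. When the cross product vanishes, so does `d₂`,
and `β` does not matter. -/
theorem zConfigs_coefs {p q y : Point} (h : dist p q ≠ 0) :
    (dist p q ^ 2 + dist p y ^ 2 - dist q y ^ 2) / (2 * dist p q) / dist p q * dist p q ^ 2 =
      (y 0 - p 0) * (q 0 - p 0) + (y 1 - p 1) * (q 1 - p 1) ∧
    (if 0 < inner ℝ (y - p) (perp (q - p)) then (1 : ℝ) else -1) *
      (√|dist p y ^ 2 - ((dist p q ^ 2 + dist p y ^ 2 - dist q y ^ 2) / (2 * dist p q)) ^ 2| /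
        dist p q) * dist p q ^ 2 =
      (y 1 - p 1) * (q 0 - p 0) - (y 0 - p 0) * (q 1 - p 1) := by
  have h1 := dist_sq_eq p q
  have h2 := dist_sq_eq p y
  have h3 := dist_sq_eq q y
  have hpos : 0 < dist p q := lt_of_le_of_ne dist_nonneg h.symm
  have hin : inner ℝ (y - p) (perp (q - p)) =
      (y 1 - p 1) * (q 0 - p 0) - (y 0 - p 0) * (q 1 - p 1) := by
    rw [inner_eq]; simp; ring
  rw [hin]
  generalize dist p q = r at *
  rw [h2, h3]
  constructor
  · field_simp
    rw [h1]; ring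
  set k := (y 1 - p 1) * (q 0 - p 0) - (y 0 - p 0) * (q 1 - p 1) with hk
  have e : (y 0 - p 0) ^ 2 + (y 1 - p 1) ^ 2 - ((r ^ 2 + ((y 0 - p 0) ^ 2 + (y 1 - p 1) ^ 2) -
      ((y 0 - q 0) ^ 2 + (y 1 - q 1) ^ 2)) / (2 * r)) ^ 2 = (k / r) ^ 2 := by
    have h4 : r ^ 2 + ((y 0 - p 0) ^ 2 + (y 1 - p 1) ^ 2) -
        ((y 0 - q 0) ^ 2 + (y 1 - q 1) ^ 2) =
        2 * ((y 0 - p 0) * (q 0 - p 0) + (y 1 - p 1) * (q 1 - p 1)) := by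
      rw [h1]; ring
    rw [h4]
    field_simp
    rw [h1, hk]; ring
  rw [e, abs_of_nonneg (sq_nonneg _), Real.sqrt_sq_eq_abs, abs_div, abs_of_pos hpos]
  by_cases h0 : 0 < k
  · rw [if_pos h0, abs_of_pos h0]; field_simp
  · rw [if_neg h0, abs_of_nonpos (not_lt.1 h0)]; field_simp

theorem quarterTurn_entries : quarterTurn 0 0 = 0 ∧ quarterTurn 0 1 = -1 ∧ quarterTurn 1 0 = 1 ∧
    quarterTurn 1 1 = 0 := by simp [quarterTurn]

/-- The third point has the same coordinates relative to the turned edge as `y` has relative to `q -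
p`. The factor `r₁²` clears the denominators. -/
theorem configs_trd {v w p q y : Point} (h : dist p q ≠ 0) (x : Point) :
    dist p q ^ 2 • Matrix.toEuclideanLin (configs v w p q y).2.2 x =
      dist p q ^ 2 • Matrix.toEuclideanLin (configs v w p q y).1 x +
      ((y 0 - p 0) * (q 0 - p 0) + (y 1 - p 1) * (q 1 - p 1)) • dist p q • configEdge v x +
      ((y 1 - p 1) * (q 0 - p 0) - (y 0 - p 0) * (q 1 - p 1)) •
        perp (dist p q • configEdge v x) := by
  obtain ⟨h1, h2⟩ := zConfigs_coefs (y := y) h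
  rw [← h1, ← h2]
  apply Point.ext
  · simp only [PiLp.add_apply, PiLp.smul_apply, toEuclideanLin_zero, perp_zero, smul_eq_mul]
    simp only [configs, zConfigs, h, if_false]
    generalize (if 0 < inner ℝ (y - p) (perp (q - p)) then (1 : ℝ) else -1) = β
    generalize √|dist p y ^ 2 - ((dist p q ^ 2 + dist p y ^ 2 - dist q y ^ 2) /
      (2 * dist p q)) ^ 2| = d₂
    generalize (dist p q ^ 2 + dist p y ^ 2 - dist q y ^ 2) / (2 * dist p q) = d₁
    simp [toXAxis, Matrix.mul_apply, Fin.sum_univ_two, configEdge, quarterTurn_entries]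
    ring
  · simp only [PiLp.add_apply, PiLp.smul_apply, toEuclideanLin_one, perp_one, smul_eq_mul]
    simp only [configs, zConfigs, h, if_false]
    generalize (if 0 < inner ℝ (y - p) (perp (q - p)) then (1 : ℝ) else -1) = β
    generalize √|dist p y ^ 2 - ((dist p q ^ 2 + dist p y ^ 2 - dist q y ^ 2) /
      (2 * dist p q)) ^ 2| = d₂
    generalize (dist p q ^ 2 + dist p y ^ 2 - dist q y ^ 2) / (2 * dist p q) = d₁
    simp [toXAxis, Matrix.mul_apply, Fin.sum_univ_two, configEdge, quarterTurn_entries]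
    ring

/-- There is a rotation that takes a vector to a given vector of the same length. -/
theorem exists_rotation {a b c d : ℝ} (h : a ^ 2 + b ^ 2 = c ^ 2 + d ^ 2) :
    ∃ x y : ℝ, x ^ 2 + y ^ 2 = 1 ∧ x * a - y * b = c ∧ y * a + x * b = d := by
  by_cases h0 : a ^ 2 + b ^ 2 = 0
  · have ha : a = 0 := by nlinarith [sq_nonneg a, sq_nonneg b]
    have hb : b = 0 := by nlinarith [sq_nonneg a, sq_nonneg b]
    have hc : c = 0 := by nlinarith [sq_nonneg c, sq_nonneg d]
    have hd : d = 0 := by nlinarith [sq_nonneg c, sq_nonneg d]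
    exact ⟨1, 0, by norm_num, by simp [*], by simp [*]⟩
  -- Real and imaginary part of the complex quotient `(c + d i) / (a + b i)`.
  · refine ⟨(a * c + b * d) / (a ^ 2 + b ^ 2), (a * d - b * c) / (a ^ 2 + b ^ 2), ?_, ?_, ?_⟩
    · field_simp
      linear_combination (-(a ^ 2 + b ^ 2)) * h
    · field_simp; ring
    · field_simp; ring

theorem eq_of_inner_eq {v w a b : Point} (hd : v 0 * w 1 - v 1 * w 0 ≠ 0)
    (h1 : inner ℝ v a = inner ℝ v b) (h2 : inner ℝ w a = inner ℝ w b) : a = b := by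
  rw [inner_eq, inner_eq] at h1 h2
  apply Point.ext
  · apply mul_left_cancel₀ hd
    linear_combination w 1 * h1 - v 1 * h2
  · apply mul_left_cancel₀ hd
    linear_combination v 0 * h2 - w 0 * h1

/-- A rotation preserves coordinates relative to an edge and its quarter turn, so the images of `p ≠
q` determine that of `y`. -/
theorem configs_trd_move {v w p q y x s : Point} {g : RigidMotion} (h : dist p q ≠ 0)
    (h1 : g.move p = Matrix.toEuclideanLin (configs v w p q y).1 x + s)
    (h2 : g.move q = Matrix.toEuclideanLin (configs v w p q y).2.1 x + s) :
    g.move y = Matrix.toEuclideanLin (configs v w p q y).2.2 x + s := by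
  have hz := configs_trd (v := v) (w := w) (y := y) h x
  rw [configs_snd] at h2
  have hr := dist_sq_eq p q
  have e : dist p q • configEdge v x = g.move q - g.move p := by rw [h1, h2]; module
  rw [e] at hz
  have e1 : Matrix.toEuclideanLin (configs v w p q y).1 x = g.move p - s := by rw [h1]; module
  rw [e1] at hz
  apply Point.ext
  · have hz0 := congrArg (fun u : Point => u 0) hz
    simp only [PiLp.add_apply, PiLp.smul_apply, PiLp.sub_apply, perp_zero, smul_eq_mul,
      g.move_zero, g.move_one] at hz0 ⊢
    apply mul_left_cancel₀ (pow_ne_zero 2 h)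
    rw [mul_add, hz0, hr]
    ring
  · have hz0 := congrArg (fun u : Point => u 1) hz
    simp only [PiLp.add_apply, PiLp.smul_apply, PiLp.sub_apply, perp_one, smul_eq_mul,
      g.move_zero, g.move_one] at hz0 ⊢
    apply mul_left_cancel₀ (pow_ne_zero 2 h)
    rw [mul_add, hz0, hr]
    ring

/-- Every alignment that puts `p` and `q` on the two lines through `s` is a configuration. -/
theorem exists_config {v w : Point} (p q y s : Point) (hv : v 0 ^ 2 + v 1 ^ 2 = 1)
    (hd : v 0 * w 1 - v 1 * w 0 ≠ 0) {g : RigidMotion}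
    (h1 : inner ℝ v (g.move p) = inner ℝ v s) (h2 : inner ℝ w (g.move q) = inner ℝ w s) :
    ∃ x : Point, ‖x‖ = 1 ∧ g.move p = Matrix.toEuclideanLin (configs v w p q y).1 x + s ∧
      g.move q = Matrix.toEuclideanLin (configs v w p q y).2.1 x + s ∧
      g.move y = Matrix.toEuclideanLin (configs v w p q y).2.2 x + s := by
  have hg := g.cs_sq_add_sn_sq
  by_cases hr : dist p q = 0
  · have hpq : p = q := dist_eq_zero.1 hr
    subst hpq
    have hs : g.move p = s := eq_of_inner_eq hd h1 h2
    have hy := dist_sq_eq p y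
    have hP : ∀ x, Matrix.toEuclideanLin (configs v w p p y).1 x = 0 := fun x => by
      rw [configs_fst]; simp
    have hQ : ∀ x, Matrix.toEuclideanLin (configs v w p p y).2.1 x = 0 := fun x => by
      rw [configs_snd, hP]; simp
    simp only [hP, hQ, zero_add, hs, true_and, configs_trd_of_eq hr, norm_eq_one_iff]
    rw [← hs]
    by_cases hr2 : dist p y = 0
    · have hpy : p = y := dist_eq_zero.1 hr2
      subst hpy
      -- All three points coincide and `Z = 0`; any unit vector serves.
      exact ⟨!₂[1, 0], by simp, by simp⟩
    · set e0 := g.cs * (y 0 - p 0) - g.sn * (y 1 - p 1) with he0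
      set e1 := g.sn * (y 0 - p 0) + g.cs * (y 1 - p 1) with he1
      have he : e0 ^ 2 + e1 ^ 2 = dist p y ^ 2 := by
        rw [hy, he0, he1]
        linear_combination ((y 0 - p 0) ^ 2 + (y 1 - p 1) ^ 2) * hg
      -- The solution of `Z x = e`, where `e` is the rotated vector `y - p` and `Z` is `dist p y`
      -- times an orthogonal matrix.
      refine ⟨!₂[(v 0 * e1 - v 1 * e0) / dist p y, (0 - v 0 * e0 - v 1 * e1) / dist p y], ?_, ?_⟩
      · simp
        field_simp
        linear_combination (e0 ^ 2 + e1 ^ 2) * hv + he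
      · apply Point.ext
        · simp [g.move_zero]
          field_simp
          linear_combination (-e0) * hv - he0
        · simp [g.move_one]
          field_simp
          linear_combination (-e1) * hv - he1
  · have hq := dist_sq_eq p q
    set e0 := g.cs * (q 0 - p 0) - g.sn * (q 1 - p 1) with he0
    set e1 := g.sn * (q 0 - p 0) + g.cs * (q 1 - p 1) with he1
    have he : e0 ^ 2 + e1 ^ 2 = dist p q ^ 2 := by
      rw [hq, he0, he1]
      linear_combination ((q 0 - p 0) ^ 2 + (q 1 - p 1) ^ 2) * hg
    -- Chosen so that `dist p q • configEdge v x` is the rotated vector `q - p`.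
    set x : Point := !₂[(0 - v 0 * e0 - v 1 * e1) / dist p q, (v 1 * e0 - v 0 * e1) / dist p q]
      with hx
    have hx1 : ‖x‖ = 1 := by
      rw [norm_eq_one_iff, hx]
      simp
      field_simp
      linear_combination (e0 ^ 2 + e1 ^ 2) * hv + he
    have hedge : dist p q • configEdge v x = g.move q - g.move p := by
      apply Point.ext
      · simp [configEdge, hx, g.move_zero]
        field_simp
        linear_combination e0 * hv + he0
      · simp [configEdge, hx, g.move_one]
        field_simp
        linear_combination e1 * hv + he1
    -- Once the edge is known, the two incidences fix the inner products of the first point with `v`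
    -- and `w`, hence its position.
    have hp : g.move p = Matrix.toEuclideanLin (configs v w p q y).1 x + s := by
      refine eq_of_inner_eq hd ?_ ?_
      · rw [inner_add_right, inner_configs_fst, h1, zero_add]
      · have := inner_configs_snd p q y x hd
        rw [configs_snd, hedge, inner_add_right, inner_sub_right, h2] at this
        rw [inner_add_right]
        linarith
    have hq' : g.move q = Matrix.toEuclideanLin (configs v w p q y).2.1 x + s := by
      rw [configs_snd, hedge, add_right_comm, ← hp]; module
    exact ⟨x, hx1, hp, hq', configs_trd_move hr hp hq'⟩

/-- Every configuration comes from an alignment. -/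
theorem exists_motion_of_config {v : Point} (w p q y s : Point) (hv : v 0 ^ 2 + v 1 ^ 2 = 1)
    {x : Point} (hx : ‖x‖ = 1) :
    ∃ g : RigidMotion, g.move p = Matrix.toEuclideanLin (configs v w p q y).1 x + s ∧
      g.move q = Matrix.toEuclideanLin (configs v w p q y).2.1 x + s ∧
      g.move y = Matrix.toEuclideanLin (configs v w p q y).2.2 x + s := by
  rw [norm_eq_one_iff] at hx
  by_cases hr : dist p q = 0
  · have hpq : p = q := dist_eq_zero.1 hr
    subst hpq
    have hP : ∀ x, Matrix.toEuclideanLin (configs v w p p y).1 x = 0 := fun x => by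
      rw [configs_fst]; simp
    have hQ : ∀ x, Matrix.toEuclideanLin (configs v w p p y).2.1 x = 0 := fun x => by
      rw [configs_snd, hP]; simp
    have hy := dist_sq_eq p y
    obtain ⟨c, d, hcd, h1, h2⟩ := exists_rotation (a := y 0 - p 0) (b := y 1 - p 1)
      (c := dist p y * (0 - v 1 * x 0 - v 0 * x 1)) (d := dist p y * (v 0 * x 0 - v 1 * x 1)) (by
        rw [← hy]
        linear_combination (-dist p y ^ 2 * (x 0 ^ 2 + x 1 ^ 2)) * hv - dist p y ^ 2 * hx)
    simp only [hP, hQ, zero_add, configs_trd_of_eq hr]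
    have hp : (mkMotion c d hcd !₂[c * p 0 - d * p 1 - s 0, d * p 0 + c * p 1 - s 1]).move p =
        s := by
      apply Point.ext
      · simp [RigidMotion.move_zero]
      · simp [RigidMotion.move_one]
    refine ⟨_, hp, hp, ?_⟩
    apply Point.ext
    · simp [RigidMotion.move_zero]; linarith
    · simp [RigidMotion.move_one]; linarith
  · have hq := dist_sq_eq p q
    obtain ⟨c, d, hcd, h1, h2⟩ := exists_rotation (a := q 0 - p 0) (b := q 1 - p 1)
      (c := dist p q * (v 1 * x 1 - v 0 * x 0)) (d := dist p q * (0 - v 0 * x 1 - v 1 * x 0)) (by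
        rw [← hq]
        linear_combination (-dist p q ^ 2 * (x 0 ^ 2 + x 1 ^ 2)) * hv - dist p q ^ 2 * hx)
    set b := Matrix.toEuclideanLin (configs v w p q y).1 x + s with hb
    set g := mkMotion c d hcd !₂[c * p 0 - d * p 1 - b 0, d * p 0 + c * p 1 - b 1] with hgd
    have hp : g.move p = b := by
      apply Point.ext
      · simp [RigidMotion.move_zero, hgd]
      · simp [RigidMotion.move_one, hgd]
    have hq' : g.move q = Matrix.toEuclideanLin (configs v w p q y).2.1 x + s := by
      rw [configs_snd, add_right_comm, ← hb]
      apply Point.ext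
      · simp [RigidMotion.move_zero, hgd, configEdge]; linarith
      · simp [RigidMotion.move_one, hgd, configEdge]; linarith
    exact ⟨g, hp, hq', configs_trd_move hr hp hq'⟩

/-- Two equations of a line, one of them with a unit normal, are proportional. -/
theorem Line.exists_scale {L : Line} {v : Point} {b : ℝ} (hv : ‖v‖ = 1)
    (h : L.carrier = hyperplane v b) :
    ∃ c : ℝ, c ≠ 0 ∧ L.normal 0 = c * v 0 ∧ L.normal 1 = c * v 1 ∧ L.offset = c * b := by
  rw [norm_eq_one_iff] at hv
  have hN := L.normSq_pos
  have h0 := hN.ne'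
  -- These points are the foot of the perpendicular from the origin plus multiples of the direction
  -- of the line. Comparing `s = 0` with `s = 1` shows that `v` is orthogonal to the direction.
  have key : ∀ s : ℝ, inner ℝ v (!₂[L.offset * L.normal 0 / (L.normal 0 ^ 2 + L.normal 1 ^ 2) -
      s * L.normal 1, L.offset * L.normal 1 / (L.normal 0 ^ 2 + L.normal 1 ^ 2) +
      s * L.normal 0] : Point) = b := by
    intro s
    have : (!₂[L.offset * L.normal 0 / (L.normal 0 ^ 2 + L.normal 1 ^ 2) - s * L.normal 1,
        L.offset * L.normal 1 / (L.normal 0 ^ 2 + L.normal 1 ^ 2) + s * L.normal 0] : Point) ∈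
        L.carrier := by
      rw [mem_carrier, ev]; simp; field_simp; ring
    rw [h] at this
    exact this
  have k0 := key 0
  have k1 := key 1
  rw [inner_eq] at k0 k1
  simp at k0 k1
  have hperp : v 1 * L.normal 0 - v 0 * L.normal 1 = 0 := by linarith
  have e0 : L.normal 0 = (L.normal 0 * v 0 + L.normal 1 * v 1) * v 0 := by
    linear_combination (-L.normal 0) * hv + v 1 * hperp
  have e1 : L.normal 1 = (L.normal 0 * v 0 + L.normal 1 * v 1) * v 1 := by
    linear_combination (-L.normal 1) * hv - v 0 * hperp
  refine ⟨L.normal 0 * v 0 + L.normal 1 * v 1, ?_, e0, e1, ?_⟩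
  · intro hc
    rw [hc, zero_mul] at e0 e1
    rw [e0, e1] at hN
    simp at hN
  · rw [← k0]
    field_simp
    linear_combination L.offset * (v 1 * L.normal 0 - v 0 * L.normal 1) * hperp -
      L.offset * (L.normal 0 ^ 2 + L.normal 1 ^ 2) * hv

/-- For unit vectors the squares of the dot and the cross product sum to 1, and `L.det M` is a
nonzero multiple of the cross product. The branch taken by Align thus depends only on the lines, not
on the chosen unit normals. -/
theorem abs_inner_eq_one_iff {L M : Line} {v w : Point} {b c : ℝ} (hv : ‖v‖ = 1) (hw : ‖w‖ = 1)
    (hL : L.carrier = hyperplane v b) (hM : M.carrier = hyperplane w c) :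
    |inner ℝ v w| = 1 ↔ L.det M = 0 := by
  obtain ⟨s, hs, h1, h2, -⟩ := L.exists_scale hv hL
  obtain ⟨t, ht, h3, h4, -⟩ := M.exists_scale hw hM
  rw [norm_eq_one_iff] at hv hw
  have e : L.det M = s * t * (v 0 * w 1 - v 1 * w 0) := by
    rw [Line.det, h1, h2, h3, h4]; ring
  rw [e, mul_eq_zero, or_iff_right (mul_ne_zero hs ht), inner_eq]
  have e2 : (v 0 * w 0 + v 1 * w 1) ^ 2 + (v 0 * w 1 - v 1 * w 0) ^ 2 = 1 := by
    linear_combination (w 0 ^ 2 + w 1 ^ 2) * hv + hw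
  constructor
  · intro h
    rw [← sq_abs, h] at e2
    exact pow_eq_zero_iff two_ne_zero |>.1 (by linarith)
  · intro h
    rw [h, ← sq_abs] at e2
    nlinarith [abs_nonneg (v 0 * w 0 + v 1 * w 1)]

/-- Unit vectors `x` and feasible alignments correspond by `exists_config` and
`exists_motion_of_config`, and `|v_lᵀ Z x - c_l|` is the residual of the third line up to a constant
factor. Hence the argmin over `x` is the argmin over feasible alignments, whatever `v` and `b` were
chosen. -/
theorem crossingAlignments_eq {m : ℕ} {A : Fin m → Point × Line} {v : Fin m → Point}
    {b : Fin m → ℝ} (hvb : ∀ i, ‖v i‖ = 1 ∧ (A i).2.carrier = hyperplane (v i) (b i))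
    {j k : Fin m} (l : Fin m) (hd : (A j).2.det (A k).2 ≠ 0) :
    crossingAlignments A v b j k l =
      closest (A j).2 (A k).2 (A j).1 (A k).1 (A l).2 (A l).1 := by
  obtain ⟨c, hc, c0, c1, c2⟩ := (A j).2.exists_scale (hvb j).1 (hvb j).2
  obtain ⟨d, hd', d0, d1, d2⟩ := (A k).2.exists_scale (hvb k).1 (hvb k).2
  obtain ⟨f, hf, f0, f1, f2⟩ := (A l).2.exists_scale (hvb l).1 (hvb l).2
  have hv := (norm_eq_one_iff _).1 (hvb j).1
  have hdet : v j 0 * v k 1 - v j 1 * v k 0 ≠ 0 := by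
    intro h0; apply hd; rw [Line.det, c0, c1, d0, d1]
    linear_combination c * d * h0
  have evj : ∀ q, (A j).2.ev q = 0 ↔ inner ℝ (v j) q = b j := fun q => by
    rw [← Line.mem_carrier, (hvb j).2]; rfl
  have evk : ∀ q, (A k).2.ev q = 0 ↔ inner ℝ (v k) q = b k := fun q => by
    rw [← Line.mem_carrier, (hvb k).2]; rfl
  have evl : ∀ q, |(A l).2.ev q| = |f| * |inner ℝ (v l) q - b l| := fun q => by
    rw [Line.ev, f0, f1, f2, inner_eq, ← abs_mul]; congr 1; ring
  have hf' : 0 < |f| := abs_pos.2 hf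
  have hfeas : ∀ g, g ∈ feasible (A j).2 (A k).2 (A j).1 (A k).1 ↔
      inner ℝ (v j) (g.move (A j).1) = b j ∧ inner ℝ (v k) (g.move (A k).1) = b k := fun g => by
    rw [feasible, Set.mem_ofPred_eq, evj, evk]; simp [hd]
  have hmem : ∀ g s x, inner ℝ (v j) s = b j → inner ℝ (v k) s = b k →
      g.move (A j).1 = Matrix.toEuclideanLin
        (configs (v j) (v k) (A j).1 (A k).1 (A l).1).1 x + s →
      g.move (A k).1 = Matrix.toEuclideanLin
        (configs (v j) (v k) (A j).1 (A k).1 (A l).1).2.1 x + s →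
      g ∈ feasible (A j).2 (A k).2 (A j).1 (A k).1 := by
    intro g s x hs1 hs2 h1 h2
    rw [hfeas, h1, h2, inner_add_right, inner_add_right, inner_configs_fst,
      inner_configs_snd _ _ _ _ hdet, hs1, hs2]
    simp
  ext g
  change (∃ s x : Point, s ∈ (A j).2.carrier ∩ (A k).2.carrier ∧
    IsUnitArgmin (v l) (configs (v j) (v k) (A j).1 (A k).1 (A l).1).2.2
      (b l - inner ℝ (v l) s) x ∧
    g.move (A j).1 = Matrix.toEuclideanLin
      (configs (v j) (v k) (A j).1 (A k).1 (A l).1).1 x + s ∧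
    g.move (A k).1 = Matrix.toEuclideanLin
      (configs (v j) (v k) (A j).1 (A k).1 (A l).1).2.1 x + s ∧
    g.move (A l).1 = Matrix.toEuclideanLin
      (configs (v j) (v k) (A j).1 (A k).1 (A l).1).2.2 x + s) ↔ _
  rw [closest, Set.mem_ofPred_eq]
  constructor
  · rintro ⟨s, x, ⟨hs1, hs2⟩, ⟨hx, hmin⟩, h1, h2, h3⟩
    rw [Line.mem_carrier, evj] at hs1
    rw [Line.mem_carrier, evk] at hs2
    refine ⟨hmem g s x hs1 hs2 h1 h2, fun g' hg' => ?_⟩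
    rw [hfeas] at hg'
    obtain ⟨x', hx', h1', h2', h3'⟩ := exists_config (A j).1 (A k).1 (A l).1 s hv hdet
      (hg'.1.trans hs1.symm) (hg'.2.trans hs2.symm)
    rw [evl, evl, h3, h3', inner_add_right, inner_add_right]
    refine mul_le_mul_of_nonneg_left ?_ hf'.le
    have := hmin x' hx'
    rwa [sub_sub_eq_add_sub, sub_sub_eq_add_sub] at this
  · rintro ⟨hg, hmin⟩
    obtain ⟨s, hs1, hs2⟩ : ∃ s : Point, inner ℝ (v j) s = b j ∧ inner ℝ (v k) s = b k := by
      refine ⟨!₂[(b j * v k 1 - b k * v j 1) / (v j 0 * v k 1 - v j 1 * v k 0),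
        (b k * v j 0 - b j * v k 0) / (v j 0 * v k 1 - v j 1 * v k 0)], ?_, ?_⟩
      · rw [inner_eq]; simp
        rw [mul_div_assoc', mul_div_assoc', ← add_div, div_eq_iff hdet]; ring
      · rw [inner_eq]; simp
        rw [mul_div_assoc', mul_div_assoc', ← add_div, div_eq_iff hdet]; ring
    have hg' := (hfeas g).1 hg
    obtain ⟨x, hx, h1, h2, h3⟩ := exists_config (A j).1 (A k).1 (A l).1 s hv hdet
      (hg'.1.trans hs1.symm) (hg'.2.trans hs2.symm)
    refine ⟨s, x, ⟨?_, ?_⟩, ⟨hx, fun y hy => ?_⟩, h1, h2, h3⟩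
    · rwa [Line.mem_carrier, evj]
    · rwa [Line.mem_carrier, evk]
    · obtain ⟨g', h1', h2', h3'⟩ := exists_motion_of_config (v k) (A j).1 (A k).1 (A l).1 s hv hy
      have := hmin g' (hmem g' s y hs1 hs2 h1' h2')
      rw [evl, evl, h3, h3', inner_add_right, inner_add_right] at this
      have := le_of_mul_le_mul_left this hf'
      rwa [sub_sub_eq_add_sub, sub_sub_eq_add_sub]

theorem parallelAlignments_eq {m : ℕ} (A : Fin m → Point × Line) {j k : Fin m}
    (hd : (A j).2.det (A k).2 = 0) : parallelAlignments A j k =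
      closest (A j).2 (A k).2 (A j).1 (A k).1 (A k).2 (A k).1 := by
  ext g
  simp only [parallelAlignments, closest, feasible, Set.mem_ofPred_eq, Line.mem_carrier,
    Line.infDist_le_iff, hd, ne_eq, not_true_eq_false, false_imp_iff, and_true]

end PointsToLines
end

noncomputable section

namespace PointsToLines

/-! ### Existence of optimal alignments -/

/-- Away from 0, monotonicity bounds `h` from below on the right of `x`, and `h x' ≥ (x' / x) ^ r *
h x` does so on the left. At 0, where `h` may jump upwards, monotonicity suffices. -/
theorem IsLogLipschitz.lowerSemicontinuous {r : ℝ} {h : ℝ≥0 → ℝ≥0} (hh : IsLogLipschitz r h) :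
    LowerSemicontinuous h := by
  obtain ⟨hr, hmono, hlip⟩ := hh
  intro x y hy
  rcases eq_or_ne x 0 with rfl | hx
  · exact Filter.Eventually.of_forall fun x' => hy.trans_le (hmono (zero_le (a := x')))
  · have hc : Continuous fun x' : ℝ≥0 => (x' / x) ^ r * h x :=
      ((NNReal.continuous_rpow_const hr.le).comp (continuous_id.div_const x)).mul continuous_const
    have ht : Filter.Tendsto (fun x' : ℝ≥0 => (x' / x) ^ r * h x) (nhds x) (nhds (h x)) := by
      have := hc.tendsto x
      rwa [div_self hx, NNReal.one_rpow, one_mul] at this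
    have h0 : ∀ᶠ x' in nhds x, x' ≠ 0 := isOpen_ne.mem_nhds hx
    filter_upwards [ht.eventually_const_lt hy, h0] with x' h1 h2
    rcases le_total x x' with h3 | h3
    · exact hy.trans_le (hmono h3)
    · refine h1.trans_le ?_
      have h4 : 1 ≤ x / x' := (one_le_div₀ (pos_iff_ne_zero.2 h2)).2 h3
      have h5 := hlip (x / x') x' h4
      rw [div_mul_cancel₀ _ h2] at h5
      calc (x' / x) ^ r * h x ≤ (x' / x) ^ r * ((x / x') ^ r * h x') := by gcongr
        _ = h x' := by
          rw [← mul_assoc, ← NNReal.mul_rpow, div_mul_div_cancel₀ hx, div_self h2,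
            NNReal.one_rpow, one_mul]

/-- Provides compactness in the translation. Otherwise there are counterexamples for every bound
`N`. Replace each translation by a shortest one that is no worse; the lengths tend to infinity and
the directions accumulate at a unit vector `u`. Far out, subtracting `u` worsens no residual, yet it
shortens the vector, a contradiction. -/
theorem exists_bounded_point {ι : Type*} [Finite ι] (a : ι → Point) (M : ℝ) :
    ∃ B : ℝ, ∀ γ : ι → ℝ, (∀ i, |γ i| ≤ M) → ∀ t : Point, ∃ t' : Point, ‖t'‖ ≤ B ∧
      ∀ i, |γ i - inner ℝ (a i) t'| ≤ |γ i - inner ℝ (a i) t| := by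
  by_contra! hcon
  choose γ hγ t ht using fun N : ℕ => hcon N
  have hmin : ∀ N : ℕ, ∃ t' : Point, (∀ i, |γ N i - inner ℝ (a i) t'| ≤
      |γ N i - inner ℝ (a i) (t N)|) ∧ ∀ t'' : Point, (∀ i, |γ N i - inner ℝ (a i) t''| ≤
      |γ N i - inner ℝ (a i) (t N)|) → ‖t'‖ ≤ ‖t''‖ := by
    intro N
    set S : Set Point := {t' | ∀ i, |γ N i - inner ℝ (a i) t'| ≤ |γ N i - inner ℝ (a i) (t N)|}
    have hS : IsClosed S := by
      simp only [S, Set.ofPred_forall]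
      exact isClosed_iInter fun i => isClosed_le (by fun_prop) (by fun_prop)
    obtain ⟨t', ht', hd⟩ := hS.exists_infDist_eq_dist ⟨t N, fun i => le_rfl⟩ 0
    refine ⟨t', ht', fun t'' h'' => ?_⟩
    have := Metric.infDist_le_dist_of_mem (x := (0 : Point)) (show t'' ∈ S from h'')
    rwa [hd, dist_zero_left, dist_zero_left] at this
  choose m hm hm' using hmin
  have hbig : ∀ N : ℕ, (N : ℝ) < ‖m N‖ := by
    intro N
    by_contra! hle
    obtain ⟨i, hi⟩ := ht N (m N) hle
    exact absurd (hm N i) (not_le.2 hi)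
  have hpos : ∀ N, 0 < ‖m N‖ := fun N => (Nat.cast_nonneg N).trans_lt (hbig N)
  obtain ⟨u, hu, φ, hφ, hlim⟩ := (isCompact_sphere (0 : Point) 1).tendsto_subseq
    (x := fun N => ‖m N‖⁻¹ • m N) (fun N => by
      rw [mem_sphere_zero_iff_norm, norm_smul, norm_inv, norm_norm, inv_mul_cancel₀ (hpos N).ne'])
  have hu1 : ‖u‖ = 1 := mem_sphere_zero_iff_norm.1 hu
  have hinf : Filter.Tendsto (fun N => ‖m (φ N)‖) Filter.atTop Filter.atTop :=
    Filter.tendsto_atTop_mono (fun N => (hbig (φ N)).le)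
      (tendsto_natCast_atTop_atTop.comp hφ.tendsto_atTop)
  have hinner : ∀ w : Point, 0 < inner ℝ w u → ∀ C : ℝ,
      ∀ᶠ N in Filter.atTop, C < inner ℝ w (m (φ N)) := by
    intro w hw C
    have h1 : Filter.Tendsto (fun N => inner ℝ w (‖m (φ N)‖⁻¹ • m (φ N))) Filter.atTop
        (nhds (inner ℝ w u)) :=
      ((continuous_const.inner continuous_id).tendsto u).comp hlim
    have h2 := (hinf.atTop_mul_pos hw h1).eventually_gt_atTop C
    filter_upwards [h2] with N hN
    rwa [inner_smul_right, mul_inv_cancel_left₀ (hpos _).ne'] at hN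
  -- If `a i` is orthogonal to `u`, nothing changes. Otherwise the inner product of `a i` with `m (φ
  -- N)` is eventually so large, compared with the bound `M` on `γ`, that a step back by `u` brings
  -- it closer to `γ`.
  have hdec : ∀ᶠ N in Filter.atTop, ∀ i,
      |γ (φ N) i - inner ℝ (a i) (m (φ N) - u)| ≤ |γ (φ N) i - inner ℝ (a i) (m (φ N))| := by
    rw [Filter.eventually_all]
    intro i
    rcases lt_trichotomy (inner ℝ (a i) u) 0 with h | h | h
    · have := hinner (-a i) (by rw [inner_neg_left]; linarith) (M - inner ℝ (a i) u)
      filter_upwards [this] with N hN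
      have h1 := abs_le.1 (hγ (φ N) i)
      rw [inner_neg_left] at hN
      rw [inner_sub_right, abs_of_nonneg (by linarith), abs_of_nonneg (by linarith)]
      linarith
    · filter_upwards with N
      rw [inner_sub_right, h, sub_zero]
    · have := hinner (a i) h (M + inner ℝ (a i) u)
      filter_upwards [this] with N hN
      have h1 := abs_le.1 (hγ (φ N) i)
      rw [inner_sub_right, abs_of_nonpos (by linarith), abs_of_nonpos (by linarith)]
      linarith
  obtain ⟨N, h1, h2⟩ := (hdec.and (hinner u (by
    rw [real_inner_self_eq_norm_sq, hu1]; norm_num) 1)).exists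
  have h3 := hm' (φ N) (m (φ N) - u) fun i => (h1 i).trans (hm (φ N) i)
  -- `‖m - u‖² = ‖m‖² - 2 ⟪m, u⟫ + 1` is smaller than `‖m‖²`, because the inner product exceeds 1.
  have h4 := norm_sub_sq_real (m (φ N)) u
  rw [real_inner_comm, hu1] at h4
  nlinarith [hpos (φ N), norm_nonneg (m (φ N) - u)]

theorem cost_eq_sum {n : ℕ} (z : ℝ) (lip : ℝ≥0 → ℝ≥0) (A : Fin n → Point × Line)
    (g : RigidMotion) : cost z lip A g = ∑ i, lip (Dz z (A i) g) := rfl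

/-- A lower semicontinuous function attains its minimum on the compact product of the unit circle
and a ball of translations. By `exists_bounded_point` an arbitrary alignment costs at least as much
as one in this set with the same rotation. -/
theorem exists_optimal_motion {n : ℕ} {z r : ℝ} {lip : ℝ≥0 → ℝ≥0} (A : Fin n → Point × Line)
    (hz : 1 ≤ z) (hlip : IsLogLipschitz r lip) :
    ∃ g, ∀ g', cost z lip A g ≤ cost z lip A g' := by
  choose κ hκ using fun i => exists_Dz_eq hz (A i).2
  have hD : ∀ i g, Dz z (A i) g = κ i * ‖(A i).2.ev (g.move (A i).1)‖₊ := fun i g =>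
    hκ i (A i).1 g
  -- Bounds, uniformly over all rotations, the values of the equations before the translation is
  -- subtracted.
  set M : ℝ := ∑ i, (‖(A i).2.normal‖ * ‖(A i).1‖ + |(A i).2.offset|) with hM
  obtain ⟨B, hB⟩ := exists_bounded_point (fun i => (A i).2.normal) M
  set f : ℝ × ℝ × Point → ℝ≥0 := fun u => ∑ i, lip (κ i *
    ‖(A i).2.normal 0 * (u.1 * (A i).1 0 - u.2.1 * (A i).1 1 - u.2.2 0) +
      (A i).2.normal 1 * (u.2.1 * (A i).1 0 + u.1 * (A i).1 1 - u.2.2 1) - (A i).2.offset‖₊) with hf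
  have hcost : ∀ g : RigidMotion, cost z lip A g = f (g.cs, g.sn, g.2) := by
    intro g
    rw [cost_eq_sum, hf]
    simp only [hD, Line.ev_move]
  have hlsc : LowerSemicontinuous f := by
    refine lowerSemicontinuous_sum fun i _ => ?_
    exact hlip.lowerSemicontinuous.comp (by fun_prop)
  set S : Set (ℝ × ℝ × Point) := {u | u.1 ^ 2 + u.2.1 ^ 2 = 1 ∧ ‖u.2.2‖ ≤ max B 0} with hS
  have hScomp : IsCompact S := by
    refine IsCompact.of_isClosed_subset
      ((isCompact_Icc (a := (-1 : ℝ)) (b := 1)).prod ((isCompact_Icc (a := (-1 : ℝ)) (b := 1)).prod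
        (isCompact_closedBall (0 : Point) (max B 0)))) ?_ ?_
    · exact (isClosed_eq (f := fun u : ℝ × ℝ × Point => u.1 ^ 2 + u.2.1 ^ 2) (g := fun _ => 1)
        (by fun_prop) (by fun_prop)).inter
        (isClosed_le (f := fun u : ℝ × ℝ × Point => ‖u.2.2‖) (g := fun _ => max B 0)
          (by fun_prop) (by fun_prop))
    · rintro ⟨x, y, t⟩ ⟨h1, h2⟩
      simp only at h1 h2
      refine ⟨abs_le.1 (abs_le_one_iff_mul_self_le_one.2 (by nlinarith [sq_nonneg y])),
        abs_le.1 (abs_le_one_iff_mul_self_le_one.2 (by nlinarith [sq_nonneg x])), ?_⟩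
      simpa using h2
  have hSne : S.Nonempty := ⟨(1, 0, 0), by simp [hS]⟩
  obtain ⟨⟨x, y, t⟩, ⟨hxy, ht⟩, hmin⟩ :=
    LowerSemicontinuousOn.exists_isMinOn hSne hScomp (hlsc.lowerSemicontinuousOn S)
  simp only at hxy
  refine ⟨mkMotion x y hxy t, fun g' => ?_⟩
  rw [hcost (mkMotion x y hxy t), mkMotion_cs, mkMotion_sn, mkMotion_snd]
  have hg' := g'.cs_sq_add_sn_sq
  set γ : Fin n → ℝ := fun i => (A i).2.normal 0 * (g'.cs * (A i).1 0 - g'.sn * (A i).1 1) +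
      (A i).2.normal 1 * (g'.sn * (A i).1 0 + g'.cs * (A i).1 1) - (A i).2.offset with hγ
  obtain ⟨t', ht', h'⟩ := hB γ (fun i => by
    have h1 : |(A i).2.normal 0 * (g'.cs * (A i).1 0 - g'.sn * (A i).1 1) +
      (A i).2.normal 1 * (g'.sn * (A i).1 0 + g'.cs * (A i).1 1)| ≤
        ‖(A i).2.normal‖ * ‖(A i).1‖ := by
      apply abs_le_of_sq_le_sq _ (by positivity)
      rw [mul_pow, norm_sq_eq, norm_sq_eq]
      generalize (A i).2.normal 0 = a
      generalize (A i).2.normal 1 = b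
      generalize (A i).1 0 = c
      generalize (A i).1 1 = d
      have : (a * (g'.cs * c - g'.sn * d) + b * (g'.sn * c + g'.cs * d)) ^ 2 =
          (a ^ 2 + b ^ 2) * (c ^ 2 + d ^ 2) -
          (a * (g'.sn * c + g'.cs * d) - b * (g'.cs * c - g'.sn * d)) ^ 2 := by
        linear_combination (a ^ 2 + b ^ 2) * (c ^ 2 + d ^ 2) * hg'
      rw [this]
      nlinarith [sq_nonneg (a * (g'.sn * c + g'.cs * d) - b * (g'.cs * c - g'.sn * d))]
    refine (abs_sub _ _).trans ?_
    refine (add_le_add_left h1 _).trans ?_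
    exact Finset.single_le_sum (f := fun i => ‖(A i).2.normal‖ * ‖(A i).1‖ + |(A i).2.offset|)
      (fun i _ => by positivity) (Finset.mem_univ i)) g'.2
  refine (hmin (show (g'.cs, g'.sn, t') ∈ S from ⟨hg', ht'.trans (le_max_left _ _)⟩)).trans ?_
  rw [hcost, hf]
  refine Finset.sum_le_sum fun i _ => hlip.2.1 ?_
  gcongr
  rw [← NNReal.coe_le_coe, coe_nnnorm, coe_nnnorm, Real.norm_eq_abs, Real.norm_eq_abs]
  have := h' i
  rw [inner_eq, inner_eq] at this
  convert this using 2 <;> simp only [hγ] <;> ring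

theorem exists_optimal {n : ℕ} {z r : ℝ} {lip : ℝ≥0 → ℝ≥0} (A : Fin n → Point × Line)
    (hz : 1 ≤ z) (hlip : IsLogLipschitz r lip) :
    ∃ (g : RigidMotion) (π : Equiv.Perm (Fin n)), ∀ g' π',
      cost z lip (rematch A π) g ≤ cost z lip (rematch A π') g' := by
  choose g hg using fun π => exists_optimal_motion (rematch A π) hz hlip
  obtain ⟨π, -, hπ⟩ := Finset.exists_min_image Finset.univ
    (fun π => cost z lip (rematch A π) (g π)) Finset.univ_nonempty
  exact ⟨g π, π, fun g' π' => (hπ π' (Finset.mem_univ _)).trans (hg π' g')⟩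

end PointsToLines
end

noncomputable section

namespace PointsToLines

/-! ### The approximation guarantee -/

theorem feasible_eq_of_parallel {L M M' : Line} (h : L.det M = 0) (h' : L.det M' = 0)
    (p q q' : Point) : feasible L M p q = feasible L M' p q' := by
  simp [feasible, h, h']

/-- When the lines are parallel, the second pair imposes no condition, so it may be exchanged for
the pair that Align receives in second position. -/
theorem closest_eq_of_parallel {L M M' : Line} (h : L.det M = 0) (h' : L.det M' = 0)
    (p q q' : Point) (K : Line) (r : Point) :
    closest L M p q K r = closest L M' p q' K r := by
  rw [closest, closest, feasible_eq_of_parallel h h' p q q']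

theorem Line.ev_translate (K : Line) (g : RigidMotion) (w r : Point) :
    K.ev (RigidMotion.move (g.1, g.2 + w) r) =
      K.ev (g.move r) - (K.normal 0 * w 0 + K.normal 1 * w 1) := by
  rw [K.ev_move, K.ev_move]
  simp only [RigidMotion.cs, RigidMotion.sn, PiLp.add_apply]
  ring

theorem IsSelection.nonempty {F C : Set RigidMotion} (h : IsSelection F C) (hF : F.Nonempty) :
    C.Nonempty := by
  obtain ⟨-, ⟨-, h⟩ | ⟨-, g, rfl⟩⟩ := h
  · obtain ⟨g, hg⟩ := hF
    obtain ⟨g', hg', -⟩ := h _ ⟨g, hg, rfl⟩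
    exact ⟨g', hg'.1⟩
  · exact Set.singleton_nonempty g

/-- Among the feasible alignments, some selection of minimizers for one of the pairs is at most
four times worse, in every pair, than a given alignment. -/
theorem exists_closest_le_four {ι : Type*} [Fintype ι] [Nonempty ι] (a : ι → Point × Line)
    {L M : Line} {p q : Point} (hK : ∀ i, L.det M = 0 → L.det (a i).2 = 0) {g₀ : RigidMotion}
    (hg₀ : g₀ ∈ feasible L M p q) :
    ∃ l, ∀ C, IsSelection (closest L M p q (a l).2 (a l).1) C →
      ∃ g ∈ C, ∀ i, |(a i).2.ev (g.move (a i).1)| ≤ 4 * |(a i).2.ev (g₀.move (a i).1)| := by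
  classical
  set α : ι → ℝ := fun i => evCos L M p q (a i).2 (a i).1
  set β : ι → ℝ := fun i => evSin L M p q (a i).2 (a i).1
  set γ : ι → ℝ := fun i => evConst L M (a i).2
  have hev : ∀ g ∈ feasible L M p q, ∀ i,
      (a i).2.ev (g.move (a i).1) = α i * g.cs + β i * g.sn - γ i :=
    fun g hg i => ev_of_mem_feasible hg (hK i) _
  -- A residual that does not depend on the rotation cannot grow; these indices are left out of the
  -- search for the nearest minimizer.
  have hconst : ∀ i, α i ^ 2 + β i ^ 2 = 0 → ∀ g ∈ feasible L M p q,
      |(a i).2.ev (g.move (a i).1)| ≤ 4 * |(a i).2.ev (g₀.move (a i).1)| := by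
    intro i h0 g hg
    have hA : α i = 0 := by nlinarith [sq_nonneg (α i), sq_nonneg (β i)]
    have hB : β i = 0 := by nlinarith [sq_nonneg (α i), sq_nonneg (β i)]
    rw [hev g hg, hev g₀ hg₀, hA, hB]
    simp only [zero_mul, zero_add, zero_sub, abs_neg]
    linarith [abs_nonneg (γ i)]
  by_cases hall : ∀ i, α i ^ 2 + β i ^ 2 = 0
  · obtain ⟨l⟩ := ‹Nonempty ι›
    refine ⟨l, fun C hC => ?_⟩
    obtain ⟨g, hg⟩ := hC.nonempty ⟨_, candidate_mem_closest p q (hK l) (a l).1 (.inl rfl)⟩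
    exact ⟨g, hg, fun i => hconst i (hall i) g (hC.1 hg).1⟩
  · push Not at hall
    obtain ⟨i₀, hi₀⟩ := hall
    have hsgn : ∀ b : Bool, (if b then (1 : ℝ) else -1) = 1 ∨ (if b then (1 : ℝ) else -1) = -1 := by
      intro b; cases b <;> simp
    -- The nearest to `g₀` among the minimizers of all nonconstant residuals; the Boolean tells
    -- which of the two minimizers it is.
    obtain ⟨⟨l, b⟩, hl, hmin⟩ := Finset.exists_min_image
      (Finset.univ.filter fun x : ι × Bool => α x.1 ^ 2 + β x.1 ^ 2 ≠ 0)
      (fun x => sqDist g₀.cs g₀.sn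
        (circlePt (if x.2 then 1 else -1) (α x.1) (β x.1) (γ x.1)).1
        (circlePt (if x.2 then 1 else -1) (α x.1) (β x.1) (γ x.1)).2)
      ⟨(i₀, true), by simpa using hi₀⟩
    simp only [Finset.mem_filter, Finset.mem_univ, true_and] at hl hmin
    refine ⟨l, fun C hC => ?_⟩
    have hcand := candidate_mem_closest p q (hK l) (a l).1 (hsgn b)
    obtain ⟨hCF, ⟨-, hC⟩ | ⟨hinf, -⟩⟩ := hC
    -- The selection contains some alignment with the rotation of the nearest candidate. Its
    -- translation may be another one, but the residuals depend only on the rotation.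
    · obtain ⟨g, ⟨hg, hg1⟩, -⟩ := hC _ ⟨_, hcand, rfl⟩
      refine ⟨g, hg, fun i => ?_⟩
      by_cases hi : α i ^ 2 + β i ^ 2 = 0
      · exact hconst i hi g (hCF hg).1
      obtain ⟨hcs, hsn⟩ := (fst_eq_iff _ _).1 hg1
      simp only [candidate, mkMotion_cs, mkMotion_sn] at hcs hsn
      rw [hev g (hCF hg).1, hev g₀ hg₀]
      refine abs_le_four_mul_abs hi g₀.cs_sq_add_sn_sq g.cs_sq_add_sn_sq fun x y hxy => ?_
      rw [hcs, hsn]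
      rcases (circleMin_iff hi).1 hxy with h | h
      · have := hmin (i, true) hi
        simp only [if_true, ← h] at this
        exact this
      · have := hmin (i, false) hi
        simp only [Bool.false_eq_true, if_false, ← h] at this
        exact this
    · exact absurd (closest_finite (hK l) hl) hinf

/-- Translating so that the closest point is put on its line at most doubles the distances. -/
theorem exists_translate_le_two {ι : Type*} [Fintype ι] [Nonempty ι] (a : ι → Point × Line)
    (g₀ : RigidMotion) : ∃ (j : ι) (g : RigidMotion), (a j).2.ev (g.move (a j).1) = 0 ∧
      ∀ i, |(a i).2.ev (g.move (a i).1)| ≤ 2 * |(a i).2.ev (g₀.move (a i).1)| := by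
  obtain ⟨j, -, hj⟩ := Finset.exists_min_image Finset.univ
    (fun i => |(a i).2.ev (g₀.move (a i).1)| / ‖(a i).2.normal‖) Finset.univ_nonempty
  have hn : ∀ i, 0 < ‖(a i).2.normal‖ := fun i => norm_pos_iff.2 (a i).2.normal_ne
  -- The shift by `c` times the normal carries `p_j` perpendicularly onto its line. Its length is
  -- the least of all the distances, so it changes no distance by more than that distance.
  set c := (a j).2.ev (g₀.move (a j).1) / ‖(a j).2.normal‖ ^ 2 with hc
  refine ⟨j, (g₀.1, g₀.2 + c • (a j).2.normal), ?_, fun i => ?_⟩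
  · rw [Line.ev_translate]
    have := norm_sq_eq (a j).2.normal
    have h0 := hn j
    simp only [PiLp.smul_apply, smul_eq_mul]
    rw [show (a j).2.normal 0 * (c * (a j).2.normal 0) + (a j).2.normal 1 * (c * (a j).2.normal 1) =
      c * ‖(a j).2.normal‖ ^ 2 by rw [this]; ring, hc]
    field_simp
    ring
  · rw [Line.ev_translate]
    have h1 := abs_real_inner_le_norm (a i).2.normal (a j).2.normal
    have h2 := hj i (Finset.mem_univ _)
    have h3 : |(a i).2.normal 0 * (c • (a j).2.normal) 0 + (a i).2.normal 1 *
        (c • (a j).2.normal) 1| ≤ |(a i).2.ev (g₀.move (a i).1)| := by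
      rw [show (a i).2.normal 0 * (c • (a j).2.normal) 0 + (a i).2.normal 1 *
        (c • (a j).2.normal) 1 = c * inner ℝ (a i).2.normal (a j).2.normal by
          rw [inner_eq]; simp only [PiLp.smul_apply, smul_eq_mul]; ring, abs_mul, hc, abs_div,
          abs_of_pos (pow_pos (hn j) 2)]
      refine (mul_le_mul_of_nonneg_left h1 (by positivity)).trans ?_
      rw [div_le_div_iff₀ (hn j) (hn i)] at h2
      have h4 : |(a j).2.ev (g₀.move (a j).1)| / ‖(a j).2.normal‖ ^ 2 *
          (‖(a i).2.normal‖ * ‖(a j).2.normal‖) =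
          |(a j).2.ev (g₀.move (a j).1)| * ‖(a i).2.normal‖ / ‖(a j).2.normal‖ := by
        have := (hn j).ne'
        field_simp
      rw [h4, div_le_iff₀ (hn j)]
      exact h2
    refine (abs_sub _ _).trans ?_
    linarith

/-- Sliding along a line until the first point reaches its line at most doubles the distances. -/
theorem exists_slide_le_two {ι : Type*} [Fintype ι] (a : ι → Point × Line) {L : Line} {p : Point}
    {g₀ : RigidMotion} (hg₀ : L.ev (g₀.move p) = 0) {i₀ : ι} (hi₀ : L.det (a i₀).2 ≠ 0) :
    ∃ (k : ι) (g : RigidMotion), L.det (a k).2 ≠ 0 ∧ L.ev (g.move p) = 0 ∧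
      (a k).2.ev (g.move (a k).1) = 0 ∧
      ∀ i, |(a i).2.ev (g.move (a i).1)| ≤ 2 * |(a i).2.ev (g₀.move (a i).1)| := by
  classical
  obtain ⟨k, hk, hmin⟩ := Finset.exists_min_image
    (Finset.univ.filter fun i => L.det (a i).2 ≠ 0)
    (fun i => |(a i).2.ev (g₀.move (a i).1)| / |L.det (a i).2|) ⟨i₀, by simpa using hi₀⟩
  simp only [Finset.mem_filter, Finset.mem_univ, true_and] at hk hmin
  -- When sliding along `L`, the equation of a line `K` changes at rate `L.det K`. Thus `c` is the
  -- signed parameter at which the first residual vanishes, and up to then no residual has changed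
  -- by more than its initial size.
  set c := (a k).2.ev (g₀.move (a k).1) / L.det (a k).2 with hc
  have key : ∀ K : Line, K.normal 0 * (c • perp L.normal) 0 + K.normal 1 * (c • perp L.normal) 1 =
      c * L.det K := fun K => by
    simp only [PiLp.smul_apply, smul_eq_mul, perp_zero, perp_one, Line.det]; ring
  refine ⟨k, (g₀.1, g₀.2 + c • perp L.normal), hk, ?_, ?_, fun i => ?_⟩
  · rw [Line.ev_translate, key, hg₀, Line.det]; ring
  · rw [Line.ev_translate, key, hc, div_mul_cancel₀ _ hk, sub_self]
  · rw [Line.ev_translate, key]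
    by_cases hi : L.det (a i).2 = 0
    · rw [hi, mul_zero, sub_zero]
      linarith [abs_nonneg ((a i).2.ev (g₀.move (a i).1))]
    · have h1 := hmin i hi
      rw [← abs_div, ← hc, le_div_iff₀ (abs_pos.2 hi), ← abs_mul] at h1
      refine (abs_sub _ _).trans ?_
      linarith

/-- Some call to Align with three pairs returns an alignment that is at most 16 times worse in
every pair than a given alignment. -/
theorem exists_align_le_sixteen {n : ℕ} [NeZero n] (a : Fin n → Point × Line) (g₀ : RigidMotion) :
    ∃ e : Fin 3 → Fin n, ∀ C, IsAlignOutput (fun i => a (e i)) C →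
      ∃ g ∈ C, ∀ i, |(a i).2.ev (g.move (a i).1)| ≤ 16 * |(a i).2.ev (g₀.move (a i).1)| := by
  obtain ⟨j, g₁, hj, h₁⟩ := exists_translate_le_two a g₀
  by_cases hpar : ∀ i, (a j).2.det (a i).2 = 0
  · have hfeas : g₁ ∈ feasible (a j).2 (a j).2 (a j).1 (a j).1 := by
      simp [feasible, hj]
    obtain ⟨l, hl⟩ := exists_closest_le_four a (fun i _ => hpar i) hfeas
    -- The parallel branch uses only the positions 0 and 1, which are distinct even if `j = l`.
    -- Without the slide the factor is 2 · 4 = 8.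
    refine ⟨![j, l, l], fun C hC => ?_⟩
    obtain ⟨v, b, hvb, C', hC', rfl⟩ := hC
    have hsel := (hC' 0 1 2 (by decide)).2 ((abs_inner_eq_one_iff (hvb 0).1 (hvb 1).1
      (hvb 0).2.2 (hvb 1).2.2).2 (hpar l))
    rw [parallelAlignments_eq (fun i => a (![j, l, l] i)) (j := 0) (k := 1) (hpar l)] at hsel
    obtain ⟨g, hg, h⟩ := hl (C' 0 1 2) (by
      rw [closest_eq_of_parallel (hpar j) (hpar l) _ _ (a l).1]; exact hsel)
    refine ⟨g, ⟨0, 1, 2, by decide, hg⟩, fun i => ?_⟩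
    linarith [h i, h₁ i, abs_nonneg ((a i).2.ev (g₀.move (a i).1))]
  · push Not at hpar
    obtain ⟨i₀, hi₀⟩ := hpar
    obtain ⟨k, g₂, hk, hj2, hk2, h₂⟩ := exists_slide_le_two a hj hi₀
    have hfeas : g₂ ∈ feasible (a j).2 (a k).2 (a j).1 (a k).1 := ⟨hj2, fun _ => hk2⟩
    obtain ⟨l, hl⟩ := exists_closest_le_four a (fun i h => absurd h hk) hfeas
    -- The third index may coincide with one of the others; Align does not ask `l` to be distinct.
    -- Here the factor is 2 · 2 · 4.
    refine ⟨![j, k, l], fun C hC => ?_⟩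
    obtain ⟨v, b, hvb, C', hC', rfl⟩ := hC
    have hsel := (hC' 0 1 2 (by decide)).1 (fun h => hk ((abs_inner_eq_one_iff (hvb 0).1 (hvb 1).1
      (hvb 0).2.2 (hvb 1).2.2).1 h))
    rw [crossingAlignments_eq (A := fun i => a (![j, k, l] i)) (j := 0) (k := 1)
      (fun i => ⟨(hvb i).1, (hvb i).2.2⟩) 2 hk] at hsel
    obtain ⟨g, hg, h⟩ := hl (C' 0 1 2) hsel
    refine ⟨g, ⟨0, 1, 2, by decide, hg⟩, fun i => ?_⟩
    linarith [h i, h₁ i, h₂ i, abs_nonneg ((a i).2.ev (g₀.move (a i).1))]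

theorem one_le_wFactor (z : ℝ) : 1 ≤ wFactor z := by
  rw [wFactor]
  split_ifs
  · exact le_rfl
  · rw [NNReal.le_sqrt_iff_sq_le]; norm_num

/-- `D_z` is the residual times a constant of the line, so the factor 16 passes to it unchanged for
every `z`; the factor `wFactor z ≥ 1` only weakens the bound. -/
theorem cost_le_of_ev_le {n : ℕ} {z r : ℝ} {lip : ℝ≥0 → ℝ≥0} {A : Fin n → Point × Line}
    (hz : 1 ≤ z) (hlip : IsLogLipschitz r lip) {g g₀ : RigidMotion}
    (h : ∀ i, |(A i).2.ev (g.move (A i).1)| ≤ 16 * |(A i).2.ev (g₀.move (A i).1)|) :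
    cost z lip A g ≤ (wFactor z * 16) ^ r * cost z lip A g₀ := by
  obtain ⟨hr, hmono, hl⟩ := hlip
  rw [cost_eq_sum, cost_eq_sum, Finset.mul_sum]
  refine Finset.sum_le_sum fun i _ => ?_
  obtain ⟨κ, hκ⟩ := exists_Dz_eq hz (A i).2
  have hD : ∀ g, Dz z (A i) g = κ * ‖(A i).2.ev (g.move (A i).1)‖₊ := fun g => hκ (A i).1 g
  have h16 : (16 : ℝ≥0) ≤ wFactor z * 16 := le_mul_of_one_le_left (by norm_num) (one_le_wFactor z)
  calc lip (Dz z (A i) g) ≤ lip (16 * Dz z (A i) g₀) := by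
        apply hmono
        rw [hD, hD, mul_left_comm]
        gcongr
        rw [← NNReal.coe_le_coe]
        simpa using h i
    _ ≤ 16 ^ r * lip (Dz z (A i) g₀) := hl _ _ (by norm_num)
    _ ≤ _ := by gcongr

/-- The triple that is good for `rematch A π₀` consists of the points `e` and the lines `π₀ ∘ e`. It
is unknown to the algorithm, but all tuples are tried, and the matching chosen afterwards costs no
more than `π₀`. -/
theorem alignMatch_guarantee {n : ℕ} [NeZero n] {A : Fin n → Point × Line} {z r : ℝ}
    {lip : ℝ≥0 → ℝ≥0} (hz : 1 ≤ z) (hlip : IsLogLipschitz r lip)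
    {out : RigidMotion × Equiv.Perm (Fin n)} (hout : IsAlignMatchOutput z lip A out)
    (g₀ : RigidMotion) (π₀ : Equiv.Perm (Fin n)) :
    cost z lip (rematch A out.2) out.1 ≤ (wFactor z * 16) ^ r * cost z lip (rematch A π₀) g₀ := by
  obtain ⟨X', πhat, hX', hπ, S, rfl, -, hbest⟩ := hout
  obtain ⟨e, he⟩ := exists_align_le_sixteen (rematch A π₀) g₀
  obtain ⟨g, hg, h⟩ := he _ (hX' e (fun i => π₀ (e i)))
  calc cost z lip (rematch A out.2) out.1 ≤ cost z lip (rematch A (πhat g)) g :=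
        hbest (g, πhat g) ⟨⟨_, _, hg⟩, rfl⟩
    _ ≤ cost z lip (rematch A π₀) g := hπ g ⟨_, _, hg⟩ π₀
    _ ≤ _ := cost_le_of_ev_le hz hlip h

end PointsToLines
end

noncomputable section

namespace RealRAM

/-! ### Reasoning about programs -/

/-- The names of the arrays of natural numbers that a program writes to. -/
def Prog.natWrites : Prog → List ℕ
  | skip => []
  | setNat a _ _ => [a]
  | setReal _ _ _ _ => []
  | seq P Q => P.natWrites ++ Q.natWrites
  | ite _ P Q => P.natWrites ++ Q.natWrites
  | loop _ P => P.natWrites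

/-- The names of the arrays of real numbers that a program writes to. -/
def Prog.realWrites : Prog → List ℕ
  | skip => []
  | setNat _ _ _ => []
  | setReal a _ _ _ => [a]
  | seq P Q => P.realWrites ++ Q.realWrites
  | ite _ P Q => P.realWrites ++ Q.realWrites
  | loop _ P => P.realWrites

/-- A bound for the running time of a program all of whose loops make at most `B` iterations. -/
def Prog.timeBound (B : ℕ) : Prog → ℕ
  | skip => 1
  | setNat _ i e => i.time + e.time + 1
  | setReal _ i j e => i.time + j.time + e.time + 1
  | seq P Q => P.timeBound B + Q.timeBound B
  | ite t P Q => t.time + (P.timeBound B + Q.timeBound B)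
  | loop t P => t.time + B * (t.time + P.timeBound B)

/-- The program text is fixed, so its loop nesting depth is a constant, and each loop costs at most
one more factor `B`. -/
theorem Prog.exists_timeBound_le (P : Prog) :
    ∃ K d : ℕ, ∀ B, 1 ≤ B → P.timeBound B ≤ K * B ^ d := by
  induction P with
  | skip => exact ⟨1, 0, fun B _ => by simp [timeBound]⟩
  | setNat a i e => exact ⟨i.time + e.time + 1, 0, fun B _ => by simp [timeBound]⟩
  | setReal a i j e => exact ⟨i.time + j.time + e.time + 1, 0, fun B _ => by simp [timeBound]⟩
  | seq P Q hP hQ =>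
    obtain ⟨K₁, d₁, h₁⟩ := hP
    obtain ⟨K₂, d₂, h₂⟩ := hQ
    refine ⟨K₁ + K₂, d₁ + d₂, fun B hB => ?_⟩
    have e₁ : B ^ d₁ ≤ B ^ (d₁ + d₂) := Nat.pow_le_pow_right hB (by lia)
    have e₂ : B ^ d₂ ≤ B ^ (d₁ + d₂) := Nat.pow_le_pow_right hB (by lia)
    rw [timeBound, add_mul]
    exact add_le_add ((h₁ B hB).trans (Nat.mul_le_mul_left _ e₁))
      ((h₂ B hB).trans (Nat.mul_le_mul_left _ e₂))
  | ite t P Q hP hQ =>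
    obtain ⟨K₁, d₁, h₁⟩ := hP
    obtain ⟨K₂, d₂, h₂⟩ := hQ
    refine ⟨t.time + (K₁ + K₂), d₁ + d₂, fun B hB => ?_⟩
    have e₁ : B ^ d₁ ≤ B ^ (d₁ + d₂) := Nat.pow_le_pow_right hB (by lia)
    have e₂ : B ^ d₂ ≤ B ^ (d₁ + d₂) := Nat.pow_le_pow_right hB (by lia)
    have e₀ : t.time ≤ t.time * B ^ (d₁ + d₂) := Nat.le_mul_of_pos_right _ (by positivity)
    rw [timeBound, add_mul, add_mul]
    exact add_le_add e₀ (add_le_add ((h₁ B hB).trans (Nat.mul_le_mul_left _ e₁))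
      ((h₂ B hB).trans (Nat.mul_le_mul_left _ e₂)))
  | loop t P hP =>
    obtain ⟨K, d, h⟩ := hP
    refine ⟨t.time + (t.time + K), d + 1, fun B hB => ?_⟩
    have e₀ : ∀ d, t.time ≤ t.time * B ^ d := fun d => Nat.le_mul_of_pos_right _ (by positivity)
    rw [timeBound, add_mul]
    refine add_le_add (e₀ _) ?_
    calc B * (t.time + P.timeBound B) ≤ B * (t.time * B ^ d + K * B ^ d) :=
          Nat.mul_le_mul_left _ (add_le_add (e₀ _) (h B hB))
      _ = (t.time + K) * B ^ (d + 1) := by ring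

/-- The memories agree on the arrays that the program does not write to. -/
structure Frame (P : Prog) (σ τ : Mem) : Prop where
  nat : ∀ a, a ∉ P.natWrites → τ.nat a = σ.nat a
  real : ∀ a, a ∉ P.realWrites → τ.real a = σ.real a

@[simp] theorem Mem.writeNat_real (σ : Mem) (a i x : ℕ) : (σ.writeNat a i x).real = σ.real := rfl

@[simp] theorem Mem.writeReal_nat (σ : Mem) (a i j : ℕ) (x : ℝ) :
    (σ.writeReal a i j x).nat = σ.nat := rfl

theorem Mem.writeNat_nat (σ : Mem) (a i x b : ℕ) : (σ.writeNat a i x).nat b =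
    if b = a then Function.update (σ.nat a) i x else σ.nat b := by
  simp [writeNat, Function.update_apply]

theorem Mem.writeNat_ne (σ : Mem) {a b : ℕ} (i x : ℕ) (h : b ≠ a) :
    (σ.writeNat a i x).nat b = σ.nat b := by
  simp [writeNat_nat, h]

@[simp] theorem Mem.writeNat_same (σ : Mem) (a i x : ℕ) :
    (σ.writeNat a i x).nat a = Function.update (σ.nat a) i x := by
  simp [writeNat_nat]

theorem Mem.writeReal_ne (σ : Mem) {a b : ℕ} (i j : ℕ) (x : ℝ) (h : b ≠ a) :
    (σ.writeReal a i j x).real b = σ.real b := by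
  simp [writeReal, h]

theorem Mem.writeReal_same (σ : Mem) (a i j : ℕ) (x : ℝ) (i' j' : ℕ) :
    (σ.writeReal a i j x).real a i' j' = if i' = i ∧ j' = j then x else σ.real a i' j' := by
  simp only [writeReal, Function.update_self, Function.update_apply]
  split_ifs <;> simp_all

theorem Run.frame {O : Oracle} {P : Prog} {σ τ : Mem} {T : ℕ} (h : Run O P σ τ T) :
    Frame P σ τ := by
  induction h with
  | skip σ => exact ⟨fun _ _ => rfl, fun _ _ => rfl⟩
  | setNat a i e σ =>
    refine ⟨fun b hb => ?_, fun _ _ => rfl⟩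
    exact Mem.writeNat_ne _ _ _ (by simpa [Prog.natWrites] using hb)
  | setReal a i j e σ =>
    refine ⟨fun _ _ => rfl, fun b hb => ?_⟩
    exact Mem.writeReal_ne _ _ _ _ (by simpa [Prog.realWrites] using hb)
  | seq _ _ h₁ h₂ =>
    refine ⟨fun b hb => ?_, fun b hb => ?_⟩
    · simp only [Prog.natWrites, List.mem_append, not_or] at hb
      exact (h₂.nat b hb.2).trans (h₁.nat b hb.1)
    · simp only [Prog.realWrites, List.mem_append, not_or] at hb
      exact (h₂.real b hb.2).trans (h₁.real b hb.1)
  | iteTrue _ _ h =>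
    refine ⟨fun b hb => ?_, fun b hb => ?_⟩
    · simp only [Prog.natWrites, List.mem_append, not_or] at hb
      exact h.nat b hb.1
    · simp only [Prog.realWrites, List.mem_append, not_or] at hb
      exact h.real b hb.1
  | iteFalse _ _ h =>
    refine ⟨fun b hb => ?_, fun b hb => ?_⟩
    · simp only [Prog.natWrites, List.mem_append, not_or] at hb
      exact h.nat b hb.2
    · simp only [Prog.realWrites, List.mem_append, not_or] at hb
      exact h.real b hb.2
  | loopTrue _ _ _ h₁ h₂ =>
    exact ⟨fun b hb => (h₂.nat b hb).trans (h₁.nat b hb),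
      fun b hb => (h₂.real b hb).trans (h₁.real b hb)⟩
  | loopFalse _ => exact ⟨fun _ _ => rfl, fun _ _ => rfl⟩

/-- Started in `σ`, the program halts in a memory that satisfies `Q`, within the time bound for
loops of at most `B` iterations. -/
def Wp (B : ℕ) (O : Oracle) (P : Prog) (σ : Mem) (Q : Mem → Prop) : Prop :=
  ∃ τ T, Run O P σ τ T ∧ T ≤ P.timeBound B ∧ Q τ

/-! ### Proof rules for terminating runs with a time bound -/

variable {B : ℕ} {O : Oracle}

/-- The frame is handed to the continuation, so postconditions need not mention arrays that the
program leaves alone. -/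
theorem Wp.conseq {P : Prog} {σ : Mem} {Q Q' : Mem → Prop} (h : Wp B O P σ Q)
    (hQ : ∀ τ, Frame P σ τ → Q τ → Q' τ) : Wp B O P σ Q' := by
  obtain ⟨τ, T, hr, ht, hq⟩ := h
  exact ⟨τ, T, hr, ht, hQ τ hr.frame hq⟩

theorem wp_skip {σ : Mem} {Q : Mem → Prop} (h : Q σ) : Wp B O .skip σ Q :=
  ⟨σ, 1, .skip σ, le_rfl, h⟩

theorem wp_setNat {a : ℕ} {i e : NExp} {σ : Mem} {Q : Mem → Prop}
    (h : Q (σ.writeNat a (i.eval σ) (e.eval σ))) : Wp B O (.setNat a i e) σ Q :=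
  ⟨_, _, .setNat a i e σ, le_rfl, h⟩

theorem wp_setReal {a : ℕ} {i j : NExp} {e : RExp} {σ : Mem} {Q : Mem → Prop}
    (h : Q (σ.writeReal a (i.eval σ) (j.eval σ) (e.eval O σ))) :
    Wp B O (.setReal a i j e) σ Q :=
  ⟨_, _, .setReal a i j e σ, le_rfl, h⟩

theorem wp_seq {P₁ P₂ : Prog} {σ : Mem} {Q : Mem → Prop}
    (h : Wp B O P₁ σ fun τ => Wp B O P₂ τ Q) : Wp B O (.seq P₁ P₂) σ Q := by
  obtain ⟨τ, T, hr, ht, τ', T', hr', ht', hq⟩ := h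
  exact ⟨τ', T + T', .seq hr hr', add_le_add ht ht', hq⟩

theorem wp_ite {t : Test} {P₁ P₂ : Prog} {σ : Mem} {Q : Mem → Prop}
    (h₁ : t.holds O σ → Wp B O P₁ σ Q) (h₂ : ¬ t.holds O σ → Wp B O P₂ σ Q) :
    Wp B O (.ite t P₁ P₂) σ Q := by
  by_cases ht : t.holds O σ
  · obtain ⟨τ, T, hr, hT, hq⟩ := h₁ ht
    exact ⟨τ, _, .iteTrue ht hr, by simp only [Prog.timeBound]; lia, hq⟩
  · obtain ⟨τ, T, hr, hT, hq⟩ := h₂ ht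
    exact ⟨τ, _, .iteFalse ht hr, by simp only [Prog.timeBound]; lia, hq⟩

/-- The variable held in the first cell of an array. -/
abbrev nvar (a : ℕ) : NExp := .get a (.const 0)

/-- `for c = 0, …, N - 1 do body`. -/
def forLoop (c : ℕ) (N : NExp) (body : Prog) : Prog :=
  .seq (.setNat c (.const 0) (.const 0))
    (.loop (.natLe (.add (nvar c) (.const 1)) N)
      (.seq body (.setNat c (.const 0) (.add (nvar c) (.const 1)))))

/-- Induction on the number `m` of remaining iterations. The invariant is stated after the increment
of the counter, as the loop test sees it; the body must not touch the counter, and the frame keeps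
the bound `N` constant. -/
theorem wp_loop_aux {c : ℕ} {N : NExp} {body : Prog} {σ : Mem} {Q : Mem → Prop} (n : ℕ)
    (I : ℕ → Mem → Prop) (hc : c ∉ body.natWrites)
    (hN : ∀ τ, Frame (forLoop c N body) σ τ → N.eval τ = n)
    (hstep : ∀ i < n, ∀ τ, Frame (forLoop c N body) σ τ → τ.nat c 0 = i → I i τ →
      Wp B O body τ fun τ' => I (i + 1) (τ'.writeNat c 0 (i + 1)))
    (hend : ∀ τ, Frame (forLoop c N body) σ τ → I n τ → Q τ) :
    ∀ m i τ, i + m = n → Frame (forLoop c N body) σ τ → τ.nat c 0 = i → I i τ →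
      ∃ τ' T, Run O (.loop (.natLe (.add (nvar c) (.const 1)) N)
        (.seq body (.setNat c (.const 0) (.add (nvar c) (.const 1))))) τ τ' T ∧
        T ≤ (Test.natLe (.add (nvar c) (.const 1)) N).time + m *
          ((Test.natLe (.add (nvar c) (.const 1)) N).time +
          (Prog.seq body (.setNat c (.const 0) (.add (nvar c) (.const 1)))).timeBound B) ∧ Q τ' := by
  intro m
  induction m with
  | zero =>
    intro i τ him hF hci hI
    refine ⟨τ, _, .loopFalse ?_, by simp, hend τ hF (by rwa [← him, Nat.add_zero])⟩
    simp only [Test.holds, NExp.eval, hN τ hF]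
    lia
  | succ m ih =>
    intro i τ him hF hci hI
    obtain ⟨τ₁, T₁, hr, hT, hI'⟩ := hstep i (by lia) τ hF hci hI
    have hF₁ := hr.frame
    have hc₁ : τ₁.nat c 0 = i := by rw [hF₁.nat c hc, hci]
    have hF₂ : Frame (forLoop c N body) σ (τ₁.writeNat c 0 (i + 1)) := by
      refine ⟨fun b hb => ?_, fun b hb => ?_⟩
      · have hb' : b ≠ c ∧ b ∉ body.natWrites := by
          simp [forLoop, Prog.natWrites] at hb
          exact ⟨hb.1, hb.2.1⟩
        rw [Mem.writeNat_ne _ _ _ hb'.1, hF₁.nat b hb'.2, hF.nat b hb]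
      · have hb' : b ∉ body.realWrites := by
          simpa [forLoop, Prog.realWrites] using hb
        rw [Mem.writeNat_real, hF₁.real b hb', hF.real b hb]
    obtain ⟨τ', T', hr', hT', hq⟩ := ih (i + 1) _ (by lia) hF₂ (by simp) hI'
    have hset : Run O (.setNat c (.const 0) (.add (nvar c) (.const 1))) τ₁
        (τ₁.writeNat c 0 (i + 1))
        ((NExp.const 0).time + (NExp.add (nvar c) (.const 1)).time + 1) := by
      have := Run.setNat (O := O) c (.const 0) (.add (nvar c) (.const 1)) τ₁
      simp only [NExp.eval, hc₁] at this
      exact this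
    refine ⟨τ', _, .loopTrue ?_ (.seq hr hset) hr', ?_, hq⟩
    · simp only [Test.holds, NExp.eval, hN τ hF, hci]
      lia
    · rw [add_mul, one_mul]
      simp only [Prog.timeBound] at hT' ⊢
      lia

theorem wp_forLoop {c : ℕ} {N : NExp} {body : Prog} {σ : Mem} {Q : Mem → Prop} (n : ℕ)
    (I : ℕ → Mem → Prop) (hn : n ≤ B) (hc : c ∉ body.natWrites)
    (hN : ∀ τ, Frame (forLoop c N body) σ τ → N.eval τ = n)
    (h0 : I 0 (σ.writeNat c 0 0))
    (hstep : ∀ i < n, ∀ τ, Frame (forLoop c N body) σ τ → τ.nat c 0 = i → I i τ →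
      Wp B O body τ fun τ' => I (i + 1) (τ'.writeNat c 0 (i + 1)))
    (hend : ∀ τ, Frame (forLoop c N body) σ τ → I n τ → Q τ) :
    Wp B O (forLoop c N body) σ Q := by
  refine wp_seq (wp_setNat ?_)
  have hF : Frame (forLoop c N body) σ (σ.writeNat c 0 0) := by
    refine ⟨fun b hb => ?_, fun b _ => rfl⟩
    have hb' : b ≠ c ∧ b ∉ body.natWrites := by
      simp [forLoop, Prog.natWrites] at hb
      exact ⟨hb.1, hb.2.1⟩
    rw [Mem.writeNat_ne _ _ _ hb'.1]
  obtain ⟨τ', T, hr, hT, hq⟩ := wp_loop_aux n I hc hN hstep hend n 0 _ (by lia) hF (by simp) h0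
  refine ⟨τ', T, hr, hT.trans ?_, hq⟩
  simp only [Prog.timeBound]
  gcongr

end RealRAM
end

noncomputable section

namespace RealRAM

/-! ### Optimal assignments: the invariants of the Hungarian method -/

/-- The dual variables are feasible for the costs `c`. -/
def DualFeasible (n : ℕ) (c : ℕ → ℕ → ℝ) (u v : ℕ → ℝ) : Prop :=
  ∀ i < n, ∀ j < n, u i + v j ≤ c i j

/-- The first `k` rows are matched injectively along tight edges. -/
structure TightMatching (n k : ℕ) (c : ℕ → ℕ → ℝ) (u v : ℕ → ℝ) (f : ℕ → ℕ) : Prop where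
  lt : ∀ i < k, f i < n
  inj : ∀ i < k, ∀ j < k, f i = f j → i = j
  tight : ∀ i < k, u i + v (f i) = c i (f i)

/-- The rows `s 0 = k, s 1, …, s h` and the columns `t 1, …, t h` form an alternating tree: the
column `t a` is matched to the row `s a` and joined by a tight edge to the row `s (w a)`. -/
structure AltTree (n k h : ℕ) (c : ℕ → ℕ → ℝ) (u v : ℕ → ℝ) (f s t w : ℕ → ℕ) : Prop where
  root : s 0 = k
  row_lt : ∀ a, 1 ≤ a → a ≤ h → s a < k
  matched : ∀ a, 1 ≤ a → a ≤ h → f (s a) = t a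
  parent_lt : ∀ a, 1 ≤ a → a ≤ h → w a < a
  tight : ∀ a, 1 ≤ a → a ≤ h → u (s (w a)) + v (t a) = c (s (w a)) (t a)
  col_inj : ∀ a, 1 ≤ a → a ≤ h → ∀ b, 1 ≤ b → b ≤ h → t a = t b → a = b

/-- The rows and the columns of the tree are marked. -/
structure Marks (n h : ℕ) (s t inS inT : ℕ → ℕ) : Prop where
  rows : ∀ i < n, 1 ≤ inS i ↔ ∃ a ≤ h, s a = i
  cols : ∀ j < n, 1 ≤ inT j ↔ ∃ a, 1 ≤ a ∧ a ≤ h ∧ t a = j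

section

variable {n k h : ℕ} {c : ℕ → ℕ → ℝ} {u v : ℕ → ℝ} {f s t w inS inT : ℕ → ℕ}

theorem AltTree.row_le (ht : AltTree n k h c u v f s t w) {a : ℕ} (ha : a ≤ h) : s a ≤ k := by
  rcases Nat.eq_zero_or_pos a with rfl | h0
  · exact ht.root.le
  · exact (ht.row_lt a h0 ha).le

/-- The rows `s 1, …, s h` lie below `k` and are distinct, because their matched columns `t a` are.
-/
theorem AltTree.card_le (ht : AltTree n k h c u v f s t w) : h ≤ k := by
  have := Finset.card_le_card_of_injOn (s := Finset.Icc 1 h) (t := Finset.range k) s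
    (fun a ha => by
      simp only [Finset.coe_Icc, Set.mem_Icc] at ha
      simpa using ht.row_lt a ha.1 ha.2)
    (fun a ha b hb hab => by
      simp only [Finset.coe_Icc, Set.mem_Icc] at ha hb
      refine ht.col_inj a ha.1 ha.2 b hb.1 hb.2 ?_
      rw [← ht.matched a ha.1 ha.2, ← ht.matched b hb.1 hb.2, hab])
  simpa using this

theorem AltTree.exists_unmarked (ht : AltTree n k h c u v f s t w) (hm : Marks n h s t inS inT)
    (hk : k < n) : ∃ j < n, inT j = 0 := by
  by_contra! hcon
  have hsub : Finset.range n ⊆ (Finset.Icc 1 h).image t := by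
    intro j hj
    rw [Finset.mem_range] at hj
    obtain ⟨a, h1, h2, h3⟩ := (hm.cols j hj).1 (Nat.one_le_iff_ne_zero.2 (hcon j hj))
    exact Finset.mem_image.2 ⟨a, Finset.mem_Icc.2 ⟨h1, h2⟩, h3⟩
  have h1 := Finset.card_le_card hsub
  have h2 : ((Finset.Icc 1 h).image t).card ≤ (Finset.Icc 1 h).card := Finset.card_image_le
  have h3 := ht.card_le
  simp only [Finset.card_range, Nat.card_Icc] at h1 h2
  lia

/-- The dual variables after a change by `δ` at the marked positions below `n`. -/
def raise (n : ℕ) (δ : ℝ) (inS : ℕ → ℕ) (u : ℕ → ℝ) : ℕ → ℝ := fun i =>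
  if i < n ∧ 1 ≤ inS i then u i + δ else u i

/-- Only edges from a marked row to an unmarked column lose slack, and `δ` is at most the least
slack among them. -/
theorem DualFeasible.raise {δ : ℝ} (hd : DualFeasible n c u v) (hm : Marks n h s t inS inT)
    (hδ : ∀ a ≤ h, ∀ j < n, inT j = 0 → δ ≤ c (s a) j - u (s a) - v j) (hδ0 : 0 ≤ δ) :
    DualFeasible n c (raise n δ inS u) (raise n (-δ) inT v) := by
  intro i hi j hj
  have h1 := hd i hi j hj
  simp only [RealRAM.raise, hi, hj, true_and]
  split_ifs with h2 h3 h3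
  · linarith
  · obtain ⟨a, ha, rfl⟩ := (hm.rows i hi).1 h2
    linarith [hδ a ha j hj (by lia)]
  · linarith
  · exact h1

/-- A matched row is marked if and only if its column is, so the two changes cancel along matched
edges. The marked row `k` is still unmatched. -/
theorem TightMatching.raise (δ : ℝ) (hf : TightMatching n k c u v f)
    (ht : AltTree n k h c u v f s t w) (hm : Marks n h s t inS inT) (hk : k < n) :
    TightMatching n k c (raise n δ inS u) (raise n (-δ) inT v) f := by
  refine ⟨hf.lt, hf.inj, fun i hi => ?_⟩
  have h1 := hf.tight i hi
  have h2 : 1 ≤ inS i ↔ 1 ≤ inT (f i) := by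
    rw [hm.rows i (hi.trans hk), hm.cols _ (hf.lt i hi)]
    constructor
    · rintro ⟨a, ha, rfl⟩
      rcases Nat.eq_zero_or_pos a with rfl | h0
      · rw [ht.root] at hi; lia
      · exact ⟨a, h0, ha, (ht.matched a h0 ha).symm⟩
    · rintro ⟨a, h0, ha, h3⟩
      refine ⟨a, ha, hf.inj _ (ht.row_lt a h0 ha) _ hi ?_⟩
      rw [ht.matched a h0 ha, h3]
  simp only [RealRAM.raise, hi.trans hk, hf.lt i hi, true_and, ← h2]
  split_ifs <;> linarith

/-- Extension of the tree by an edge that a change of the dual variables makes tight, up to the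
last matched edge. -/
theorem AltTree.extend (ht : AltTree n k h c u v f s t w) (hm : Marks n h s t inS inT)
    (hf : TightMatching n k c u v f)
    (hk : k < n) {i j : ℕ} (hi : i ≤ h) (hj : j < n) (hjT : inT j = 0) :
    let δ := c (s i) j - u (s i) - v j
    let t' := Function.update t (h + 1) j
    let w' := Function.update w (h + 1) i
    -- Only up to `h`: whether the new column is matched, and to which row, is still open.
    (∀ a, 1 ≤ a → a ≤ h → f (s a) = t' a) ∧
    (∀ a, 1 ≤ a → a ≤ h + 1 → w' a < a) ∧
    (∀ a, 1 ≤ a → a ≤ h + 1 → RealRAM.raise n δ inS u (s (w' a)) +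
      RealRAM.raise n (-δ) inT v (t' a) = c (s (w' a)) (t' a)) ∧
    (∀ a, 1 ≤ a → a ≤ h + 1 → ∀ b, 1 ≤ b → b ≤ h + 1 → t' a = t' b → a = b) := by
  intro δ t' w'
  have hsn : ∀ a ≤ h, s a < n := fun a ha => (ht.row_le ha).trans_lt hk
  have hS : ∀ a ≤ h, 1 ≤ inS (s a) := fun a ha => (hm.rows _ (hsn a ha)).2 ⟨a, ha, rfl⟩
  have ht' : ∀ a ≤ h, t' a = t a := fun a ha => Function.update_of_ne (by lia) _ _
  have hw' : ∀ a ≤ h, w' a = w a := fun a ha => Function.update_of_ne (by lia) _ _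
  have hj' : t' (h + 1) = j := Function.update_self _ _ _
  have hi' : w' (h + 1) = i := Function.update_self _ _ _
  have htn : ∀ a, 1 ≤ a → a ≤ h → t a < n := fun a h1 h2 => by
    rw [← ht.matched a h1 h2]; exact hf.lt _ (ht.row_lt a h1 h2)
  have hne : ∀ a, 1 ≤ a → a ≤ h → t a ≠ j := fun a h1 h2 h3 => by
    have := (hm.cols j hj).2 ⟨a, h1, h2, h3⟩
    lia
  refine ⟨fun a h1 h2 => by rw [ht' a h2, ht.matched a h1 h2], fun a h1 h2 => ?_,
    fun a h1 h2 => ?_, fun a h1 h2 b h3 h4 hab => ?_⟩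
  · rcases Nat.lt_or_ge h a with h3 | h3
    · obtain rfl : a = h + 1 := by lia
      rw [hi']; lia
    · rw [hw' a h3]; exact ht.parent_lt a h1 h3
  · rcases Nat.lt_or_ge h a with h3 | h3
    · obtain rfl : a = h + 1 := by lia
      rw [hi', hj']
      simp only [RealRAM.raise, hsn i hi, hS i hi, and_self, if_true, hjT, δ]
      norm_num
      ring
    · rw [ht' a h3, hw' a h3]
      have hwa := ht.parent_lt a h1 h3
      have h4 : 1 ≤ inT (t a) := (hm.cols _ (htn a h1 h3)).2 ⟨a, h1, h3, rfl⟩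
      simp only [RealRAM.raise, hsn (w a) (by lia), hS (w a) (by lia), htn a h1 h3, and_self, if_true,
        h4]
      linarith [ht.tight a h1 h3]
  · rcases Nat.lt_or_ge h a with h5 | h5 <;> rcases Nat.lt_or_ge h b with h6 | h6
    · lia
    · obtain rfl : a = h + 1 := by lia
      rw [hj', ht' b h6] at hab
      exact absurd hab.symm (hne b h3 h6)
    · obtain rfl : b = h + 1 := by lia
      rw [hj', ht' a h5] at hab
      exact absurd hab (hne a h1 h5)
    · rw [ht' a h5, ht' b h6] at hab
      exact ht.col_inj a h1 h5 b h3 h6 hab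

/-- The state of an augmentation: the rows below `k` are matched, the column `t x` is free, and
the tree is intact below `x`; at the end, row `k` is matched too. -/
structure Augmenting (n k x : ℕ) (c : ℕ → ℕ → ℝ) (u v : ℕ → ℝ) (f s t : ℕ → ℕ) : Prop where
  matching : TightMatching n (if x = 0 then k + 1 else k) c u v f
  matched : ∀ a, 1 ≤ a → a < x → f (s a) = t a
  free : 1 ≤ x → ∀ i < k, f i ≠ t x

/-- The row `s (w x)` gives up its column `t (w x)` for the free column `t x`, so `t (w x)` becomes
the free one. At the root there is no column to give up, and the matching gains the row `k`. -/
theorem Augmenting.step {h x : ℕ} (ha : Augmenting n k x c u v f s t) (hx : 1 ≤ x) (hxh : x ≤ h + 1)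
    (hroot : s 0 = k) (hrow : ∀ a, 1 ≤ a → a ≤ h → s a < k) (htn : t x < n)
    (hw : w x < x) (htight : u (s (w x)) + v (t x) = c (s (w x)) (t x))
    (hinj : ∀ a, 1 ≤ a → a ≤ h + 1 → ∀ b, 1 ≤ b → b ≤ h + 1 → t a = t b → a = b) :
    Augmenting n k (w x) c u v (Function.update f (s (w x)) (t x)) s t := by
  have hf := ha.matching
  rw [if_neg (by lia)] at hf
  have hfree := ha.free hx
  set y := w x with hy
  rcases Nat.eq_zero_or_pos y with h0 | h0
  · rw [h0, hroot] at htight ⊢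
    refine ⟨?_, fun a _ _ => by lia, fun h => by lia⟩
    rw [if_pos rfl]
    have hk : ∀ i < k, Function.update f k (t x) i = f i := fun i hi =>
      Function.update_of_ne (by lia) _ _
    have hkk : Function.update f k (t x) k = t x := Function.update_self _ _ _
    refine ⟨fun i hi => ?_, fun i hi j hj hij => ?_, fun i hi => ?_⟩
    · rcases Nat.lt_or_ge i k with h1 | h1
      · rw [hk i h1]; exact hf.lt i h1
      · obtain rfl : i = k := by lia
        rwa [hkk]
    · rcases Nat.lt_or_ge i k with h1 | h1 <;> rcases Nat.lt_or_ge j k with h2 | h2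
      · rw [hk i h1, hk j h2] at hij; exact hf.inj i h1 j h2 hij
      · obtain rfl : j = k := by lia
        rw [hk i h1, hkk] at hij
        exact absurd hij (hfree i h1)
      · obtain rfl : i = k := by lia
        rw [hk j h2, hkk] at hij
        exact absurd hij.symm (hfree j h2)
      · lia
    · rcases Nat.lt_or_ge i k with h1 | h1
      · rw [hk i h1]; exact hf.tight i h1
      · obtain rfl : i = k := by lia
        rwa [hkk]
  · have hsy : s y < k := hrow y h0 (by lia)
    have hfy : f (s y) = t y := ha.matched y h0 hw
    have hne : ∀ i, i ≠ s y → Function.update f (s y) (t x) i = f i := fun i hi =>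
      Function.update_of_ne hi _ _
    have hself : Function.update f (s y) (t x) (s y) = t x := Function.update_self _ _ _
    refine ⟨?_, fun a h1 h2 => ?_, fun _ i hi => ?_⟩
    · rw [if_neg (by lia)]
      refine ⟨fun i hi => ?_, fun i hi j hj hij => ?_, fun i hi => ?_⟩
      · by_cases h1 : i = s y
        · rw [h1, hself]; exact htn
        · rw [hne i h1]; exact hf.lt i hi
      · by_cases h1 : i = s y <;> by_cases h2 : j = s y
        · rw [h1, h2]
        · rw [h1, hself, hne j h2] at hij
          exact absurd hij.symm (hfree j hj)
        · rw [h2, hself, hne i h1] at hij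
          exact absurd hij (hfree i hi)
        · rw [hne i h1, hne j h2] at hij; exact hf.inj i hi j hj hij
      · by_cases h1 : i = s y
        · rw [h1, hself]; exact htight
        · rw [hne i h1]; exact hf.tight i hi
    · have h3 : s a ≠ s y := by
        intro h3
        have h4 := ha.matched a h1 (by lia)
        rw [h3, hfy] at h4
        have := hinj y h0 (by lia) a h1 (by lia) h4
        lia
      rw [hne _ h3]
      exact ha.matched a h1 (by lia)
    · by_cases h1 : i = s y
      · rw [h1, hself]
        intro h2
        have := hinj x hx hxh y h0 (by lia) h2
        lia
      · rw [hne i h1, ← hfy]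
        exact fun h2 => h1 (hf.inj i hi _ hsy h2)

end

/-- A matching of all rows along tight edges is a permutation of minimal cost. -/
theorem TightMatching.optimal {n : ℕ} {c : ℕ → ℕ → ℝ} {u v : ℕ → ℝ} {f : ℕ → ℕ}
    (hf : TightMatching n n c u v f) (hd : DualFeasible n c u v) :
    ∃ π : Equiv.Perm (Fin n), (∀ i : Fin n, f i = π i) ∧
      ∀ π' : Equiv.Perm (Fin n), ∑ i : Fin n, c i (π i) ≤ ∑ i : Fin n, c i (π' i) := by
  have hinj : Function.Injective fun i : Fin n => (⟨f i, hf.lt i i.2⟩ : Fin n) := fun i j hij =>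
    Fin.ext (hf.inj i i.2 j j.2 (Fin.mk.inj hij))
  refine ⟨Equiv.ofBijective _ (Finite.injective_iff_bijective.1 hinj), fun i => rfl,
    fun π' => ?_⟩
  set π := Equiv.ofBijective _ (Finite.injective_iff_bijective.1 hinj)
  have h1 : ∑ i : Fin n, c i (π i) = ∑ i : Fin n, (u i + v (π i)) :=
    Finset.sum_congr rfl fun i _ => (hf.tight i i.2).symm
  have h2 : ∑ i : Fin n, (u i + v (π' i)) ≤ ∑ i : Fin n, c i (π' i) :=
    Finset.sum_le_sum fun i _ => hd i i.2 _ (π' i).2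
  -- Weak duality: the sum of all dual variables is the same for every permutation, bounds every
  -- cost from below, and is attained along tight edges.
  refine le_trans (le_of_eq ?_) h2
  rw [h1, Finset.sum_add_distrib, Finset.sum_add_distrib,
    Equiv.sum_comp π (fun j : Fin n => v j), Equiv.sum_comp π' (fun j : Fin n => v j)]

end RealRAM
end

noncomputable section

namespace RealRAM

theorem Mem.writeReal_real (σ : Mem) (a i j : ℕ) (x : ℝ) (b : ℕ) :
    (σ.writeReal a i j x).real b =
      if b = a then fun i' j' => if i' = i ∧ j' = j then x else σ.real a i' j' else σ.real b := by
  split_ifs with h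
  · subst h; funext i' j'; exact Mem.writeReal_same σ b i j x i' j'
  · exact Mem.writeReal_ne σ i j x h

attribute [simp] NExp.eval RExp.eval Test.holds Mem.writeNat_nat Mem.writeReal_real

/-! ### The Hungarian method as a program

The arrays of natural numbers: `0` holds `n`; `2` the column matched to each row; `3`, `4`, `5` the
rows, the columns and the parents in the alternating tree; `6`, `7` the marks of its rows and
columns; `8` the row to be matched; `9` the size of the tree; `20`, `21` loop counters; `23` whether
a best edge was found; `24`, `25` the best edge; `26` whether its column is matched; `27` a position
in the tree; `28` whether row `8` has been matched. The arrays of real numbers: `4` holds the costs,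
`5`, `6` the dual variables, `7` the least slack. -/

def initTree : Prog :=
  .seq (forLoop 20 (nvar 0)
    (.seq (.setNat 6 (nvar 20) (.const 0)) (.setNat 7 (nvar 20) (.const 0))))
  (.seq (.setNat 3 (.const 0) (nvar 8))
  (.seq (.setNat 6 (nvar 8) (.const 1)) (.setNat 28 (.const 0) (.const 0))))

/-- The slack of the edge from the row at position `nvar 20` of the tree to the column
`nvar 21`. -/
def slackExp : RExp :=
  .sub (.sub (.get 4 (.get 3 (nvar 20)) (nvar 21)) (.get 5 (.get 3 (nvar 20)) (.const 0)))
    (.get 6 (nvar 21) (.const 0))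

def leastSlackBody : Prog :=
  .ite (.and (.natLe (.get 7 (nvar 21)) (.const 0))
      (.not (.and (.natLe (.const 1) (nvar 23))
        (.realLe (.get 7 (.const 0) (.const 0)) slackExp))))
    (.seq (.setReal 7 (.const 0) (.const 0) slackExp)
    (.seq (.setNat 24 (.const 0) (nvar 20))
    (.seq (.setNat 25 (.const 0) (nvar 21)) (.setNat 23 (.const 0) (.const 1)))))
    .skip

def leastSlack : Prog :=
  .seq (.setNat 23 (.const 0) (.const 0))
    (forLoop 20 (.add (nvar 9) (.const 1)) (forLoop 21 (nvar 0) leastSlackBody))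

def updateDuals : Prog :=
  forLoop 20 (nvar 0)
    (.seq
      (.ite (.natLe (.const 1) (.get 6 (nvar 20)))
        (.setReal 5 (nvar 20) (.const 0)
          (.add (.get 5 (nvar 20) (.const 0)) (.get 7 (.const 0) (.const 0)))) .skip)
      (.ite (.natLe (.const 1) (.get 7 (nvar 20)))
        (.setReal 6 (nvar 20) (.const 0)
          (.sub (.get 6 (nvar 20) (.const 0)) (.get 7 (.const 0) (.const 0)))) .skip))

def searchRow : Prog :=
  .seq (.setNat 26 (.const 0) (.const 0))
    (forLoop 20 (nvar 8)
      (.ite (.and (.natLe (.get 2 (nvar 20)) (nvar 25)) (.natLe (nvar 25) (.get 2 (nvar 20))))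
        (.seq (.setNat 3 (.add (nvar 9) (.const 1)) (nvar 20)) (.setNat 26 (.const 0) (.const 1)))
        .skip))

/-- The number of iterations is fixed in advance; once the position 0, the root, is reached, the
remaining ones are idle. -/
def augment : Prog :=
  .seq (.setNat 27 (.const 0) (.add (nvar 9) (.const 1)))
    (forLoop 20 (.add (nvar 0) (.const 1))
      (.ite (.natLe (.const 1) (nvar 27))
        (.seq (.setNat 2 (.get 3 (.get 5 (nvar 27))) (.get 4 (nvar 27)))
          (.setNat 27 (.const 0) (.get 5 (nvar 27))))
        .skip))

def treeStep : Prog :=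
  .seq leastSlack
  (.seq updateDuals
  (.seq (.setNat 4 (.add (nvar 9) (.const 1)) (nvar 25))
  (.seq (.setNat 5 (.add (nvar 9) (.const 1)) (nvar 24))
  (.seq searchRow
    (.ite (.natLe (.const 1) (nvar 26))
      (.seq (.setNat 7 (nvar 25) (.const 1))
        (.setNat 6 (.get 3 (.add (nvar 9) (.const 1))) (.const 1)))
      (.seq augment (.setNat 28 (.const 0) (.const 1))))))))

/-- The loop counter `9` doubles as the size of the tree. After an augmentation the flag `28` makes
the remaining iterations idle. -/
def matchRow : Prog :=
  .seq initTree (forLoop 9 (nvar 0) (.ite (.natLe (nvar 28) (.const 0)) treeStep .skip))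

def hungarian : Prog :=
  .seq (forLoop 20 (nvar 0)
    (.seq (.setReal 5 (nvar 20) (.const 0) (.const 0)) (.setReal 6 (nvar 20) (.const 0) (.const 0))))
    (forLoop 8 (nvar 0) matchRow)

/-! ### Correctness of the Hungarian method -/

variable {B : ℕ} {O : Oracle} {n : ℕ}

theorem wp_initTree {σ : Mem} (hn : σ.nat 0 0 = n) (hB : n ≤ B) :
    Wp B O initTree σ fun τ =>
      (∀ i < n, τ.nat 6 i = if i = σ.nat 8 0 then 1 else 0) ∧ (∀ j < n, τ.nat 7 j = 0) ∧
      τ.nat 3 0 = σ.nat 8 0 ∧ τ.nat 28 0 = 0 := by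
  refine wp_seq (wp_forLoop n (fun i τ => ∀ j < i, τ.nat 6 j = 0 ∧ τ.nat 7 j = 0) hB (by decide)
    (fun τ hF => ?_) (by simp) (fun i hi τ hF hc hI => ?_) (fun τ hF hI => ?_))
  · simp [hF.nat 0 (by decide), hn]
  · refine wp_seq (wp_setNat (wp_setNat ?_))
    intro j hj
    simp only [NExp.eval, Mem.writeNat_nat]
    rcases Nat.lt_succ_iff_lt_or_eq.1 hj with h | h
    · simp [hc, h.ne, hI j h]
    · simp [hc, h]
  · refine wp_seq (wp_setNat (wp_seq (wp_setNat (wp_setNat ?_))))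
    simp only [NExp.eval, Mem.writeNat_nat]
    have h8 := congrFun (hF.nat 8 (by decide)) 0
    refine ⟨fun i hi => ?_, fun j hj => ?_, ?_, ?_⟩
    · simp [h8, hI i hi, Function.update_apply]
    · simp [hI j hj]
    · simp [h8]
    · simp

/-- The state of the search for the least slack among the pairs in `D` whose column satisfies
`ok`. -/
def SlackInv (slack : ℕ → ℕ → ℝ) (ok : ℕ → Prop) (D : ℕ → ℕ → Prop) (τ : Mem) : Prop :=
  (τ.nat 23 0 = 0 ∧ ∀ a j, D a j → ¬ ok j) ∨
  (τ.nat 23 0 = 1 ∧ D (τ.nat 24 0) (τ.nat 25 0) ∧ ok (τ.nat 25 0) ∧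
    τ.real 7 0 0 = slack (τ.nat 24 0) (τ.nat 25 0) ∧
    ∀ a j, D a j → ok j → τ.real 7 0 0 ≤ slack a j)

theorem wp_leastSlackBody {τ : Mem} {slack : ℕ → ℕ → ℝ} {ok : ℕ → Prop} {D : ℕ → ℕ → Prop}
    {a j : ℕ} (ha : τ.nat 20 0 = a) (hj : τ.nat 21 0 = j)
    (hok : ok j ↔ τ.nat 7 j = 0)
    (hs : slack a j = τ.real 4 (τ.nat 3 a) j - τ.real 5 (τ.nat 3 a) 0 - τ.real 6 j 0)
    (hI : SlackInv slack ok D τ) :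
    Wp B O leastSlackBody τ (SlackInv slack ok fun a' j' => D a' j' ∨ (a' = a ∧ j' = j)) := by
  refine wp_ite (fun ht => ?_) (fun ht => wp_skip ?_)
  · simp only [Test.holds, NExp.eval, RExp.eval, slackExp, ha, hj, nonpos_iff_eq_zero, ← hs] at ht
    rw [← hok] at ht
    refine wp_seq (wp_setReal (wp_seq (wp_setNat (wp_seq (wp_setNat (wp_setNat ?_))))))
    right
    simp only [NExp.eval, RExp.eval, Mem.writeNat_nat, Mem.writeReal_real, Mem.writeNat_real,
      Mem.writeReal_nat, slackExp, ha, hj, ← hs]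
    refine ⟨by simp, by simp [hj], by simpa [hj] using ht.1, by simp [hj], ?_⟩
    rintro a' j' (h | ⟨rfl, rfl⟩) h'
    · rcases hI with ⟨h1, h2⟩ | ⟨h1, h2, h3, h4, h5⟩
      · exact absurd h' (h2 _ _ h)
      · have := ht.2
        rw [h1] at this
        simp only [le_refl, true_and, not_le] at this
        simpa using this.le.trans (h5 _ _ h h')
    · simp
  · simp only [Test.holds, NExp.eval, RExp.eval, slackExp, ha, hj, nonpos_iff_eq_zero, ← hs] at ht
    rw [← hok] at ht
    rcases hI with ⟨h1, h2⟩ | ⟨h1, h2, h3, h4, h5⟩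
    · left
      refine ⟨h1, ?_⟩
      rintro a' j' (h | ⟨rfl, rfl⟩)
      · exact h2 _ _ h
      · intro h'; apply ht; simp [h', h1]
    · right
      refine ⟨h1, Or.inl h2, h3, h4, ?_⟩
      rintro a' j' (h | ⟨rfl, rfl⟩) h'
      · exact h5 _ _ h h'
      · by_contra hlt
        apply ht
        simp only [h', h1, le_refl, true_and]
        exact hlt

theorem SlackInv.mono {slack : ℕ → ℕ → ℝ} {ok : ℕ → Prop} {D D' : ℕ → ℕ → Prop} {τ : Mem}
    (h : SlackInv slack ok D τ) (hD : ∀ a j, D a j ↔ D' a j) : SlackInv slack ok D' τ := by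
  have : D = D' := by funext a j; exact propext (hD a j)
  rwa [← this]

theorem wp_leastSlack {σ : Mem} (hn : σ.nat 0 0 = n) (hB : n ≤ B) (hB' : σ.nat 9 0 + 1 ≤ B)
    (hex : ∃ j < n, σ.nat 7 j = 0) :
    Wp B O leastSlack σ fun τ =>
      τ.nat 24 0 ≤ σ.nat 9 0 ∧ τ.nat 25 0 < n ∧ σ.nat 7 (τ.nat 25 0) = 0 ∧
      τ.real 7 0 0 = σ.real 4 (σ.nat 3 (τ.nat 24 0)) (τ.nat 25 0) -
        σ.real 5 (σ.nat 3 (τ.nat 24 0)) 0 - σ.real 6 (τ.nat 25 0) 0 ∧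
      ∀ a ≤ σ.nat 9 0, ∀ j < n, σ.nat 7 j = 0 →
        τ.real 7 0 0 ≤ σ.real 4 (σ.nat 3 a) j - σ.real 5 (σ.nat 3 a) 0 - σ.real 6 j 0 := by
  set slack : ℕ → ℕ → ℝ := fun a j =>
    σ.real 4 (σ.nat 3 a) j - σ.real 5 (σ.nat 3 a) 0 - σ.real 6 j 0 with hslack
  refine wp_seq (wp_setNat (wp_forLoop (σ.nat 9 0 + 1)
    (fun i => SlackInv slack (fun j => σ.nat 7 j = 0) fun a j => a < i ∧ j < n) hB' (by decide)
    (fun τ hF => ?_) ?_ (fun i hi τ hF hc hI => ?_) (fun τ hF hI => ?_)))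
  · simp [hF.nat 9 (by decide)]
  · left; simp
  · refine wp_forLoop n (fun m => SlackInv slack (fun j => σ.nat 7 j = 0)
      fun a j => (a < i ∧ j < n) ∨ (a = i ∧ j < m)) hB (by decide)
      (fun τ' hF' => ?_) ?_ (fun m hm τ' hF' hc' hI' => ?_) (fun τ' hF' hI' => ?_)
    · simp [hF'.nat 0 (by decide), hF.nat 0 (by decide), hn]
    · refine SlackInv.mono ?_ (D := fun a j => a < i ∧ j < n) (by simp)
      simpa [SlackInv] using hI
    · have h20 : τ'.nat 20 0 = i := by rw [hF'.nat 20 (by decide), hc]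
      have h3 : τ'.nat 3 = σ.nat 3 := by
        rw [hF'.nat 3 (by decide), hF.nat 3 (by decide)]; simp
      have h7 : τ'.nat 7 = σ.nat 7 := by
        rw [hF'.nat 7 (by decide), hF.nat 7 (by decide)]; simp
      have h4 : τ'.real 4 = σ.real 4 := by
        rw [hF'.real 4 (by decide), hF.real 4 (by decide)]; simp
      have h5 : τ'.real 5 = σ.real 5 := by
        rw [hF'.real 5 (by decide), hF.real 5 (by decide)]; simp
      have h6 : τ'.real 6 = σ.real 6 := by
        rw [hF'.real 6 (by decide), hF.real 6 (by decide)]; simp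
      refine (wp_leastSlackBody h20 hc' (by rw [h7]) (by rw [h3, h4, h5, h6]) hI').conseq
        fun τ'' _ hI'' => ?_
      refine SlackInv.mono (D := fun a' j' => ((a' < i ∧ j' < n) ∨ (a' = i ∧ j' < m)) ∨
        (a' = i ∧ j' = m)) ?_ (fun a j => by lia)
      simpa [SlackInv] using hI''
    · refine SlackInv.mono (D := fun a j => (a < i ∧ j < n) ∨ (a = i ∧ j < n)) ?_
        (fun a j => by lia)
      simpa [SlackInv] using hI'
  · rcases hI with ⟨-, h2⟩ | ⟨-, h2, h3, h4, h5⟩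
    · obtain ⟨j, hj, hj'⟩ := hex
      exact absurd hj' (h2 0 j ⟨by lia, hj⟩)
    · exact ⟨by lia, h2.2, h3, h4, fun a ha j hj hj' => h5 a j ⟨by lia, hj⟩ hj'⟩

/-- The loop invariant is `raise m`: the change has been made at the marked positions below `m`. -/
theorem wp_updateDuals {σ : Mem} (hn : σ.nat 0 0 = n) (hB : n ≤ B) :
    Wp B O updateDuals σ fun τ =>
      (fun i => τ.real 5 i 0) = raise n (σ.real 7 0 0) (σ.nat 6) (fun i => σ.real 5 i 0) ∧
      (fun i => τ.real 6 i 0) = raise n (-σ.real 7 0 0) (σ.nat 7) (fun i => σ.real 6 i 0) := by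
  refine wp_forLoop n (fun m τ =>
      (fun i => τ.real 5 i 0) = raise m (σ.real 7 0 0) (σ.nat 6) (fun i => σ.real 5 i 0) ∧
      (fun i => τ.real 6 i 0) = raise m (-σ.real 7 0 0) (σ.nat 7) (fun i => σ.real 6 i 0))
    hB (by decide) (fun τ hF => ?_) ?_ (fun m hm τ hF hc hI => ?_) (fun τ hF hI => hI)
  · simp [hF.nat 0 (by decide), hn]
  · constructor <;> funext i <;> simp [raise]
  · have h6 := hF.nat 6 (by decide)
    have h7 := hF.nat 7 (by decide)
    have h7' := hF.real 7 (by decide)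
    obtain ⟨hI1, hI2⟩ := hI
    have hu : ∀ i, τ.real 5 i 0 = _ := fun i => congrFun hI1 i
    have hv : ∀ i, τ.real 6 i 0 = _ := fun i => congrFun hI2 i
    have step : ∀ (δ : ℝ) (mk : ℕ → ℕ) (x : ℕ → ℝ) (i : ℕ), raise (m + 1) δ mk x i =
        if i = m ∧ 1 ≤ mk m then raise m δ mk x m + δ else raise m δ mk x i := by
      intro δ mk x i
      simp only [raise]
      by_cases him : i = m
      · subst him; simp
      · have : i < m + 1 ↔ i < m := by lia
        simp [him, this]
    refine wp_seq (Wp.conseq (Q := fun τ' => (∀ i, τ'.real 5 i 0 =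
        raise (m + 1) (σ.real 7 0 0) (σ.nat 6) (fun i => σ.real 5 i 0) i)) ?_
      fun τ' hF' h5 => Wp.conseq (Q := fun τ'' => (∀ i, τ''.real 6 i 0 =
        raise (m + 1) (-σ.real 7 0 0) (σ.nat 7) (fun i => σ.real 6 i 0) i)) ?_
      fun τ'' hF'' h6 => ?_)
    · refine wp_ite (fun ht => wp_setReal fun i => ?_) (fun ht => wp_skip fun i => ?_)
      · simp only [Test.holds, NExp.eval, hc, h6] at ht
        rw [step, ← hu, ← hu]
        simp [hc, h7', ht]
      · simp only [Test.holds, NExp.eval, hc, h6] at ht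
        rw [step, ← hu, ← hu]
        simp [ht]
    · have h7n := hF'.nat 7 (by decide)
      have h7r := hF'.real 7 (by decide)
      have h6r := hF'.real 6 (by decide)
      have hc' : τ'.nat 20 0 = m := by rw [hF'.nat 20 (by decide), hc]
      refine wp_ite (fun ht => wp_setReal fun i => ?_) (fun ht => wp_skip fun i => ?_)
      · simp only [Test.holds, NExp.eval, hc', h7n, h7] at ht
        rw [step, ← hv, ← hv]
        simp [hc', h7r, h7', h6r, ht, sub_eq_add_neg]
      · simp only [Test.holds, NExp.eval, hc', h7n, h7] at ht
        rw [step, ← hv, ← hv]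
        simp [ht, h6r]
    · have h5r := hF''.real 5 (by decide)
      refine ⟨funext fun i => ?_, funext fun i => h6 i⟩
      rw [Mem.writeNat_real, h5r, h5 i]

theorem wp_searchRow {σ : Mem} (hB : σ.nat 8 0 ≤ B) :
    Wp B O searchRow σ fun τ =>
      (τ.nat 26 0 = 0 ∧ (∀ r < σ.nat 8 0, σ.nat 2 r ≠ σ.nat 25 0) ∧ τ.nat 3 = σ.nat 3) ∨
      (τ.nat 26 0 = 1 ∧ ∃ r < σ.nat 8 0, σ.nat 2 r = σ.nat 25 0 ∧
        τ.nat 3 = Function.update (σ.nat 3) (σ.nat 9 0 + 1) r) := by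
  refine wp_seq (wp_setNat (wp_forLoop (σ.nat 8 0) (fun m τ =>
      (τ.nat 26 0 = 0 ∧ (∀ r < m, σ.nat 2 r ≠ σ.nat 25 0) ∧ τ.nat 3 = σ.nat 3) ∨
      (τ.nat 26 0 = 1 ∧ ∃ r < m, σ.nat 2 r = σ.nat 25 0 ∧
        τ.nat 3 = Function.update (σ.nat 3) (σ.nat 9 0 + 1) r)) hB (by decide)
    (fun τ hF => ?_) ?_ (fun m hm τ hF hc hI => ?_) (fun τ hF hI => hI)))
  · simp [hF.nat 8 (by decide)]
  · simp
  · have h2 : τ.nat 2 = σ.nat 2 := by rw [hF.nat 2 (by decide)]; simp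
    have h25 : τ.nat 25 = σ.nat 25 := by rw [hF.nat 25 (by decide)]; simp
    have h9 : τ.nat 9 = σ.nat 9 := by rw [hF.nat 9 (by decide)]; simp
    refine wp_ite (fun ht => wp_seq (wp_setNat (wp_setNat ?_))) (fun ht => wp_skip ?_)
    · simp only [Test.holds, NExp.eval, hc, h2, h25] at ht
      right
      refine ⟨by simp, m, by lia, by lia, ?_⟩
      simp only [NExp.eval, Mem.writeNat_nat, hc, h9]
      rcases hI with ⟨-, -, h3⟩ | ⟨-, r, -, -, h3⟩
      · simp [h3]
      · simp [h3]
    · simp only [Test.holds, NExp.eval, hc, h2, h25] at ht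
      rcases hI with ⟨h1, h3, h4⟩ | ⟨h1, r, hr, h3, h4⟩
      · left
        refine ⟨by simpa using h1, fun r hr => ?_, by simpa using h4⟩
        rcases Nat.lt_succ_iff_lt_or_eq.1 hr with h | rfl
        · exact h3 r h
        · lia
      · right
        exact ⟨by simpa using h1, r, by lia, h3, by simpa using h4⟩

theorem wp_augment {σ : Mem} {c : ℕ → ℕ → ℝ} {u v : ℕ → ℝ} {k h : ℕ}
    (hn : σ.nat 0 0 = n) (hB : n + 1 ≤ B) (hh : σ.nat 9 0 = h) (hhn : h + 1 ≤ n)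
    (ha : Augmenting n k (h + 1) c u v (σ.nat 2) (σ.nat 3) (σ.nat 4))
    (hroot : σ.nat 3 0 = k) (hrow : ∀ a, 1 ≤ a → a ≤ h → σ.nat 3 a < k)
    (htn : ∀ a, 1 ≤ a → a ≤ h + 1 → σ.nat 4 a < n)
    (hw : ∀ a, 1 ≤ a → a ≤ h + 1 → σ.nat 5 a < a)
    (htight : ∀ a, 1 ≤ a → a ≤ h + 1 → u (σ.nat 3 (σ.nat 5 a)) + v (σ.nat 4 a) =
      c (σ.nat 3 (σ.nat 5 a)) (σ.nat 4 a))
    (hinj : ∀ a, 1 ≤ a → a ≤ h + 1 → ∀ b, 1 ≤ b → b ≤ h + 1 → σ.nat 4 a = σ.nat 4 b → a = b) :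
    Wp B O augment σ fun τ => TightMatching n (k + 1) c u v (τ.nat 2) := by
  -- Parents have smaller positions, so the position, starting at `h + 1 ≤ n`, drops by at least one
  -- per iteration until it is 0. After `n + 1` iterations it must be 0.
  refine wp_seq (wp_setNat (wp_forLoop (n + 1) (fun m τ =>
      Augmenting n k (τ.nat 27 0) c u v (τ.nat 2) (σ.nat 3) (σ.nat 4) ∧
      (τ.nat 27 0 = 0 ∨ τ.nat 27 0 + m ≤ h + 1)) hB (by decide)
    (fun τ hF => ?_) ?_ (fun m hm τ hF hc hI => ?_) (fun τ hF hI => ?_)))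
  · simp [hF.nat 0 (by decide), hn]
  · simpa [hh] using ha
  · obtain ⟨hI, hle⟩ := hI
    have h3 : τ.nat 3 = σ.nat 3 := by rw [hF.nat 3 (by decide)]; simp
    have h4 : τ.nat 4 = σ.nat 4 := by rw [hF.nat 4 (by decide)]; simp
    have h5 : τ.nat 5 = σ.nat 5 := by rw [hF.nat 5 (by decide)]; simp
    refine wp_ite (fun ht => wp_seq (wp_setNat (wp_setNat ?_))) (fun ht => wp_skip ?_)
    · simp only [Test.holds, NExp.eval] at ht
      have hx : τ.nat 27 0 ≤ h + 1 := by lia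
      have hstep := hI.step (w := σ.nat 5) ht hx hroot hrow (htn _ ht hx) (hw _ ht hx)
        (htight _ ht hx) hinj
      have := hw _ ht hx
      simp only [NExp.eval, Mem.writeNat_nat, h3, h4, h5]
      refine ⟨by simpa using hstep, ?_⟩
      right
      simp
      lia
    · simp only [Test.holds, NExp.eval] at ht
      refine ⟨by simpa using hI, ?_⟩
      left
      simp
      lia
  · obtain ⟨hI, hle⟩ := hI
    have h0 : τ.nat 27 0 = 0 := by lia
    have := hI.matching
    rwa [h0, if_pos rfl] at this

/-- The state of the matching of row `k` after `h` steps. -/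
structure RowState (n k : ℕ) (c : ℕ → ℕ → ℝ) (h : ℕ) (σ : Mem) : Prop where
  feasible : DualFeasible n c (fun i => σ.real 5 i 0) (fun i => σ.real 6 i 0)
  cases : (σ.nat 28 0 = 0 ∧
      TightMatching n k c (fun i => σ.real 5 i 0) (fun i => σ.real 6 i 0) (σ.nat 2) ∧
      AltTree n k h c (fun i => σ.real 5 i 0) (fun i => σ.real 6 i 0) (σ.nat 2) (σ.nat 3)
        (σ.nat 4) (σ.nat 5) ∧
      Marks n h (σ.nat 3) (σ.nat 4) (σ.nat 6) (σ.nat 7)) ∨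
    (σ.nat 28 0 = 1 ∧
      TightMatching n (k + 1) c (fun i => σ.real 5 i 0) (fun i => σ.real 6 i 0) (σ.nat 2))

/-- The change of the dual variables makes an edge of least slack tight. If its column is matched,
the column and its row join the tree; otherwise the tree path to the free column is an augmenting
path. -/
theorem wp_treeStep {σ : Mem} {c : ℕ → ℕ → ℝ} {k h : ℕ} (hn : σ.nat 0 0 = n) (hB : n + 1 ≤ B)
    (hk : σ.nat 8 0 = k) (hkn : k < n) (hh : σ.nat 9 0 = h) (hc : σ.real 4 = c)
    (hd : DualFeasible n c (fun i => σ.real 5 i 0) (fun i => σ.real 6 i 0)) (h28 : σ.nat 28 0 = 0)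
    (hf : TightMatching n k c (fun i => σ.real 5 i 0) (fun i => σ.real 6 i 0) (σ.nat 2))
    (ht : AltTree n k h c (fun i => σ.real 5 i 0) (fun i => σ.real 6 i 0) (σ.nat 2) (σ.nat 3)
      (σ.nat 4) (σ.nat 5))
    (hm : Marks n h (σ.nat 3) (σ.nat 4) (σ.nat 6) (σ.nat 7)) :
    Wp B O treeStep σ (RowState n k c (h + 1)) := by
  have hhk := ht.card_le
  refine wp_seq ((wp_leastSlack hn (by lia) (by lia) (ht.exists_unmarked hm hkn)).conseq
    fun τ₁ hF₁ ⟨hbi, hbj, hbT, hδ, hmin⟩ => ?_)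
  have n1 : ∀ a, a ∉ leastSlack.natWrites → τ₁.nat a = σ.nat a := hF₁.nat
  have r1 : ∀ a, a ∉ leastSlack.realWrites → τ₁.real a = σ.real a := hF₁.real
  refine wp_seq ((wp_updateDuals (n := n) (by rw [n1 0 (by decide), hn]) (by lia)).conseq
    fun τ₂ hF₂ ⟨hu₂, hv₂⟩ => ?_)
  rw [n1 6 (by decide), r1 5 (by decide)] at hu₂
  rw [n1 7 (by decide), r1 6 (by decide)] at hv₂
  have n2 : ∀ a, a ∉ leastSlack.natWrites → a ∉ updateDuals.natWrites → τ₂.nat a = σ.nat a :=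
    fun a h1 h2 => (hF₂.nat a h2).trans (n1 a h1)
  refine wp_seq (wp_setNat (wp_seq (wp_setNat (wp_seq ?_))))
  simp only [NExp.eval]
  have h9 : τ₂.nat 9 0 = h := by rw [n2 9 (by decide) (by decide), hh]
  have h24 : τ₂.nat 24 = τ₁.nat 24 := hF₂.nat 24 (by decide)
  have h25 : τ₂.nat 25 = τ₁.nat 25 := hF₂.nat 25 (by decide)
  have h4 : τ₂.nat 4 = σ.nat 4 := n2 4 (by decide) (by decide)
  have h5 : τ₂.nat 5 = σ.nat 5 := n2 5 (by decide) (by decide)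
  rw [Mem.writeNat_ne _ _ _ (by decide : (9 : ℕ) ≠ 4),
    Mem.writeNat_ne _ _ _ (by decide : (24 : ℕ) ≠ 4), h9, h24, h25]
  rw [hh] at hbi hmin
  rw [hc] at hδ hmin
  set i := τ₁.nat 24 0
  set j := τ₁.nat 25 0
  set δ := τ₁.real 7 0 0
  set τ₃ := (τ₂.writeNat 4 (h + 1) j).writeNat 5 (h + 1) i with hτ₃
  have n3 : ∀ a, a ∉ leastSlack.natWrites → a ∉ updateDuals.natWrites → a ≠ 4 → a ≠ 5 →
      τ₃.nat a = σ.nat a := fun a h1 h2 h3 h4 => by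
    rw [hτ₃, Mem.writeNat_ne _ _ _ h4, Mem.writeNat_ne _ _ _ h3, n2 a h1 h2]
  have t4 : τ₃.nat 4 = Function.update (σ.nat 4) (h + 1) j := by simp [hτ₃, h4]
  have t5 : τ₃.nat 5 = Function.update (σ.nat 5) (h + 1) i := by simp [hτ₃, h5]
  have t8 : τ₃.nat 8 0 = k := by rw [n3 8 (by decide) (by decide) (by decide) (by decide), hk]
  have t2 : τ₃.nat 2 = σ.nat 2 := n3 2 (by decide) (by decide) (by decide) (by decide)
  have t3 : τ₃.nat 3 = σ.nat 3 := n3 3 (by decide) (by decide) (by decide) (by decide)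
  have t6 : τ₃.nat 6 = σ.nat 6 := n3 6 (by decide) (by decide) (by decide) (by decide)
  have t7 : τ₃.nat 7 = σ.nat 7 := n3 7 (by decide) (by decide) (by decide) (by decide)
  have t9 : τ₃.nat 9 0 = h := by rw [n3 9 (by decide) (by decide) (by decide) (by decide), hh]
  have t0 : τ₃.nat 0 0 = n := by rw [n3 0 (by decide) (by decide) (by decide) (by decide), hn]
  have t28 : τ₃.nat 28 0 = 0 := by
    rw [n3 28 (by decide) (by decide) (by decide) (by decide), h28]
  have t25 : τ₃.nat 25 0 = j := by simp [hτ₃, h25, j]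
  -- The least slack is the slack of an actual edge, which is nonnegative by dual feasibility.
  have hδ0 : 0 ≤ δ := by
    have := hd (σ.nat 3 i) ((ht.row_le hbi).trans_lt hkn) j hbj
    linarith
  have hd' := hd.raise hm hmin hδ0
  have hf' := hf.raise δ ht hm hkn
  have hext := ht.extend hm hf hkn hbi hbj hbT
  simp only [← hδ, ← t4, ← t5, ← hu₂, ← hv₂] at hd' hf' hext
  obtain ⟨hmatched, hparent, htight, hinj⟩ := hext
  have tr : τ₃.real = τ₂.real := by simp [hτ₃]
  have hlt : ∀ a, 1 ≤ a → a ≤ h + 1 → τ₃.nat 4 a < n := by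
    intro a h1 h2
    rcases Nat.lt_or_ge h a with h3 | h3
    · obtain rfl : a = h + 1 := by lia
      rw [t4, Function.update_self]; exact hbj
    · rw [← hmatched a h1 h3]
      exact hf.lt _ (ht.row_lt a h1 h3)
  refine (wp_searchRow (by rw [t8]; lia)).conseq fun τ₄ hF₄ hs => ?_
  have n4 : ∀ a, a ∉ searchRow.natWrites → τ₄.nat a = τ₃.nat a := hF₄.nat
  have r4 : τ₄.real = τ₂.real := by
    rw [← tr]; funext a; exact hF₄.real a (by simp [searchRow, forLoop, Prog.realWrites])
  rw [t8, t2, t25, t3, t9] at hs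
  refine wp_ite (fun htst => wp_seq (wp_setNat (wp_setNat ?_))) (fun htst => wp_seq ?_)
  · rcases hs with ⟨h26, -, -⟩ | ⟨-, r, hr, hrj, hs3⟩
    · simp [h26] at htst
    have h94 : τ₄.nat 9 0 = h := by rw [n4 9 (by decide), t9]
    have h254 : τ₄.nat 25 0 = j := by rw [n4 25 (by decide), t25]
    have hs' : ∀ a ≤ h, Function.update (σ.nat 3) (h + 1) r a = σ.nat 3 a := fun a ha =>
      Function.update_of_ne (by lia) _ _
    have hsh : Function.update (σ.nat 3) (h + 1) r (h + 1) = r := Function.update_self _ _ _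
    have ht4 : ∀ a ≤ h, τ₃.nat 4 a = σ.nat 4 a := fun a ha => by
      rw [t4, Function.update_of_ne (by lia)]
    have ht4h : τ₃.nat 4 (h + 1) = j := by rw [t4, Function.update_self]
    refine ⟨by simpa [r4] using hd', Or.inl ⟨?_, ?_, ?_, ?_⟩⟩
    · simp [n4 28 (by decide), t28]
    · simpa [r4, n4 2 (by decide), t2] using hf'
    · simp only [Mem.writeNat_nat, Mem.writeNat_real, NExp.eval, r4, hs3, n4 2 (by decide), t2,
        n4 4 (by decide), n4 5 (by decide)]
      norm_num
      refine ⟨?_, fun a h1 h2 => ?_, fun a h1 h2 => ?_, hparent, fun a h1 h2 => ?_, hinj⟩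
      · rw [hs' 0 (by lia)]; exact ht.root
      · rcases Nat.lt_or_ge h a with h3 | h3
        · obtain rfl : a = h + 1 := by lia
          rw [hsh]; exact hr
        · rw [hs' a h3]; exact ht.row_lt a h1 h3
      · rcases Nat.lt_or_ge h a with h3 | h3
        · obtain rfl : a = h + 1 := by lia
          rw [hsh, ht4h]; exact hrj
        · rw [hs' a h3]; exact hmatched a h1 h3
      · have := hparent a h1 h2
        rw [hs' _ (by lia)]
        exact htight a h1 h2
    · simp only [Mem.writeNat_nat, NExp.eval, hs3, n4 4 (by decide), n4 6 (by decide),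
        n4 7 (by decide), t6, t7, h254]
      norm_num
      rw [h94, hsh]
      refine ⟨fun i' hi' => ?_, fun j' hj' => ?_⟩
      · rw [Function.update_apply]
        split_ifs with h1
        · simp only [le_refl, true_iff]
          exact ⟨h + 1, le_rfl, hsh.trans h1.symm⟩
        · rw [hm.rows i' hi']
          constructor
          · rintro ⟨a, ha, rfl⟩
            exact ⟨a, by lia, hs' a ha⟩
          · rintro ⟨a, ha, h2⟩
            rcases Nat.lt_or_ge h a with h3 | h3
            · obtain rfl : a = h + 1 := by lia
              rw [hsh] at h2
              exact absurd h2.symm h1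
            · exact ⟨a, h3, by rw [← h2, hs' a h3]⟩
      · rw [Function.update_apply]
        split_ifs with h1
        · simp only [le_refl, true_iff]
          exact ⟨h + 1, by lia, le_rfl, ht4h.trans h1.symm⟩
        · rw [hm.cols j' hj']
          constructor
          · rintro ⟨a, ha, ha', rfl⟩
            exact ⟨a, ha, by lia, ht4 a ha'⟩
          · rintro ⟨a, ha, ha', h2⟩
            rcases Nat.lt_or_ge h a with h3 | h3
            · obtain rfl : a = h + 1 := by lia
              rw [ht4h] at h2
              exact absurd h2.symm h1
            · exact ⟨a, ha, h3, by rw [← h2, ht4 a h3]⟩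
  · rcases hs with ⟨-, hfree, hs3⟩ | ⟨h26, -⟩
    swap
    · simp [h26] at htst
    have h24' : τ₄.nat 2 = σ.nat 2 := by rw [n4 2 (by decide), t2]
    have h44' : τ₄.nat 4 = τ₃.nat 4 := n4 4 (by decide)
    have h54' : τ₄.nat 5 = τ₃.nat 5 := n4 5 (by decide)
    have hj4 : τ₃.nat 4 (h + 1) = j := by rw [t4, Function.update_self]
    refine (wp_augment (n := n) (k := k) (h := h) (c := c) (u := fun i => τ₂.real 5 i 0)
      (v := fun i => τ₂.real 6 i 0) (by rw [n4 0 (by decide), t0]) hB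
      (by rw [n4 9 (by decide), t9]) (by lia) ?_ (by rw [hs3]; exact ht.root)
      (by rw [hs3]; exact ht.row_lt) (by rw [h44']; exact hlt) (by rw [h54']; exact hparent)
      (by rw [hs3, h44', h54']; exact htight) (by rw [h44']; exact hinj)).conseq
      fun τ₅ hF₅ hf₅ => wp_setNat ?_
    · rw [h24', hs3, h44']
      refine ⟨by simpa using hf', fun a h1 h2 => hmatched a h1 (by lia), fun _ r hr => ?_⟩
      rw [hj4]
      exact hfree r hr
    · have r5 : τ₅.real = τ₂.real := by
        rw [← r4]; funext a; exact hF₅.real a (by simp [augment, forLoop, Prog.realWrites])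
      exact ⟨by simpa [r5] using hd', Or.inr ⟨by simp, by simpa [r5] using hf₅⟩⟩

theorem wp_matchRow {σ : Mem} {c : ℕ → ℕ → ℝ} {k : ℕ} (hn : σ.nat 0 0 = n) (hB : n + 1 ≤ B)
    (hk : σ.nat 8 0 = k) (hkn : k < n) (hc : σ.real 4 = c)
    (hd : DualFeasible n c (fun i => σ.real 5 i 0) (fun i => σ.real 6 i 0))
    (hf : TightMatching n k c (fun i => σ.real 5 i 0) (fun i => σ.real 6 i 0) (σ.nat 2)) :
    Wp B O matchRow σ fun τ =>
      DualFeasible n c (fun i => τ.real 5 i 0) (fun i => τ.real 6 i 0) ∧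
      TightMatching n (k + 1) c (fun i => τ.real 5 i 0) (fun i => τ.real 6 i 0) (τ.nat 2) := by
  refine wp_seq ((wp_initTree hn (by lia)).conseq fun τ₁ hF₁ ⟨h6, h7, h3, h28⟩ => ?_)
  rw [hk] at h6 h3
  have hr1 : τ₁.real = σ.real := by
    funext a; exact hF₁.real a (by simp [initTree, forLoop, Prog.realWrites])
  refine wp_forLoop n (fun h τ => RowState n k c h τ) (by lia) (by decide)
    (fun τ hF => ?_) ?_ (fun h hh τ hF h9 hI => ?_) (fun τ hF hI => ?_)
  · simp [hF.nat 0 (by decide), hF₁.nat 0 (by decide), hn]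
  · refine ⟨by simpa [hr1] using hd, Or.inl ⟨by simpa using h28, ?_, ?_, ?_⟩⟩
    · simpa [hr1, hF₁.nat 2 (by decide)] using hf
    · exact ⟨by simpa using h3, fun a h1 h2 => by lia, fun a h1 h2 => by lia,
        fun a h1 h2 => by lia, fun a h1 h2 => by lia, fun a h1 h2 => by lia⟩
    · refine ⟨fun i hi => ?_, fun j hj => ?_⟩
      · simp [h6 i hi, h3]
        split_ifs with h
        · simp [h]
        · simp [Ne.symm h]
      · simp [h7 j hj]
  · have e8 : τ.nat 8 0 = k := by rw [hF.nat 8 (by decide), hF₁.nat 8 (by decide), hk]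
    have e0 : τ.nat 0 0 = n := by rw [hF.nat 0 (by decide), hF₁.nat 0 (by decide), hn]
    have e4 : τ.real 4 = c := by rw [hF.real 4 (by decide), hF₁.real 4 (by decide), hc]
    refine wp_ite (fun ht => ?_) (fun ht => wp_skip ?_)
    · simp only [Test.holds, NExp.eval, nonpos_iff_eq_zero] at ht
      rcases hI.cases with ⟨-, h1, h2, h3⟩ | ⟨h1, -⟩
      · refine (wp_treeStep e0 hB e8 hkn h9 e4 hI.feasible ht h1 h2 h3).conseq fun τ' _ h' => ?_
        obtain ⟨g1, g2⟩ := h'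
        exact ⟨by simpa using g1, by simpa using g2⟩
      · lia
    · simp only [Test.holds, NExp.eval, nonpos_iff_eq_zero] at ht
      rcases hI.cases with ⟨h1, -⟩ | ⟨h1, h2⟩
      · exact absurd h1 ht
      · exact ⟨by simpa using hI.feasible, Or.inr ⟨by simpa using h1, by simpa using h2⟩⟩
  · rcases hI.cases with ⟨-, -, h2, -⟩ | ⟨-, h2⟩
    -- An unfinished search would leave a tree of size `n`, but its size is at most `k < n`.
    · have := h2.card_le; lia
    · exact ⟨hI.feasible, h2⟩

/-- Nonnegativity of the costs is needed only at the start, where it makes the zero dual variables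
feasible. -/
theorem wp_hungarian {σ : Mem} (hn : σ.nat 0 0 = n) (hB : n + 1 ≤ B)
    (hpos : ∀ i < n, ∀ j < n, 0 ≤ σ.real 4 i j) :
    Wp B O hungarian σ fun τ => ∃ π : Equiv.Perm (Fin n), (∀ i : Fin n, τ.nat 2 i = π i) ∧
      ∀ π' : Equiv.Perm (Fin n),
        ∑ i : Fin n, σ.real 4 i (π i) ≤ ∑ i : Fin n, σ.real 4 i (π' i) := by
  refine wp_seq (wp_forLoop n (fun m τ => ∀ i < m, τ.real 5 i 0 = 0 ∧ τ.real 6 i 0 = 0)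
    (by lia) (by decide) (fun τ hF => ?_) (by simp) (fun m hm τ hF hc hI => ?_)
    (fun τ hF hI => ?_))
  · simp [hF.nat 0 (by decide), hn]
  · refine wp_seq (wp_setReal (wp_setReal ?_))
    intro i hi
    rcases Nat.lt_succ_iff_lt_or_eq.1 hi with h | h
    · simp [hc, h.ne, hI i h]
    · simp [hc, h]
  · refine wp_forLoop n (fun k τ =>
      DualFeasible n (σ.real 4) (fun i => τ.real 5 i 0) (fun i => τ.real 6 i 0) ∧
      TightMatching n k (σ.real 4) (fun i => τ.real 5 i 0) (fun i => τ.real 6 i 0) (τ.nat 2))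
      (by lia) (by decide) (fun τ' hF' => ?_) ?_ (fun k hk τ' hF' hc' hI' => ?_)
      (fun τ' hF' hI' => hI'.2.optimal hI'.1)
    · simp [hF'.nat 0 (by decide), hF.nat 0 (by decide), hn]
    · refine ⟨fun i hi j hj => ?_, ⟨fun i hi => by lia, fun i hi => by lia, fun i hi => by lia⟩⟩
      simp [(hI i hi).1, (hI j hj).2, hpos i hi j hj]
    · refine (wp_matchRow (by rw [hF'.nat 0 (by decide), hF.nat 0 (by decide), hn]) hB hc' hk
        (by rw [hF'.real 4 (by decide), hF.real 4 (by decide)]) hI'.1 hI'.2).conseq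
        fun τ'' _ h'' => ?_
      exact ⟨by simpa using h''.1, by simpa using h''.2⟩

end RealRAM
end

noncomputable section

namespace RealRAM

open PointsToLines

/-! ### The candidates as a program

The arrays of natural numbers `10`, `11`, `12` hold the indices of three points and `13`, `14`, `15`
those of three lines; `16`, `17` the indices of the point and of the line to be brought together.
The row `0` of the array `2` of real numbers holds the coefficients of the translation, those of the
equation of the line `17` at the point `16`, and the determinant; the rows `1`, `2` hold the cosines
and the sines of the candidates. -/

/-- An entry of the input row with index `nvar c`. -/
abbrev inp (c j : ℕ) : RExp := .get 0 (nvar c) (.const j)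

/-- An entry of the scratch array. -/
abbrev scr (i j : ℕ) : RExp := .get 2 (.const i) (.const j)

/-- Assignment to an entry of the scratch array. -/
abbrev setScr (i j : ℕ) (e : RExp) : Prog := .setReal 2 (.const i) (.const j) e

def solveFst (a b : RExp) : RExp :=
  .div (.sub (.mul a (inp 14 3)) (.mul b (inp 13 3))) (scr 0 10)

def solveSnd (a b : RExp) : RExp :=
  .div (.sub (.mul b (inp 13 2)) (.mul a (inp 14 2))) (scr 0 10)

/-- The inner product of the normal of the line `c` and the point `d`. -/
def cosExp (c d : ℕ) : RExp := .add (.mul (inp c 2) (inp d 0)) (.mul (inp c 3) (inp d 1))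

/-- The inner product of the normal of the line `c` and the point `d` turned by a right angle. -/
def sinExp (c d : ℕ) : RExp := .sub (.mul (inp c 3) (inp d 0)) (.mul (inp c 2) (inp d 1))

def negOffset (c : ℕ) : RExp := .sub (.const 0) (inp c 4)

def footExp (j : ℕ) : RExp :=
  .sub (.const 0) (.div (.mul (inp 13 4) (inp 13 j))
    (.add (.mul (inp 13 2) (inp 13 2)) (.mul (inp 13 3) (inp 13 3))))

def computeDet : Prog :=
  setScr 0 10 (.sub (.mul (inp 13 2) (inp 14 3)) (.mul (inp 13 3) (inp 14 2)))

def shiftParallel : Prog :=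
  .seq (setScr 0 0 (inp 10 0)) (.seq (setScr 0 1 (inp 10 1))
  (.seq (setScr 0 2 (.sub (.const 0) (inp 10 1))) (.seq (setScr 0 3 (inp 10 0))
  (.seq (setScr 0 4 (footExp 2)) (.seq (setScr 0 5 (footExp 3))
  (.seq (.setNat 16 (.const 0) (nvar 11)) (.setNat 17 (.const 0) (nvar 14))))))))

def shiftCrossing : Prog :=
  .seq (setScr 0 0 (solveFst (cosExp 13 10) (cosExp 14 11)))
  (.seq (setScr 0 1 (solveSnd (cosExp 13 10) (cosExp 14 11)))
  (.seq (setScr 0 2 (solveFst (sinExp 13 10) (sinExp 14 11)))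
  (.seq (setScr 0 3 (solveSnd (sinExp 13 10) (sinExp 14 11)))
  (.seq (setScr 0 4 (solveFst (negOffset 13) (negOffset 14)))
  (.seq (setScr 0 5 (solveSnd (negOffset 13) (negOffset 14)))
  (.seq (.setNat 16 (.const 0) (nvar 12)) (.setNat 17 (.const 0) (nvar 15))))))))

def computeShift : Prog :=
  .seq computeDet
    (.ite (.and (.realLe (scr 0 10) (.const 0)) (.realLe (.const 0) (scr 0 10)))
      shiftParallel shiftCrossing)

def computeCoefs : Prog :=
  .seq (setScr 0 6 (.add (.mul (inp 17 2) (.sub (inp 16 0) (scr 0 0)))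
    (.mul (inp 17 3) (.sub (inp 16 1) (scr 0 1)))))
  (.seq (setScr 0 7 (.sub (.mul (inp 17 3) (.sub (inp 16 0) (scr 0 3)))
    (.mul (inp 17 2) (.add (inp 16 1) (scr 0 2)))))
  (setScr 0 8 (.add (.add (inp 17 4) (.mul (inp 17 2) (scr 0 4))) (.mul (inp 17 3) (scr 0 5)))))

def coefNorm : RExp := .add (.mul (scr 0 6) (scr 0 6)) (.mul (scr 0 7) (scr 0 7))

def coefRoot : RExp := .sqrt (.sub coefNorm (.mul (scr 0 8) (scr 0 8)))

def setPoints (x₁ y₁ x₂ y₂ : RExp) : Prog :=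
  .seq (setScr 1 0 x₁) (.seq (setScr 1 1 y₁) (.seq (setScr 2 0 x₂) (setScr 2 1 y₂)))

/-- The branches are those of `circlePt`; a sum of squares is compared with 0 by `≤` alone. -/
def computePoints : Prog :=
  .ite (.realLe coefNorm (.const 0))
    (setPoints (.const 1) (.const 0) (.const 1) (.const 0))
  (.ite (.realLe (.mul (scr 0 8) (scr 0 8)) coefNorm)
    (setPoints
      (.div (.sub (.mul (scr 0 8) (scr 0 6)) (.mul coefRoot (scr 0 7))) coefNorm)
      (.div (.add (.mul (scr 0 8) (scr 0 7)) (.mul coefRoot (scr 0 6))) coefNorm)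
      (.div (.add (.mul (scr 0 8) (scr 0 6)) (.mul coefRoot (scr 0 7))) coefNorm)
      (.div (.sub (.mul (scr 0 8) (scr 0 7)) (.mul coefRoot (scr 0 6))) coefNorm))
  (.ite (.realLe (.const 0) (scr 0 8))
    (setPoints (.div (scr 0 6) (.sqrt coefNorm)) (.div (scr 0 7) (.sqrt coefNorm))
      (.div (scr 0 6) (.sqrt coefNorm)) (.div (scr 0 7) (.sqrt coefNorm)))
    (setPoints
      (.div (.sub (.const 0) (scr 0 6)) (.sqrt coefNorm))
      (.div (.sub (.const 0) (scr 0 7)) (.sqrt coefNorm))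
      (.div (.sub (.const 0) (scr 0 6)) (.sqrt coefNorm))
      (.div (.sub (.const 0) (scr 0 7)) (.sqrt coefNorm)))))

def computeCandidates : Prog := .seq computeShift (.seq computeCoefs computePoints)

/-- The input row with index `nvar c` holds the point `p`. -/
def HoldsPoint (σ : Mem) (c : ℕ) (p : Point) : Prop :=
  σ.real 0 (σ.nat c 0) 0 = p 0 ∧ σ.real 0 (σ.nat c 0) 1 = p 1

/-- The input row with index `nvar c` holds the line `L`. -/
def HoldsLine (σ : Mem) (c : ℕ) (L : Line) : Prop :=
  σ.real 0 (σ.nat c 0) 2 = L.normal 0 ∧ σ.real 0 (σ.nat c 0) 3 = L.normal 1 ∧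
    σ.real 0 (σ.nat c 0) 4 = L.offset

/-- The scratch array holds the coefficients of the translation. -/
def HoldsShift (σ : Mem) (L M : Line) (p q : Point) : Prop :=
  σ.real 2 0 0 = shiftCos L M p q 0 ∧ σ.real 2 0 1 = shiftCos L M p q 1 ∧
  σ.real 2 0 2 = shiftSin L M p q 0 ∧ σ.real 2 0 3 = shiftSin L M p q 1 ∧
  σ.real 2 0 4 = shiftConst L M 0 ∧ σ.real 2 0 5 = shiftConst L M 1

/-! ### Correctness of the computation of the candidates -/

variable {B : ℕ} {O : Oracle} {n : ℕ}

theorem wp_shiftParallel {σ : Mem} {p q : Point} {L M : Line} (hp : HoldsPoint σ 10 p)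
    (hL : HoldsLine σ 13 L) (hd : L.det M = 0) :
    Wp B O shiftParallel σ fun τ => HoldsShift τ L M p q ∧
      τ.nat 16 0 = σ.nat 11 0 ∧ τ.nat 17 0 = σ.nat 14 0 := by
  obtain ⟨hp0, hp1⟩ := hp
  obtain ⟨hL0, hL1, hL2⟩ := hL
  refine wp_seq (wp_setReal (wp_seq (wp_setReal (wp_seq (wp_setReal (wp_seq (wp_setReal (wp_seq
    (wp_setReal (wp_seq (wp_setReal (wp_seq (wp_setNat (wp_setNat ?_))))))))))))))
  simp [HoldsShift, shiftCos, shiftSin, shiftConst, hd, footExp, hp0, hp1, hL0, hL1, hL2, pow_two]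

theorem wp_shiftCrossing {σ : Mem} {p q : Point} {L M : Line} (hp : HoldsPoint σ 10 p)
    (hq : HoldsPoint σ 11 q) (hL : HoldsLine σ 13 L) (hM : HoldsLine σ 14 M)
    (hdet : σ.real 2 0 10 = L.det M) (hd : L.det M ≠ 0) :
    Wp B O shiftCrossing σ fun τ => HoldsShift τ L M p q ∧
      τ.nat 16 0 = σ.nat 12 0 ∧ τ.nat 17 0 = σ.nat 15 0 := by
  obtain ⟨hp0, hp1⟩ := hp
  obtain ⟨hq0, hq1⟩ := hq
  obtain ⟨hL0, hL1, hL2⟩ := hL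
  obtain ⟨hM0, hM1, hM2⟩ := hM
  refine wp_seq (wp_setReal (wp_seq (wp_setReal (wp_seq (wp_setReal (wp_seq (wp_setReal (wp_seq
    (wp_setReal (wp_seq (wp_setReal (wp_seq (wp_setNat (wp_setNat ?_))))))))))))))
  simp [HoldsShift, shiftCos, shiftSin, shiftConst, hd, solveFst, solveSnd, cosExp, sinExp,
    negOffset, Line.solve, hp0, hp1, hq0, hq1, hL0, hL1, hL2, hM0, hM1, hM2, hdet]

theorem wp_computeShift {σ : Mem} {p q : Point} {L M : Line} (hp : HoldsPoint σ 10 p)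
    (hq : HoldsPoint σ 11 q) (hL : HoldsLine σ 13 L) (hM : HoldsLine σ 14 M) :
    Wp B O computeShift σ fun τ => HoldsShift τ L M p q ∧
      τ.nat 16 0 = (if L.det M = 0 then σ.nat 11 0 else σ.nat 12 0) ∧
      τ.nat 17 0 = (if L.det M = 0 then σ.nat 14 0 else σ.nat 15 0) := by
  refine wp_seq (wp_setReal ?_)
  set σ' := σ.writeReal 2 ((NExp.const 0).eval σ) ((NExp.const 10).eval σ)
    ((RExp.sub (.mul (inp 13 2) (inp 14 3)) (.mul (inp 13 3) (inp 14 2))).eval O σ) with hσ'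
  have hdet : σ'.real 2 0 10 = L.det M := by
    simp [hσ', Line.det, hL.1, hL.2.1, hM.1, hM.2.1]
  have h0 : σ'.real 0 = σ.real 0 := by simp [hσ']
  have hn : σ'.nat = σ.nat := by simp [hσ']
  have hp' : HoldsPoint σ' 10 p := by simpa [HoldsPoint, h0, hn] using hp
  have hq' : HoldsPoint σ' 11 q := by simpa [HoldsPoint, h0, hn] using hq
  have hL' : HoldsLine σ' 13 L := by simpa [HoldsLine, h0, hn] using hL
  have hM' : HoldsLine σ' 14 M := by simpa [HoldsLine, h0, hn] using hM
  refine wp_ite (fun ht => ?_) (fun ht => ?_)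
  · simp only [Test.holds, RExp.eval, NExp.eval, hdet, Nat.cast_zero] at ht
    have hd : L.det M = 0 := le_antisymm ht.1 ht.2
    refine (wp_shiftParallel (q := q) hp' hL' hd).conseq fun τ _ h => ?_
    simpa [hd, hn] using h
  · simp only [Test.holds, RExp.eval, NExp.eval, hdet, Nat.cast_zero] at ht
    have hd : L.det M ≠ 0 := fun h => ht ⟨h.le, h.ge⟩
    refine (wp_shiftCrossing hp' hq' hL' hM' hdet hd).conseq fun τ _ h => ?_
    simpa [hd, hn] using h

theorem wp_computeCoefs {σ : Mem} {p q r : Point} {L M K : Line} (hs : HoldsShift σ L M p q)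
    (hr : HoldsPoint σ 16 r) (hK : HoldsLine σ 17 K) :
    Wp B O computeCoefs σ fun τ => HoldsShift τ L M p q ∧
      τ.real 2 0 6 = evCos L M p q K r ∧ τ.real 2 0 7 = evSin L M p q K r ∧
      τ.real 2 0 8 = evConst L M K := by
  obtain ⟨h0, h1, h2, h3, h4, h5⟩ := hs
  obtain ⟨hr0, hr1⟩ := hr
  obtain ⟨hK0, hK1, hK2⟩ := hK
  refine wp_seq (wp_setReal (wp_seq (wp_setReal (wp_setReal ?_))))
  simp [HoldsShift, evCos, evSin, evConst, h0, h1, h2, h3, h4, h5, hr0, hr1, hK0, hK1, hK2]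

theorem wp_computePoints {σ : Mem} {a b c : ℝ} (ha : σ.real 2 0 6 = a) (hb : σ.real 2 0 7 = b)
    (hc : σ.real 2 0 8 = c) :
    Wp B O computePoints σ fun τ => (∀ j, τ.real 2 0 j = σ.real 2 0 j) ∧
      τ.real 2 1 0 = (circlePt 1 a b c).1 ∧ τ.real 2 1 1 = (circlePt 1 a b c).2 ∧
      τ.real 2 2 0 = (circlePt (-1) a b c).1 ∧ τ.real 2 2 1 = (circlePt (-1) a b c).2 := by
  have hN : coefNorm.eval O σ = a ^ 2 + b ^ 2 := by simp [coefNorm, ha, hb, pow_two]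
  refine wp_ite (fun ht => ?_) (fun ht => wp_ite (fun ht' => ?_) (fun ht' =>
    wp_ite (fun ht'' => ?_) (fun ht'' => ?_)))
  · have h0 : a ^ 2 + b ^ 2 = 0 := by
      simp only [Test.holds, hN, RExp.eval, Nat.cast_zero] at ht
      exact le_antisymm ht (by positivity)
    refine wp_seq (wp_setReal (wp_seq (wp_setReal (wp_seq (wp_setReal (wp_setReal ?_))))))
    simp [circlePt, h0]
  all_goals
    have h0 : a ^ 2 + b ^ 2 ≠ 0 := by
      simp only [Test.holds, hN, RExp.eval, Nat.cast_zero] at ht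
      exact fun h => ht h.le
    refine wp_seq (wp_setReal (wp_seq (wp_setReal (wp_seq (wp_setReal (wp_setReal ?_))))))
    simp only [Test.holds, hN, RExp.eval, NExp.eval, hc, ← pow_two] at ht'
  · simp only [pow_two] at h0 ht'
    simp [circlePt, h0, ht', coefNorm, coefRoot, ha, hb, hc, pow_two, sub_eq_add_neg]
  · simp only [Test.holds, RExp.eval, NExp.eval, hc, Nat.cast_zero] at ht''
    simp only [pow_two] at h0 ht'
    simp [circlePt, h0, ht', ht'', coefNorm, ha, hb, pow_two]
  · simp only [Test.holds, RExp.eval, NExp.eval, hc, Nat.cast_zero] at ht''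
    simp only [pow_two] at h0 ht'
    simp [circlePt, h0, ht', ht'', coefNorm, ha, hb, pow_two]

/-- The two candidates for three pairs. -/
def candidates (p q y : Point) (L M N : Line) (s : ℝ) (hs : s = 1 ∨ s = -1) : RigidMotion :=
  candidate L M p q (if L.det M = 0 then M else N) (if L.det M = 0 then q else y) s hs

/-- The row `i` of the scratch array holds the cosine and the sine of `g`, whose translation is
given by the coefficients in the row `0`. -/
def HoldsCandidate (σ : Mem) (i : ℕ) (g : RigidMotion) : Prop :=
  σ.real 2 i 0 = g.cs ∧ σ.real 2 i 1 = g.sn ∧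
  g.cs * σ.real 2 0 0 + g.sn * σ.real 2 0 2 + σ.real 2 0 4 = g.2 0 ∧
  g.cs * σ.real 2 0 1 + g.sn * σ.real 2 0 3 + σ.real 2 0 5 = g.2 1

theorem wp_computeCandidates {σ : Mem} {p q y : Point} {L M N : Line} (hp : HoldsPoint σ 10 p)
    (hq : HoldsPoint σ 11 q) (hy : HoldsPoint σ 12 y) (hL : HoldsLine σ 13 L)
    (hM : HoldsLine σ 14 M) (hN : HoldsLine σ 15 N) :
    Wp B O computeCandidates σ fun τ =>
      HoldsCandidate τ 1 (candidates p q y L M N 1 (.inl rfl)) ∧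
      HoldsCandidate τ 2 (candidates p q y L M N (-1) (.inr rfl)) := by
  refine wp_seq ((wp_computeShift hp hq hL hM).conseq fun τ₁ hF₁ ⟨hs, h16, h17⟩ => ?_)
  have h0 := hF₁.real 0 (by decide)
  set K := if L.det M = 0 then M else N with hKdef
  set r := if L.det M = 0 then q else y with hrdef
  have hr : HoldsPoint τ₁ 16 r := by
    simp only [HoldsPoint, h16, h0, hrdef]
    split_ifs
    · exact hq
    · exact hy
  have hK : HoldsLine τ₁ 17 K := by
    simp only [HoldsLine, h17, h0, hKdef]
    split_ifs
    · exact hM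
    · exact hN
  refine wp_seq ((wp_computeCoefs hs hr hK).conseq fun τ₂ hF₂ ⟨hs₂, ha, hb, hc⟩ => ?_)
  refine (wp_computePoints ha hb hc).conseq fun τ₃ hF₃ ⟨h1, h2, h3, h4, h5⟩ => ?_
  obtain ⟨s0, s1, s2, s3, s4, s5⟩ := hs₂
  simp only [HoldsCandidate, h1, h2, h3, h4, h5, s0, s1, s2, s3, s4, s5, candidates, ← hKdef,
    ← hrdef, candidate, mkMotion_cs, mkMotion_sn, mkMotion_snd]
  simp [shift]

end RealRAM
end

noncomputable section

namespace RealRAM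

open PointsToLines

/-! ### The program Align+Match

The array `3` of real numbers holds the current alignment, `8` the least cost so far and `9` the
current cost; the array `29` of natural numbers tells whether some alignment has been seen. -/

def loadMotion (i : ℕ) : Prog :=
  .seq (.setReal 3 (.const 0) (.const 0) (scr i 0))
  (.seq (.setReal 3 (.const 0) (.const 1) (.sub (.const 0) (scr i 1)))
  (.seq (.setReal 3 (.const 1) (.const 0) (scr i 1))
  (.seq (.setReal 3 (.const 1) (.const 1) (scr i 0))
  (.seq (.setReal 3 (.const 2) (.const 0)
    (.add (.add (.mul (scr i 0) (scr 0 0)) (.mul (scr i 1) (scr 0 2))) (scr 0 4)))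
  (.setReal 3 (.const 2) (.const 1)
    (.add (.add (.mul (scr i 0) (scr 0 1)) (.mul (scr i 1) (scr 0 3))) (scr 0 5)))))))

/-- A coordinate of the point `nvar 20` after the current alignment. -/
def movedExp (i : ℕ) : RExp :=
  .sub (.add (.mul (.get 3 (.const i) (.const 0)) (inp 20 0))
    (.mul (.get 3 (.const i) (.const 1)) (inp 20 1))) (.get 3 (.const 2) (.const i))

def fillCosts : Prog :=
  forLoop 20 (nvar 0) (forLoop 21 (nvar 0)
    (.setReal 4 (nvar 20) (nvar 21)
      (.lip (.lineDist (movedExp 0) (movedExp 1) (inp 21 2) (inp 21 3) (inp 21 4)))))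

def sumCosts : Prog :=
  .seq (.setReal 9 (.const 0) (.const 0) (.const 0))
    (forLoop 20 (nvar 0)
      (.setReal 9 (.const 0) (.const 0)
        (.add (.get 9 (.const 0) (.const 0)) (.get 4 (nvar 20) (.get 2 (nvar 20))))))

def copyEntry (i j : ℕ) : Prog :=
  .setReal 1 (.const i) (.const j) (.get 3 (.const i) (.const j))

def copyOutput : Prog :=
  .seq (copyEntry 0 0) (.seq (copyEntry 0 1) (.seq (copyEntry 1 0) (.seq (copyEntry 1 1)
  (.seq (copyEntry 2 0) (.seq (copyEntry 2 1)
  (.seq (.setReal 8 (.const 0) (.const 0) (.get 9 (.const 0) (.const 0)))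
  (.seq (.setNat 29 (.const 0) (.const 1))
    (forLoop 20 (nvar 0) (.setNat 1 (nvar 20) (.get 2 (nvar 20)))))))))))

def processCandidate (i : ℕ) : Prog :=
  .seq (loadMotion i) (.seq fillCosts (.seq hungarian (.seq sumCosts
    (.ite (.and (.natLe (.const 1) (nvar 29))
        (.realLe (.get 8 (.const 0) (.const 0)) (.get 9 (.const 0) (.const 0))))
      .skip copyOutput))))

def processTuple : Prog :=
  .seq computeCandidates (.seq (processCandidate 1) (processCandidate 2))

def alignMatch : Prog :=
  forLoop 10 (nvar 0) (forLoop 11 (nvar 0) (forLoop 12 (nvar 0)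
    (forLoop 13 (nvar 0) (forLoop 14 (nvar 0) (forLoop 15 (nvar 0) processTuple)))))

/-- The memory holds the input. -/
structure HoldsInput {n : ℕ} (A : Fin n → Point × Line) (σ : Mem) : Prop where
  size : σ.nat 0 0 = n
  data : σ.real 0 = (inputMem A).real 0

/-- The array `a` holds the alignment `g`. -/
def HoldsMotion (σ : Mem) (a : ℕ) (g : RigidMotion) : Prop :=
  (∀ i j : Fin 2, σ.real a i j = (g.1 : Matrix (Fin 2) (Fin 2) ℝ) i j) ∧
  ∀ j : Fin 2, σ.real a 2 j = g.2 j

/-! ### Correctness of the search over all tuples -/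

section

variable {B : ℕ} {O : Oracle} {n : ℕ} {A : Fin n → Point × Line}

theorem HoldsInput.holdsPoint {σ : Mem} (h : HoldsInput A σ) {c : ℕ} {i : Fin n}
    (hc : σ.nat c 0 = i) : HoldsPoint σ c (A i).1 := by
  simp [HoldsPoint, hc, h.data, inputMem]

theorem HoldsInput.holdsLine {σ : Mem} (h : HoldsInput A σ) {c : ℕ} {i : Fin n}
    (hc : σ.nat c 0 = i) : HoldsLine σ c (A i).2 := by
  simp [HoldsLine, hc, h.data, inputMem]

theorem HoldsInput.frame {P : Prog} {σ τ : Mem} (h : HoldsInput A σ) (hF : Frame P σ τ)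
    (h1 : 0 ∉ P.natWrites) (h2 : 0 ∉ P.realWrites) : HoldsInput A τ :=
  ⟨by rw [hF.nat 0 h1, h.size], by rw [hF.real 0 h2, h.data]⟩

theorem wp_loadMotion {σ : Mem} {i : ℕ} {g : RigidMotion} (h : HoldsCandidate σ i g) :
    Wp B O (loadMotion i) σ fun τ => HoldsMotion τ 3 g := by
  obtain ⟨h0, h1, h2, h3⟩ := h
  have hR := rotation_entries g.1
  refine wp_seq (wp_setReal (wp_seq (wp_setReal (wp_seq (wp_setReal (wp_seq (wp_setReal (wp_seq
    (wp_setReal (wp_setReal ?_))))))))))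
  refine ⟨fun i j => ?_, fun j => ?_⟩
  · fin_cases i <;> fin_cases j <;> simp [h0, h1, hR, RigidMotion.cs, RigidMotion.sn]
  · fin_cases j
    · simpa [h0, h1] using h2
    · simpa [h0, h1] using h3

/-- The cost of a pair. -/
def pairCost (O : Oracle) (A : Fin n → Point × Line) (g : RigidMotion) (i j : Fin n) : ℝ :=
  O.lip (Dz O.z ((A i).1, (A j).2) g)

/-- For a fixed alignment the cost splits into entries of a matrix, so the choice of the matching is
an assignment problem. -/
theorem cost_rematch (O : Oracle) (A : Fin n → Point × Line) (g : RigidMotion)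
    (π : Equiv.Perm (Fin n)) :
    (cost O.z O.lip (rematch A π) g : ℝ) = ∑ i, pairCost O A g i (π i) := by
  rw [cost_eq_sum, NNReal.coe_sum]; rfl

theorem eval_pairCost {σ : Mem} {g : RigidMotion} (hA : HoldsInput A σ) (hg : HoldsMotion σ 3 g)
    {i j : Fin n} (hi : σ.nat 20 0 = i) (hj : σ.nat 21 0 = j) :
    (RExp.lip (.lineDist (movedExp 0) (movedExp 1) (inp 21 2) (inp 21 3) (inp 21 4))).eval O σ =
      pairCost O A g i j := by
  obtain ⟨p0, p1⟩ := hA.holdsPoint hi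
  obtain ⟨l0, l1, l2⟩ := hA.holdsLine hj
  have hR := rotation_entries g.1
  have e00 := hg.1 0 0
  have e01 := hg.1 0 1
  have e10 := hg.1 1 0
  have e11 := hg.1 1 1
  have e20 := hg.2 0
  have e21 := hg.2 1
  simp only [Fin.val_zero, Fin.val_one] at e00 e01 e10 e11 e20 e21
  have m0 : (movedExp 0).eval O σ = g.move (A i).1 0 := by
    simp only [movedExp, RExp.eval, NExp.eval, e00, e01, e20, p0, p1, g.move_zero, hR.1,
      RigidMotion.cs, RigidMotion.sn]
    ring
  have m1 : (movedExp 1).eval O σ = g.move (A i).1 1 := by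
    simp only [movedExp, RExp.eval, NExp.eval, e10, e11, e21, p0, p1, g.move_one, hR.2.1,
      RigidMotion.cs, RigidMotion.sn]
  have hm : (!₂[g.move (A i).1 0, g.move (A i).1 1] : Point) = g.move (A i).1 :=
    Point.ext (by simp) (by simp)
  have hl : (!₂[(A j).2.normal 0, (A j).2.normal 1] : Point) = (A j).2.normal :=
    Point.ext (by simp) (by simp)
  rw [RExp.eval, RExp.eval, m0, m1, hm]
  simp only [RExp.eval, NExp.eval, l0, l1, l2, hl]
  rw [Real.toNNReal_coe]
  rfl

theorem HoldsMotion.congr {σ τ : Mem} {a : ℕ} {g : RigidMotion} (h : HoldsMotion σ a g)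
    (hr : τ.real a = σ.real a) : HoldsMotion τ a g := by
  simpa only [HoldsMotion, hr] using h

theorem wp_fillCosts {σ : Mem} {g : RigidMotion} (hA : HoldsInput A σ) (hg : HoldsMotion σ 3 g)
    (hB : n ≤ B) :
    Wp B O fillCosts σ fun τ => ∀ i j : Fin n, τ.real 4 i j = pairCost O A g i j := by
  refine wp_forLoop n (fun m τ => ∀ i j : Fin n, (i : ℕ) < m → τ.real 4 i j = pairCost O A g i j)
    hB (by decide) (fun τ hF => ?_) (by simp) (fun m hm τ hF hc hI => ?_)
    (fun τ hF hI i j => hI i j i.2)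
  · simp [hF.nat 0 (by decide), hA.size]
  · refine wp_forLoop n (fun l τ => ∀ i j : Fin n, (i : ℕ) < m ∨ ((i : ℕ) = m ∧ (j : ℕ) < l) →
      τ.real 4 i j = pairCost O A g i j) hB (by decide) (fun τ' hF' => ?_) ?_
      (fun l hl τ' hF' hc' hI' => ?_) (fun τ' hF' hI' i j hi => ?_)
    · simp [hF'.nat 0 (by decide), hF.nat 0 (by decide), hA.size]
    · intro i j h
      exact hI i j (by lia)
    · have hA' := (hA.frame hF (by decide) (by decide)).frame hF' (by decide) (by decide)
      have hg' := (hg.congr (hF.real 3 (by decide))).congr (hF'.real 3 (by decide))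
      have h20 : τ'.nat 20 0 = m := by rw [hF'.nat 20 (by decide), hc]
      refine wp_setReal fun i j h => ?_
      rw [eval_pairCost (i := ⟨m, hm⟩) (j := ⟨l, hl⟩) hA' hg' h20 hc']
      simp only [Mem.writeNat_real, NExp.eval, h20, hc', Mem.writeReal_same]
      split_ifs with h'
      · rw [show (⟨m, hm⟩ : Fin n) = i from Fin.ext h'.1.symm,
          show (⟨l, hl⟩ : Fin n) = j from Fin.ext h'.2.symm]
      · exact hI' i j (by lia)
    · exact hI' i j (by lia)

theorem wp_sumCosts {σ : Mem} {π : Equiv.Perm (Fin n)} (hn : σ.nat 0 0 = n) (hB : n ≤ B)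
    (hπ : ∀ i : Fin n, σ.nat 2 i = π i) :
    Wp B O sumCosts σ fun τ => τ.real 9 0 0 = ∑ i : Fin n, σ.real 4 i (π i) := by
  refine wp_seq (wp_setReal (wp_forLoop n (fun m τ => τ.real 9 0 0 =
    ∑ i ∈ Finset.range m, σ.real 4 i (σ.nat 2 i)) hB (by decide) (fun τ hF => ?_) (by simp)
    (fun m hm τ hF hc hI => wp_setReal ?_) (fun τ hF hI => ?_)))
  · simp [hF.nat 0 (by decide), hn]
  · have h4 : τ.real 4 = σ.real 4 := by rw [hF.real 4 (by decide)]; simp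
    have h2 : τ.nat 2 = σ.nat 2 := by rw [hF.nat 2 (by decide)]; simp
    rw [Finset.sum_range_succ, ← hI]
    simp [hc, h4, h2]
  · rw [hI, Finset.sum_range]
    exact Finset.sum_congr rfl fun i _ => by rw [hπ]

theorem wp_copyOutput {σ : Mem} {g : RigidMotion} {π : Equiv.Perm (Fin n)} (hn : σ.nat 0 0 = n)
    (hB : n ≤ B) (hg : HoldsMotion σ 3 g) (hπ : ∀ i : Fin n, σ.nat 2 i = π i) :
    Wp B O copyOutput σ fun τ => HoldsOutput τ (g, π) ∧ τ.nat 29 0 = 1 ∧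
      τ.real 8 0 0 = σ.real 9 0 0 := by
  refine wp_seq (wp_setReal (wp_seq (wp_setReal (wp_seq (wp_setReal (wp_seq (wp_setReal (wp_seq
    (wp_setReal (wp_seq (wp_setReal (wp_seq (wp_setReal (wp_seq (wp_setNat ?_)))))))))))))))
  simp only [NExp.eval, RExp.eval]
  refine wp_forLoop n (fun m τ => ∀ i : Fin n, (i : ℕ) < m → τ.nat 1 i = π i) hB (by decide)
    (fun τ hF => ?_) (by simp) (fun m hm τ hF hc hI => wp_setNat fun i hi => ?_)
    (fun τ hF hI => ?_)
  · simp [hF.nat 0 (by decide), hn]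
  · have h2 : τ.nat 2 = σ.nat 2 := by rw [hF.nat 2 (by decide)]; simp
    simp only [NExp.eval, Mem.writeNat_nat, hc, h2]
    rcases Nat.lt_succ_iff_lt_or_eq.1 hi with h | h
    · simp [h.ne, hI i h]
    · simp [← h, hπ]
  · refine ⟨⟨fun i j => ?_, fun j => ?_, fun i => hI i i.2⟩, ?_, ?_⟩
    · rw [hF.real 1 (by decide)]
      have := hg.1 i j
      fin_cases i <;> fin_cases j <;> simpa using this
    · rw [hF.real 1 (by decide)]
      have := hg.2 j
      fin_cases j <;> simpa using this
    · rw [hF.nat 29 (by decide)]; simp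
    · rw [hF.real 8 (by decide)]; simp

/-- The memory holds a best alignment of `D` with a matching. -/
structure BestOf (O : Oracle) (A : Fin n → Point × Line) (D : Set RigidMotion) (σ : Mem) :
    Prop where
  input : HoldsInput A σ
  best : (σ.nat 29 0 = 0 ∧ D = ∅) ∨ (σ.nat 29 0 = 1 ∧ ∃ out : RigidMotion × Equiv.Perm (Fin n),
    HoldsOutput σ out ∧ out.1 ∈ D ∧
    σ.real 8 0 0 = cost O.z O.lip (rematch A out.2) out.1 ∧
    ∀ g ∈ D, ∀ π, cost O.z O.lip (rematch A out.2) out.1 ≤ cost O.z O.lip (rematch A π) g)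

theorem BestOf.writeNat {D : Set RigidMotion} {σ : Mem} (h : BestOf O A D σ) {a : ℕ} (x : ℕ)
    (ha : a ≠ 0 ∧ a ≠ 1 ∧ a ≠ 29) : BestOf O A D (σ.writeNat a 0 x) := by
  obtain ⟨⟨h1, h2⟩, h3⟩ := h
  refine ⟨⟨?_, h2⟩, ?_⟩
  · rwa [Mem.writeNat_ne _ _ _ ha.1.symm]
  · simp only [Mem.writeNat_real, HoldsOutput, Mem.writeNat_ne _ _ _ ha.2.1.symm,
      Mem.writeNat_ne _ _ _ ha.2.2.symm]
    exact h3

/-- The matching found for `g` is optimal for `g`, so comparing a single number with the record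
covers all matchings. The flag `29` stands in for an infinite initial record. -/
theorem wp_processCandidate {σ : Mem} {D : Set RigidMotion} {i : ℕ} {g : RigidMotion}
    (hB : n + 1 ≤ B) (h : BestOf O A D σ) (hg : HoldsCandidate σ i g) :
    Wp B O (processCandidate i) σ (BestOf O A (D ∪ {g})) := by
  have hA := h.input
  refine wp_seq ((wp_loadMotion hg).conseq fun τ₁ hF₁ hg₁ => ?_)
  have hA₁ := hA.frame hF₁ (by simp [loadMotion, Prog.natWrites])
    (by simp [loadMotion, Prog.realWrites])
  refine wp_seq ((wp_fillCosts hA₁ hg₁ (by lia)).conseq fun τ₂ hF₂ hc₂ => ?_)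
  have hA₂ := hA₁.frame hF₂ (by decide) (by decide)
  have hg₂ := hg₁.congr (hF₂.real 3 (by decide))
  refine wp_seq ((wp_hungarian hA₂.size hB (fun a ha b hb => ?_)).conseq
    fun τ₃ hF₃ ⟨π, hπ, hopt⟩ => ?_)
  · rw [hc₂ ⟨a, ha⟩ ⟨b, hb⟩]
    exact NNReal.coe_nonneg _
  have hA₃ := hA₂.frame hF₃ (by decide) (by decide)
  have hg₃ := hg₂.congr (hF₃.real 3 (by decide))
  have hopt' : ∀ π', cost O.z O.lip (rematch A π) g ≤ cost O.z O.lip (rematch A π') g := by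
    intro π'
    rw [← NNReal.coe_le_coe, cost_rematch, cost_rematch]
    simpa only [hc₂] using hopt π'
  refine wp_seq ((wp_sumCosts hA₃.size (by lia) hπ).conseq fun τ₄ hF₄ hsum => ?_)
  have hA₄ := hA₃.frame hF₄ (by decide) (by decide)
  have hg₄ := hg₃.congr (hF₄.real 3 (by decide))
  have hπ₄ : ∀ i : Fin n, τ₄.nat 2 i = π i := by rw [hF₄.nat 2 (by decide)]; exact hπ
  rw [hF₃.real 4 (by decide)] at hsum
  have hsum' : τ₄.real 9 0 0 = cost O.z O.lip (rematch A π) g := by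
    rw [hsum, cost_rematch]
    simp only [hc₂]
  have e29 : τ₄.nat 29 = σ.nat 29 := by
    rw [hF₄.nat 29 (by decide), hF₃.nat 29 (by decide), hF₂.nat 29 (by decide),
      hF₁.nat 29 (by simp [loadMotion, Prog.natWrites])]
  have e1 : τ₄.nat 1 = σ.nat 1 := by
    rw [hF₄.nat 1 (by decide), hF₃.nat 1 (by decide), hF₂.nat 1 (by decide),
      hF₁.nat 1 (by simp [loadMotion, Prog.natWrites])]
  have e8 : τ₄.real 8 = σ.real 8 := by
    rw [hF₄.real 8 (by decide), hF₃.real 8 (by decide), hF₂.real 8 (by decide),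
      hF₁.real 8 (by simp [loadMotion, Prog.realWrites])]
  have e1' : τ₄.real 1 = σ.real 1 := by
    rw [hF₄.real 1 (by decide), hF₃.real 1 (by decide), hF₂.real 1 (by decide),
      hF₁.real 1 (by simp [loadMotion, Prog.realWrites])]
  refine wp_ite (fun ht => wp_skip ?_) (fun ht => ?_)
  · simp only [Test.holds, NExp.eval, RExp.eval, e29, e8, hsum'] at ht
    rcases h.best with ⟨h0, -⟩ | ⟨h1, out, hout, hD, hcost, hmin⟩
    · lia
    refine ⟨hA₄, Or.inr ⟨by rw [e29, h1], out, ?_, Or.inl hD, by rw [e8, hcost], ?_⟩⟩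
    · simpa only [HoldsOutput, e1, e1'] using hout
    · rintro g' (hg' | rfl) π'
      · exact hmin g' hg' π'
      · refine le_trans ?_ (hopt' π')
        have := ht.2
        rw [hcost] at this
        exact_mod_cast this
  · simp only [Test.holds, NExp.eval, RExp.eval, e29, e8, hsum'] at ht
    refine (wp_copyOutput hA₄.size (by lia) hg₄ hπ₄).conseq fun τ₅ hF₅ ⟨hout, h29, h8⟩ => ?_
    refine ⟨hA₄.frame hF₅ (by decide) (by decide), Or.inr ⟨h29, (g, π), hout, Or.inr rfl,
      by rw [h8, hsum'], ?_⟩⟩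
    rintro g' (hg' | rfl) π'
    · rcases h.best with ⟨-, h0⟩ | ⟨h1, out, -, -, hcost, hmin⟩
      · rw [h0] at hg'; exact absurd hg' (Set.notMem_empty _)
      · refine le_trans ?_ (hmin g' hg' π')
        rw [hcost, h1] at ht
        simp only [le_refl, true_and, not_le] at ht
        exact_mod_cast ht.le
    · exact hopt' π'

/-- The set of the two candidates for three pairs. -/
def candidateSet (a b c : Point × Line) : Set RigidMotion :=
  {candidates a.1 b.1 c.1 a.2 b.2 c.2 1 (.inl rfl), candidates a.1 b.1 c.1 a.2 b.2 c.2 (-1) (.inr rfl)}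

theorem wp_processTuple {σ : Mem} {D : Set RigidMotion} (hB : n + 1 ≤ B) (h : BestOf O A D σ)
    {i₁ i₂ i₃ j₁ j₂ j₃ : Fin n} (h10 : σ.nat 10 0 = i₁) (h11 : σ.nat 11 0 = i₂)
    (h12 : σ.nat 12 0 = i₃) (h13 : σ.nat 13 0 = j₁) (h14 : σ.nat 14 0 = j₂)
    (h15 : σ.nat 15 0 = j₃) :
    Wp B O processTuple σ (BestOf O A (D ∪ candidateSet ((A i₁).1, (A j₁).2) ((A i₂).1, (A j₂).2)
      ((A i₃).1, (A j₃).2))) := by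
  have hA := h.input
  refine wp_seq ((wp_computeCandidates (hA.holdsPoint h10) (hA.holdsPoint h11) (hA.holdsPoint h12)
    (hA.holdsLine h13) (hA.holdsLine h14) (hA.holdsLine h15)).conseq
    fun τ₁ hF₁ ⟨hc₁, hc₂⟩ => ?_)
  have h₁ : BestOf O A D τ₁ := by
    refine ⟨hA.frame hF₁ (by decide) (by decide), ?_⟩
    simp only [HoldsOutput, hF₁.nat 29 (by decide), hF₁.nat 1 (by decide),
      hF₁.real 1 (by decide), hF₁.real 8 (by decide)]
    exact h.best
  refine wp_seq ((wp_processCandidate hB h₁ hc₁).conseq fun τ₂ hF₂ h₂ => ?_)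
  have hc₂' : HoldsCandidate τ₂ 2 (candidates (A i₁).1 (A i₂).1 (A i₃).1 (A j₁).2 (A j₂).2
      (A j₃).2 (-1) (.inr rfl)) := by
    simpa only [HoldsCandidate, hF₂.real 2 (by decide)] using hc₂
  refine (wp_processCandidate hB h₂ hc₂').conseq fun τ₃ _ h₃ => ?_
  rwa [Set.union_assoc, ← Set.insert_eq] at h₃

/-- One rule for all six nested loops. The step is asked for arbitrary `D`, since an inner loop
starts with whatever the earlier iterations have collected. -/
theorem wp_forLoop_union {σ : Mem} {D : Set RigidMotion} {c : ℕ} {body : Prog}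
    (hc : c ≠ 0 ∧ c ≠ 1 ∧ c ≠ 29) (hcb : c ∉ body.natWrites) (h0b : 0 ∉ body.natWrites)
    (hB : n ≤ B) (E : Fin n → Set RigidMotion) (h : BestOf O A D σ)
    (hstep : ∀ i : Fin n, ∀ D τ, Frame (forLoop c (nvar 0) body) σ τ → τ.nat c 0 = i →
      BestOf O A D τ → Wp B O body τ (BestOf O A (D ∪ E i))) :
    Wp B O (forLoop c (nvar 0) body) σ (BestOf O A (D ∪ ⋃ i, E i)) := by
  refine wp_forLoop n (fun m => BestOf O A (D ∪ ⋃ i : Fin n, ⋃ _ : (i : ℕ) < m, E i)) hB hcb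
    (fun τ hF => ?_) ?_ (fun m hm τ hF hcm hI => ?_) (fun τ hF hI => ?_)
  · have : 0 ∉ (forLoop c (nvar 0) body).natWrites := by
      simp [forLoop, Prog.natWrites, h0b, hc.1.symm]
    rw [NExp.eval, NExp.eval, hF.nat 0 this, h.input.size]
  · simpa using h.writeNat 0 hc
  · refine (hstep ⟨m, hm⟩ _ τ hF hcm hI).conseq fun τ' _ h' => ?_
    have := h'.writeNat (m + 1) hc
    convert this using 1
    rw [Set.union_assoc]
    congr 1
    ext g
    simp only [Set.mem_iUnion, Set.mem_union, exists_prop]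
    constructor
    · rintro ⟨i, hi, hg⟩
      rcases Nat.lt_succ_iff_lt_or_eq.1 hi with h | h
      · exact Or.inl ⟨i, h, hg⟩
      · right
        rwa [show (⟨m, hm⟩ : Fin n) = i from Fin.ext h.symm]
    · rintro (⟨i, hi, hg⟩ | hg)
      · exact ⟨i, by lia, hg⟩
      · exact ⟨⟨m, hm⟩, by simp, hg⟩
  · simpa using hI

/-- All candidates. -/
def allCandidates (A : Fin n → Point × Line) : Set RigidMotion :=
  ⋃ (i₁ : Fin n) (i₂ : Fin n) (i₃ : Fin n) (j₁ : Fin n) (j₂ : Fin n) (j₃ : Fin n),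
    candidateSet ((A i₁).1, (A j₁).2) ((A i₂).1, (A j₂).2) ((A i₃).1, (A j₃).2)

theorem wp_alignMatch {σ : Mem} (hB : n + 1 ≤ B) (h : BestOf O A ∅ σ) :
    Wp B O alignMatch σ (BestOf O A (allCandidates A)) := by
  rw [← Set.empty_union (allCandidates A)]
  refine wp_forLoop_union (by decide) (by decide) (by decide) (by lia) _ h
    fun i₁ D₁ τ₁ _ h10 h => ?_
  refine wp_forLoop_union (by decide) (by decide) (by decide) (by lia) _ h
    fun i₂ D₂ τ₂ F₂ h11 h => ?_
  refine wp_forLoop_union (by decide) (by decide) (by decide) (by lia) _ h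
    fun i₃ D₃ τ₃ F₃ h12 h => ?_
  refine wp_forLoop_union (by decide) (by decide) (by decide) (by lia) _ h
    fun j₁ D₄ τ₄ F₄ h13 h => ?_
  refine wp_forLoop_union (by decide) (by decide) (by decide) (by lia) _ h
    fun j₂ D₅ τ₅ F₅ h14 h => ?_
  refine wp_forLoop_union (by decide) (by decide) (by decide) (by lia) _ h
    fun j₃ D₆ τ₆ F₆ h15 h => ?_
  refine wp_processTuple hB h ?_ ?_ ?_ ?_ ?_ h15
  · rw [F₆.nat 10 (by decide), F₅.nat 10 (by decide), F₄.nat 10 (by decide),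
      F₃.nat 10 (by decide), F₂.nat 10 (by decide), h10]
  · rw [F₆.nat 11 (by decide), F₅.nat 11 (by decide), F₄.nat 11 (by decide),
      F₃.nat 11 (by decide), h11]
  · rw [F₆.nat 12 (by decide), F₅.nat 12 (by decide), F₄.nat 12 (by decide), h12]
  · rw [F₆.nat 13 (by decide), F₅.nat 13 (by decide), h13]
  · rw [F₆.nat 14 (by decide), h14]

end

end RealRAM

/-! ### The result of the search as an output of Align+Match -/

namespace PointsToLines

open RealRAM

theorem Line.exists_unit_rep (L : Line) :
    ∃ (v : Point) (b : ℝ), ‖v‖ = 1 ∧ 0 ≤ b ∧ L.carrier = hyperplane v b := by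
  have hn : ‖L.normal‖ ≠ 0 := norm_ne_zero_iff.2 L.normal_ne
  have key : ∀ s : ℝ, s ≠ 0 → L.carrier = hyperplane (s • L.normal) (s * L.offset) := by
    intro s hs
    ext q
    simp only [carrier, hyperplane, Set.mem_ofPred_eq, real_inner_smul_left]
    exact (mul_right_inj' hs).symm
  rcases le_total 0 L.offset with h | h
  · refine ⟨‖L.normal‖⁻¹ • L.normal, ‖L.normal‖⁻¹ * L.offset, ?_, by positivity,
      key _ (inv_ne_zero hn)⟩
    rw [norm_smul, norm_inv, norm_norm, inv_mul_cancel₀ hn]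
  · refine ⟨(-‖L.normal‖⁻¹) • L.normal, -‖L.normal‖⁻¹ * L.offset, ?_, ?_,
      key _ (neg_ne_zero.2 (inv_ne_zero hn))⟩
    · rw [norm_smul, norm_neg, norm_inv, norm_norm, inv_mul_cancel₀ hn]
    · exact mul_nonneg_of_nonpos_of_nonpos (neg_nonpos.2 (by positivity)) h

/-- The program never normalizes the lines. This is harmless, because the eligible sets are
`closest` for every admissible choice of unit normals. -/
theorem isAlignOutput_candidates {m : ℕ} (A : Fin m → Point × Line) :
    IsAlignOutput A {g | ∃ j k l, j ≠ k ∧ g ∈ candidateSet (A j) (A k) (A l)} := by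
  choose v b hv using fun i => (A i).2.exists_unit_rep
  refine ⟨v, b, hv, fun j k l => candidateSet (A j) (A k) (A l), fun j k l _ => ⟨fun h => ?_,
    fun h => ?_⟩, rfl⟩
  · have hd : (A j).2.det (A k).2 ≠ 0 := fun h0 => h ((abs_inner_eq_one_iff (hv j).1 (hv k).1
      (hv j).2.2 (hv k).2.2).2 h0)
    rw [crossingAlignments_eq (fun i => ⟨(hv i).1, (hv i).2.2⟩) l hd]
    simp only [candidateSet, candidates, hd, if_false]
    exact isSelection_candidates _ _ (fun h0 => absurd h0 hd) _
  · have hd : (A j).2.det (A k).2 = 0 := (abs_inner_eq_one_iff (hv j).1 (hv k).1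
      (hv j).2.2 (hv k).2.2).1 h
    rw [parallelAlignments_eq A hd]
    simp only [candidateSet, candidates, hd, if_true]
    exact isSelection_candidates _ _ (fun h0 => hd) _

theorem isAlignMatchOutput_of_best {n : ℕ} {z : ℝ} {lip : ℝ≥0 → ℝ≥0} {A : Fin n → Point × Line}
    {out : RigidMotion × Equiv.Perm (Fin n)} (hout : out.1 ∈ allCandidates A)
    (hbest : ∀ g ∈ allCandidates A, ∀ π,
      cost z lip (rematch A out.2) out.1 ≤ cost z lip (rematch A π) g) :
    IsAlignMatchOutput z lip A out := by
  classical
  have hex : ∀ g, ∃ π, IsOptimalMatching z lip A g π := fun g => by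
    obtain ⟨π, -, h⟩ := Finset.exists_min_image Finset.univ
      (fun π => cost z lip (rematch A π) g) Finset.univ_nonempty
    exact ⟨π, fun σ => h σ (Finset.mem_univ _)⟩
  choose πopt hopt using hex
  have hall : ∀ g, (∃ i j : Fin 3 → Fin n, g ∈ {g | ∃ a b c : Fin 3, a ≠ b ∧ g ∈ candidateSet
      ((A (i a)).1, (A (j a)).2) ((A (i b)).1, (A (j b)).2) ((A (i c)).1, (A (j c)).2)}) ↔
      g ∈ allCandidates A := by
    intro g
    simp only [allCandidates, Set.mem_iUnion]
    constructor
    · rintro ⟨i, j, a, b, c, -, h⟩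
      exact ⟨i a, i b, i c, j a, j b, j c, h⟩
    · rintro ⟨i₁, i₂, i₃, j₁, j₂, j₃, h⟩
      exact ⟨![i₁, i₂, i₃], ![j₁, j₂, j₃], 0, 1, 2, by decide, h⟩
  refine ⟨fun i j => {g | ∃ a b c : Fin 3, a ≠ b ∧ g ∈ candidateSet
      ((A (i a)).1, (A (j a)).2) ((A (i b)).1, (A (j b)).2) ((A (i c)).1, (A (j c)).2)},
    -- The matching has to be a function of the alignment, while the program may meet one alignment
    -- several times and find different matchings; at `out.1` the one that was returned is
    -- prescribed.
    fun g => if g = out.1 then out.2 else πopt g,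
    fun i j => isAlignOutput_candidates fun a => ((A (i a)).1, (A (j a)).2), fun g _ => ?_,
    _, rfl, ⟨(hall _).2 hout, by simp⟩, fun u hu => hbest u.1 ((hall _).1 hu.1) u.2⟩
  by_cases h : g = out.1
  · subst h
    simp only [if_true]
    exact fun σ => hbest _ hout σ
  · simp only [h, if_false]
    exact hopt g

end PointsToLines

end

/-! ### The theorem -/

open PointsToLines in
theorem mainTheorem3 :
    (∀ (n : ℕ) (A : Fin n → Point × Line) (z r : ℝ) (lip : ℝ≥0 → ℝ≥0),
      3 ≤ n → 1 ≤ z → IsLogLipschitz r lip →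
      ∃ opt : ℝ≥0,
        IsLeast (Set.range fun u : RigidMotion × Equiv.Perm (Fin n) =>
          cost z lip (rematch A u.2) u.1) opt ∧
        ∀ out : RigidMotion × Equiv.Perm (Fin n), IsAlignMatchOutput z lip A out →
          cost z lip (rematch A out.2) out.1 ≤ (wFactor z * 16) ^ r * opt) ∧
    (∃ (P : RealRAM.Prog) (K d : ℕ),
      ∀ (n : ℕ) (A : Fin n → Point × Line) (z r : ℝ) (lip : ℝ≥0 → ℝ≥0),
        3 ≤ n → 1 ≤ z → IsLogLipschitz r lip →
        ∃ (τ : RealRAM.Mem) (T : ℕ) (out : RigidMotion × Equiv.Perm (Fin n)),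
          RealRAM.Run ⟨lip, z⟩ P (RealRAM.inputMem A) τ T ∧ T ≤ K * n ^ d ∧
          RealRAM.HoldsOutput τ out ∧ IsAlignMatchOutput z lip A out) := by
  refine ⟨fun n A z r lip hn hz hlip => ?_, ?_⟩
  · have : NeZero n := ⟨by lia⟩
    obtain ⟨g, π, hopt⟩ := exists_optimal A hz hlip
    refine ⟨cost z lip (rematch A π) g, ⟨⟨(g, π), rfl⟩, ?_⟩,
      fun out hout => alignMatch_guarantee hz hlip hout g π⟩
    rintro _ ⟨u, rfl⟩
    exact hopt u.1 u.2
  · obtain ⟨K, d, hK⟩ := RealRAM.alignMatch.exists_timeBound_le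
    -- All loops make at most `n + 1 ≤ 2 n` iterations, whence the factor `2 ^ d`.
    refine ⟨RealRAM.alignMatch, K * 2 ^ d, d, fun n A z r lip hn hz hlip => ?_⟩
    have hstart : RealRAM.BestOf ⟨lip, z⟩ A ∅ (RealRAM.inputMem A) :=
      ⟨⟨by simp [RealRAM.inputMem], rfl⟩, Or.inl ⟨by simp [RealRAM.inputMem], rfl⟩⟩
    obtain ⟨τ, T, hrun, hT, -, hbest⟩ := RealRAM.wp_alignMatch (B := n + 1) le_rfl hstart
    have hne : (RealRAM.allCandidates A).Nonempty := by
      obtain ⟨i⟩ : Nonempty (Fin n) := ⟨⟨0, by lia⟩⟩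
      exact ⟨_, Set.mem_iUnion.2 ⟨i, Set.mem_iUnion.2 ⟨i, Set.mem_iUnion.2 ⟨i, Set.mem_iUnion.2 ⟨i,
        Set.mem_iUnion.2 ⟨i, Set.mem_iUnion.2 ⟨i, Or.inl rfl⟩⟩⟩⟩⟩⟩⟩
    rcases hbest with ⟨-, h0⟩ | ⟨-, out, hout, hmem, -, hmin⟩
    · rw [h0] at hne
      exact absurd hne Set.not_nonempty_empty
    · refine ⟨τ, T, out, hrun, hT.trans ((hK _ (by lia)).trans ?_), hout,
        isAlignMatchOutput_of_best hmem hmin⟩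
      rw [mul_assoc, ← mul_pow]
      exact Nat.mul_le_mul_left _ (Nat.pow_le_pow_left (by lia) _)
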